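/- **Setting.** Let $d\ge 1$, let $V:\mathbb Z^d\to\mathbb R$ be bounded, $\lambda>0$ and $\beta,\mu\in\mathbb R$. On $\ell^2(\mathbb Z^d)$, with standard basis $(\eta_x)_{x\in\mathbb Z^d}$ and unit vectors $e_1,\dots,e_d$ of $\mathbb Z^d$, let $(h\varphi)(x)=-\sum_{|x-y|=1}\varphi(y)+V(x)\varphi(x)$, let $Q_1$ be the position operator $(Q_1\varphi)(x)=x_1\varphi(x)$ on its maximal domain $D(Q_1)$, and let $f_{\beta,\mu}(\varepsilon)=1/(1+e^{\beta(\varepsilon-\mu)})$. For $E\in\mathbb R$ let $h_E$ be the self-adjoint closure of $h-EQ_1$ on $D(Q_1)$. Let $\mathcal A$ be the CAR algebra over $\ell^2(\mathbb Z^d)$: the nonzero $C^*$-algebra generated by $a(f)$ (antilinear in $f$) and $a^*(f)=a(f)^*$ with $\{a^*(f),a(g)\}=\langle g,f\rangle 1$, $\{a(f),a(g)\}=0$. Write $a_x=a(\eta_x)$, let $\theta$ be the automorphism $a^{\#}(f)\mapsto -a^{\#}(f)$, and let $\delta_E$ be the generator of the automorphism group $a^{\#}(f)\mapsto a^{\#}(e^{ith_E}f)$,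 where $a^\#$ stands for $a$ or $a^*$. For $N\in\mathbb N$ let $\Lambda_N=[-N,N]^d\cap\mathbb Z^d$, let $h_N$ be the compression of $h$ to $\ell^2(\Lambda_N)$, and let $(\varphi_n)$ be an arbitrary orthonormal basis of $\ell^2(\Lambda_N)$ with $h_N\varphi_n=\varepsilon_n\varphi_n$. Davies' dissipative dynamics in the box, $T^{E,N}_t$, $t\ge0$, is the quantum dynamical semigroup (strongly continuous semigroup of unital completely positive maps) on $\mathcal A$ generated by $$L_N(A)=\delta_E(A)+\lambda\sum_n f_{\beta,\mu}(\varepsilon_n)\bigl(2a(\varphi_n)\theta(A)a^*(\varphi_n)-a(\varphi_n)a^*(\varphi_n)A-A\,a(\varphi_n)a^*(\varphi_n)\bigr)$$ $$\qquad+\lambda\sum_n (1-f_{\beta,\mu}(\varepsilon_n))\bigl(2a^*(\varphi_n)\theta(A)a(\varphi_n)-a^*(\varphi_n)a(\varphi_n)A-A\,a^*(\varphi_n)a(\varphi_n)\bigr),\qquad D(L_N)=D(\delta_E).$$ **Theorem.** For every $E\in\mathbb R$ the limit $T^{E}_t(A)=\lim_{N\to\infty}T^{E,N}_t(A)$ exists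 in norm for all $A\in\mathcal A$, $t\ge 0$, and defines a quantum dynamical semigroup. For every $E$ there is a state $\omega^{\lambda,E}_{\beta,\mu}$ on $\mathcal A$, the non-equilibrium steady state, such that $\psi(T^E_t(A))\to\omega^{\lambda,E}_{\beta,\mu}(A)$ as $t\to\infty$ for all $A\in\mathcal A$ and every initial state $\psi$ (in particular for the equilibrium state). For $x\in\mathbb Z^d$ let the current observable in the direction $e_1$ be the average of the particle flow from $x-e_1$ to $x$ and the particle flow from $x$ to $x+e_1$, $$\hat\jmath_{1,x}=\tfrac{i}{2}\bigl(a^*_xa_{x-e_1}-a^*_{x-e_1}a_x+a^*_{x+e_1}a_x-a^*_xa_{x+e_1}\bigr),$$ and let $j^{\lambda}_{1,x}(E;\beta,\mu)=\omega^{\lambda,E}_{\beta,\mu}(\hat\jmath_{1,x})$ be the steady-state current. Then the operator $f_{\beta,\mu}(h)$ maps $D(Q_1)$ into itself, the commutators $[Q_1,f_{\beta,\mu}(h)]$ and $v_1=i[h,Q_1]$, defined on $D(Q_1)$, extend to bounded operators on $\ell^2(\mathbb Z^d)$, and $v_1$ does not depend on $V$. For every $x\in\mathbb Z^d$ the function $E\mapsto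 j^{\lambda}_{1,x}(E;\beta,\mu)$ is differentiable at $E=0$, and its derivative, the conductivity, is $$\sigma=\mathrm{Re}\int_0^\infty e^{-2\lambda s}\,\bigl\langle \eta_x,\;e^{-ish}\,i[Q_1,f_{\beta,\mu}(h)]\,e^{ish}\,v_1\,\eta_x\bigr\rangle\,ds,$$ where the integral converges absolutely. -/

import Mathlib

open Filter Topology Complex
open scoped NNReal ComplexOrder

namespace Davies

/-- The lattice `ℤ^d`. -/
abbrev Lattice (d : ℕ) : Type := Fin d → ℤ

/-- The one-particle Hilbert space `ℓ²(ℤ^d)`. -/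
abbrev OneParticle (d : ℕ) : Type := lp (fun _ : Lattice d => ℂ) 2

theorem memlp_two_iff {d : ℕ} (g : Lattice d → ℂ) :
    Memℓp g 2 ↔ Summable fun x => ‖g x‖ ^ 2 := by
  rw [memℓp_gen_iff (by norm_num)]
  simp

theorem norm_sq_eq_tsum {d : ℕ} (φ : OneParticle d) : ‖φ‖ ^ 2 = ∑' x, ‖φ x‖ ^ 2 := by
  have := lp.norm_rpow_eq_tsum (p := 2) (by norm_num) φ
  simpa using this

theorem summable_norm_sq {d : ℕ} (φ : OneParticle d) : Summable fun x => ‖φ x‖ ^ 2 :=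
  (memlp_two_iff _).1 φ.2

theorem weighted_bound {d : ℕ} (σ : Lattice d ≃ Lattice d) (m : Lattice d → ℂ) {C : ℝ}
    (hm : ∀ x, ‖m x‖ ≤ C) (φ : OneParticle d) :
    Summable (fun x => ‖m x * φ (σ x)‖ ^ 2) ∧
      ∑' x, ‖m x * φ (σ x)‖ ^ 2 ≤ (C * ‖φ‖) ^ 2 := by
  have h1 : ∀ x, ‖m x * φ (σ x)‖ ^ 2 ≤ C ^ 2 * ‖φ (σ x)‖ ^ 2 := fun x => by
    rw [norm_mul, mul_pow]
    gcongr
    exact hm x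
  have h2 : Summable fun x => ‖φ (σ x)‖ ^ 2 := (Equiv.summable_iff σ).2 (summable_norm_sq φ)
  have h3 := Summable.of_nonneg_of_le (fun x => by positivity) h1 (h2.mul_left (C ^ 2))
  refine ⟨h3, (h3.tsum_le_tsum h1 (h2.mul_left _)).trans ?_⟩
  rw [tsum_mul_left, Equiv.tsum_eq σ (fun x => ‖φ x‖ ^ 2), ← norm_sq_eq_tsum, mul_pow]

/-- The bounded operator `(T φ)(x) = m(x) φ(σ x)` on `ℓ²(ℤ^d)`, for a bijection `σ` of `ℤ^d` and a
bounded function `m`. -/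
noncomputable def weightedShift {d : ℕ} (σ : Lattice d ≃ Lattice d) (m : Lattice d → ℂ)
    (hm : ∃ C, ∀ x, ‖m x‖ ≤ C) : OneParticle d →L[ℂ] OneParticle d :=
  LinearMap.mkContinuousOfExistsBound
    { toFun := fun φ => ⟨fun x => m x * φ (σ x),
        (memlp_two_iff _).2 (weighted_bound σ m hm.choose_spec φ).1⟩
      map_add' := fun φ ψ => by
        ext x
        exact mul_add _ _ _
      map_smul' := fun z φ => by
        ext x
        exact mul_left_comm _ _ _ }
    (by
      obtain ⟨C, hC⟩ := hm
      refine ⟨C, fun φ => ?_⟩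
      have hC0 : 0 ≤ C := (norm_nonneg _).trans (hC 0)
      refine abs_le_of_sq_le_sq' ?_ (by positivity) |>.2
      rw [norm_sq_eq_tsum]
      exact (weighted_bound σ m hC φ).2)

@[simp] theorem weightedShift_apply {d : ℕ} (σ : Lattice d ≃ Lattice d) (m : Lattice d → ℂ)
    (hm : ∃ C, ∀ x, ‖m x‖ ≤ C) (φ : OneParticle d) (x : Lattice d) :
    weightedShift σ m hm φ x = m x * φ (σ x) := rfl

/-- The translation `(S_v φ)(x) = φ(x + v)`. -/
noncomputable def translation {d : ℕ} (v : Lattice d) : OneParticle d →L[ℂ] OneParticle d :=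
  weightedShift (Equiv.addRight v) (fun _ => 1) ⟨1, by simp⟩

@[simp] theorem translation_apply {d : ℕ} (v : Lattice d) (φ : OneParticle d) (x : Lattice d) :
    translation v φ x = φ (x + v) := by
  simp [translation]

/-- Multiplication by a bounded real potential `V`. -/
noncomputable def potentialOp {d : ℕ} (V : Lattice d → ℝ) (hV : ∃ C, ∀ x, |V x| ≤ C) :
    OneParticle d →L[ℂ] OneParticle d :=
  weightedShift (Equiv.refl _) (fun x => (V x : ℂ)) (by simpa using hV)

@[simp] theorem potentialOp_apply {d : ℕ} (V : Lattice d → ℝ) (hV : ∃ C, ∀ x, |V x| ≤ C)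
    (φ : OneParticle d) (x : Lattice d) : potentialOp V hV φ x = V x * φ x := by
  simp [potentialOp]

/-- The unit vector of `ℤ^d` in the direction `j`. -/
def unitVec {d : ℕ} (j : Fin d) : Lattice d := Pi.single j 1

/-- The one-particle Hamiltonian `(h φ)(x) = - ∑_{|x-y|=1} φ(y) + V(x) φ(x)`; the nearest
neighbours of `x` are the points `x + e_j` and `x - e_j`. -/
noncomputable def hamiltonian {d : ℕ} (V : Lattice d → ℝ) (hV : ∃ C, ∀ x, |V x| ≤ C) :
    OneParticle d →L[ℂ] OneParticle d :=
  -(∑ j, (translation (unitVec j) + translation (-unitVec j))) + potentialOp V hV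

theorem sum_coe_apply {d : ℕ} {ι : Type*} (s : Finset ι) (f : ι → OneParticle d) (x : Lattice d) :
    (∑ i ∈ s, f i : OneParticle d) x = ∑ i ∈ s, f i x :=
  map_sum (lp.evalₗ (𝕜 := ℂ) (fun _ : Lattice d => ℂ) 2 x) f s

theorem hamiltonian_apply {d : ℕ} (V : Lattice d → ℝ) (hV : ∃ C, ∀ x, |V x| ≤ C)
    (φ : OneParticle d) (x : Lattice d) :
    hamiltonian V hV φ x =
      -(∑ j, (φ (x + unitVec j) + φ (x - unitVec j))) + V x * φ x := by
  have h : hamiltonian V hV φ = -(∑ j, (translation (unitVec j) φ + translation (-unitVec j) φ))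
      + potentialOp V hV φ := by
    simp [hamiltonian]
  have h' : hamiltonian V hV φ x =
      -((∑ j, (translation (unitVec j) φ + translation (-unitVec j) φ) : OneParticle d) x)
        + potentialOp V hV φ x := by
    rw [h]
    rfl
  rw [h', sum_coe_apply, potentialOp_apply]
  congr 2
  refine Finset.sum_congr rfl fun j _ => ?_
  rw [sub_eq_add_neg, ← translation_apply (unitVec j), ← translation_apply (-unitVec j)]
  rfl

/-- The standard basis vector `η_x` of `ℓ²(ℤ^d)`. -/
noncomputable def basisVec {d : ℕ} (x : Lattice d) : OneParticle d := lp.single 2 x 1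

/-- The position operator `(Q₁ φ)(x) = x₁ φ(x)` with its maximal domain
`{φ | ∑ |x₁|² |φ(x)|² < ∞}`; the first coordinate is the one with index `0`. -/
noncomputable def positionOp (d : ℕ) [NeZero d] : OneParticle d →ₗ.[ℂ] OneParticle d where
  domain :=
    { carrier := {φ | Memℓp (fun x : Lattice d => (x 0 : ℂ) * φ x) 2}
      add_mem' := fun {φ ψ} hφ hψ => by
        have := Memℓp.add hφ hψ
        simpa [Pi.add_def, mul_add] using this
      zero_mem' := by
        have h0 : Memℓp (fun _ : Lattice d => (0 : ℂ)) 2 := zero_memℓp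
        simpa using h0
      smul_mem' := fun z φ hφ => by
        have := Memℓp.const_smul hφ z
        simpa [Pi.smul_def, mul_left_comm] using this }
  toFun :=
    { toFun := fun φ => ⟨fun x => (x 0 : ℂ) * (φ : OneParticle d) x, φ.2⟩
      map_add' := fun φ ψ => by
        ext x
        exact mul_add _ _ _
      map_smul' := fun z φ => by
        ext x
        exact mul_left_comm _ _ _ }

theorem mem_positionOp_domain {d : ℕ} [NeZero d] (φ : OneParticle d) :
    φ ∈ (positionOp d).domain ↔ Summable fun x : Lattice d => ‖(x 0 : ℂ) * φ x‖ ^ 2 :=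
  memlp_two_iff _

theorem positionOp_apply {d : ℕ} [NeZero d] (φ : (positionOp d).domain) (x : Lattice d) :
    positionOp d φ x = (x 0 : ℂ) * (φ : OneParticle d) x := rfl

/-- The one-particle Hamiltonian `h_E = h - E Q₁` in a uniform field `E`, with domain `D(Q₁)`. -/
noncomputable def fieldHamiltonian {d : ℕ} [NeZero d] (V : Lattice d → ℝ)
    (hV : ∃ C, ∀ x, |V x| ≤ C) (E : ℝ) : OneParticle d →ₗ.[ℂ] OneParticle d where
  domain := (positionOp d).domain
  toFun := (hamiltonian V hV : OneParticle d →ₗ[ℂ] OneParticle d) ∘ₗ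
      (positionOp d).domain.subtype - (E : ℂ) • (positionOp d).toFun

/-- `U` is the unitary group `e^{itK}` of the operator `K`: a strongly continuous one-parameter
unitary group whose generator extends `i K`. If `K` is essentially self-adjoint, as `h_E` on
`D(Q₁)` is, there is only one such group, namely `e^{itK̄}` with `K̄` the closure of `K`. -/
structure IsUnitaryGroupOf {d : ℕ} (K : OneParticle d →ₗ.[ℂ] OneParticle d)
    (U : ℝ → OneParticle d ≃ₗᵢ[ℂ] OneParticle d) : Prop where
  map_zero : ∀ φ, U 0 φ = φ
  map_add : ∀ s t φ, U (s + t) φ = U s (U t φ)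
  continuous : ∀ φ, Continuous fun t => U t φ
  hasDerivAt : ∀ φ : K.domain, HasDerivAt (fun t => U t φ) (I • K φ) 0


section ODE

theorem summable_dyson_bound (B : Type*) [NormedRing B] (K R : ℝ) :
    Summable fun n : ℕ => ‖(1 : B)‖ * (K ^ n * R ^ n / n.factorial) := by
  refine Summable.mul_left _ ?_
  simpa [mul_pow] using Real.summable_pow_div_factorial (K * R)

theorem exists_bound_of_continuous {B : Type*} [NormedRing B] {k : ℝ → B} (hk : Continuous k) (R : ℝ) :
    ∃ K, ∀ t, |t| ≤ R → ‖k t‖ ≤ K := by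
  obtain ⟨K, hK⟩ := (isCompact_closedBall (0 : ℝ) R).exists_bound_of_continuousOn hk.continuousOn
  exact ⟨K, fun t ht => hK t (by simpa using ht)⟩

variable {B : Type*} [NormedRing B] [NormedAlgebra ℝ B] [CompleteSpace B]

/-- The terms of the time-ordered exponential series of `k`. -/
noncomputable def dysonTerm (k : ℝ → B) : ℕ → ℝ → B
  | 0 => fun _ => 1
  | n + 1 => fun t => ∫ s in (0 : ℝ)..t, k s * dysonTerm k n s

/-- The time-ordered exponential series of `k`. -/
noncomputable def dysonSum (k : ℝ → B) (t : ℝ) : B := ∑' n, dysonTerm k n t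

theorem dysonTerm_hasDerivAt {k : ℝ → B} (hk : Continuous k) (n : ℕ) (t : ℝ) :
    HasDerivAt (dysonTerm k (n + 1)) (k t * dysonTerm k n t) t := by
  have hc : Continuous (dysonTerm k n) := by
    induction n with
    | zero => exact continuous_const
    | succ n ih =>
      refine continuous_iff_continuousAt.2 fun t => ?_
      exact ((hk.mul ih).integral_hasStrictDerivAt 0 t).hasDerivAt.continuousAt
  exact ((hk.mul hc).integral_hasStrictDerivAt 0 t).hasDerivAt

theorem dysonTerm_continuous {k : ℝ → B} (hk : Continuous k) (n : ℕ) :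
    Continuous (dysonTerm k n) := by
  cases n with
  | zero => exact continuous_const
  | succ n => exact continuous_iff_continuousAt.2 fun t => (dysonTerm_hasDerivAt hk n t).continuousAt

theorem dysonTerm_bound {k : ℝ → B} (hk : Continuous k) {K R : ℝ}
    (hK : ∀ t, |t| ≤ R → ‖k t‖ ≤ K) (n : ℕ) (t : ℝ) (ht : |t| ≤ R) :
    ‖dysonTerm k n t‖ ≤ ‖(1 : B)‖ * (K ^ n * |t| ^ n / n.factorial) := by
  have hK0 : 0 ≤ K := (norm_nonneg _).trans (hK t ht)
  induction n generalizing t with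
  | zero => simp [dysonTerm]
  | succ n ih =>
    refine (intervalIntegral.norm_integral_le_integral_norm_uIoc).trans ?_
    have hpt : ∀ s, |s| ≤ R → ‖k s * dysonTerm k n s‖ ≤
        (‖(1 : B)‖ * K ^ (n + 1) / n.factorial) * |s - 0| ^ n := fun s hs => by
      calc ‖k s * dysonTerm k n s‖ ≤ ‖k s‖ * ‖dysonTerm k n s‖ := norm_mul_le _ _
        _ ≤ K * (‖(1 : B)‖ * (K ^ n * |s| ^ n / n.factorial)) := by
            gcongr
            · exact hK s hs
            · exact ih s hs
        _ = _ := by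
            rw [sub_zero]
            ring
    have hcont : Continuous fun s => k s * dysonTerm k n s := hk.mul (dysonTerm_continuous hk n)
    calc ∫ s in Set.uIoc 0 t, ‖k s * dysonTerm k n s‖
        ≤ ∫ s in Set.uIoc 0 t, (‖(1 : B)‖ * K ^ (n + 1) / n.factorial) * |s - 0| ^ n := by
          refine MeasureTheory.setIntegral_mono_on ?_ ?_ measurableSet_uIoc fun s hs => hpt s ?_
          · exact hcont.norm.integrableOn_uIoc
          · exact Continuous.integrableOn_uIoc (by fun_prop)
          · refine le_trans ?_ ht
            simpa using Set.abs_sub_left_of_mem_uIcc (Set.uIoc_subset_uIcc hs)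
      _ = _ := by
          rw [MeasureTheory.integral_const_mul, integral_pow_abs_sub_uIoc, sub_zero,
            Nat.factorial_succ]
          push_cast
          field_simp

theorem summable_dysonTerm {k : ℝ → B} (hk : Continuous k) (t : ℝ) :
    Summable fun n => dysonTerm k n t := by
  obtain ⟨K, hK⟩ := exists_bound_of_continuous hk |t|
  exact Summable.of_norm_bounded (summable_dyson_bound B K |t|)
    fun n => dysonTerm_bound hk hK n t le_rfl

theorem dysonSum_zero {k : ℝ → B} (hk : Continuous k) : dysonSum k 0 = 1 := by
  rw [dysonSum, (summable_dysonTerm hk 0).tsum_eq_zero_add]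
  simp [dysonTerm]

/-- The series solves the linear differential equation `W' = k W`. -/
theorem hasDerivAt_dysonSum {k : ℝ → B} (hk : Continuous k) (t : ℝ) :
    HasDerivAt (dysonSum k) (k t * dysonSum k t) t := by
  obtain ⟨K, hK⟩ := exists_bound_of_continuous hk (|t| + 1)
  have hK0 : 0 ≤ K := (norm_nonneg _).trans (hK 0 (by simp; positivity))
  have hz : ∀ n, dysonTerm k (n + 1) 0 = 0 := fun n => by simp [dysonTerm]
  have e : dysonSum k = fun t => 1 + ∑' n, dysonTerm k (n + 1) t := by
    funext t
    rw [dysonSum, (summable_dysonTerm hk t).tsum_eq_zero_add]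
    simp [dysonTerm]
  have hder := hasDerivAt_tsum_of_isPreconnected (𝕜 := ℝ)
    (g := fun n t => dysonTerm k (n + 1) t) (g' := fun n t => k t * dysonTerm k n t)
    (u := fun n => K * (‖(1 : B)‖ * (K ^ n * (|t| + 1) ^ n / n.factorial)))
    (t := Metric.ball (0 : ℝ) (|t| + 1)) (y₀ := 0) (y := t)
    ((summable_dyson_bound B K _).mul_left _) Metric.isOpen_ball
    (convex_ball _ _).isPreconnected
    (fun n y _ => dysonTerm_hasDerivAt hk n y)
    (fun n y hy => by
      have hy' : |y| ≤ |t| + 1 := by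
        rw [Metric.mem_ball, dist_zero_right, Real.norm_eq_abs] at hy
        exact hy.le
      calc ‖k y * dysonTerm k n y‖ ≤ ‖k y‖ * ‖dysonTerm k n y‖ := norm_mul_le _ _
        _ ≤ K * (‖(1 : B)‖ * (K ^ n * |y| ^ n / n.factorial)) := by
            gcongr
            · exact hK y hy'
            · exact dysonTerm_bound hk hK n y hy'
        _ ≤ _ := by gcongr)
    (Metric.mem_ball_self (by positivity))
    (by simp [hz])
    (by simp)
  have h1 : k t * dysonSum k t = ∑' n, k t * dysonTerm k n t :=
    ((summable_dysonTerm hk t).tsum_mul_left _).symm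
  rw [h1, e]
  simpa using hder.const_add 1

end ODE

theorem inner_eq {d : ℕ} (φ ψ : OneParticle d) :
    inner ℂ φ ψ = ∑' x, ψ x * starRingEnd ℂ (φ x) := by
  rw [lp.inner_eq_tsum]
  rfl

theorem star_weightedShift {d : ℕ} (σ : Lattice d ≃ Lattice d) (m : Lattice d → ℂ)
    (hm : ∃ C, ∀ x, ‖m x‖ ≤ C) (m' : Lattice d → ℂ) (hm' : ∃ C, ∀ x, ‖m' x‖ ≤ C)
    (h : ∀ x, m' (σ x) = starRingEnd ℂ (m x)) :
    star (weightedShift σ m hm) = weightedShift σ.symm m' hm' := by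
  rw [ContinuousLinearMap.star_eq_adjoint]
  symm
  rw [ContinuousLinearMap.eq_adjoint_iff]
  intro φ ψ
  rw [inner_eq, inner_eq, ← Equiv.tsum_eq σ]
  refine tsum_congr fun x => ?_
  simp only [weightedShift_apply, Equiv.symm_apply_apply, map_mul, h, RingHomCompTriple.comp_apply,
    RingHom.id_apply]
  ring

theorem star_translation {d : ℕ} (v : Lattice d) :
    star (translation v) = translation (-v) := by
  rw [translation, star_weightedShift _ _ _ (fun _ => 1) ⟨1, by simp⟩ (by simp)]
  ext φ x
  simp [Equiv.addRight]

theorem star_potentialOp {d : ℕ} (V : Lattice d → ℝ) (hV : ∃ C, ∀ x, |V x| ≤ C) :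
    star (potentialOp V hV) = potentialOp V hV := by
  rw [potentialOp, star_weightedShift _ _ _ (fun x => (V x : ℂ)) (by simpa using hV) (by simp)]
  rfl

theorem star_hamiltonian {d : ℕ} (V : Lattice d → ℝ) (hV : ∃ C, ∀ x, |V x| ≤ C) :
    star (hamiltonian V hV) = hamiltonian V hV := by
  simp only [hamiltonian, star_add, star_neg, star_sum, star_translation, star_potentialOp, neg_neg]
  simp_rw [add_comm]

/-- `e^{-itEQ₁}`. -/
noncomputable def fieldPhase (d : ℕ) [NeZero d] (E t : ℝ) : OneParticle d →L[ℂ] OneParticle d :=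
  weightedShift (Equiv.refl _) (fun x => Complex.exp (-((t * E * x 0 : ℝ) : ℂ) * I))
    ⟨1, fun x => by
      rw [← Complex.ofReal_neg, Complex.norm_exp_ofReal_mul_I]⟩

theorem fieldPhase_apply {d : ℕ} [NeZero d] (E t : ℝ) (φ : OneParticle d) (x : Lattice d) :
    fieldPhase d E t φ x = Complex.exp (-((t * E * x 0 : ℝ) : ℂ) * I) * φ x := rfl

theorem fieldPhase_zero {d : ℕ} [NeZero d] (E : ℝ) : fieldPhase d E 0 = 1 := by
  ext φ x
  simp [fieldPhase_apply]

theorem fieldPhase_add {d : ℕ} [NeZero d] (E s t : ℝ) :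
    fieldPhase d E (s + t) = fieldPhase d E s * fieldPhase d E t := by
  ext φ x
  rw [mul_apply_eq_comp, fieldPhase_apply, fieldPhase_apply, fieldPhase_apply,
    ← mul_assoc, ← Complex.exp_add]
  congr 2
  push_cast
  ring

theorem star_fieldPhase {d : ℕ} [NeZero d] (E t : ℝ) :
    star (fieldPhase d E t) = fieldPhase d E (-t) := by
  rw [fieldPhase, star_weightedShift _ _ _
    (fun x => Complex.exp (-((-t * E * x 0 : ℝ) : ℂ) * I))
    ⟨1, fun x => by rw [← Complex.ofReal_neg, Complex.norm_exp_ofReal_mul_I]⟩]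
  · rfl
  · intro x
    rw [← Complex.exp_conj]
    simp

theorem fieldPhase_neg_mul {d : ℕ} [NeZero d] (E t : ℝ) :
    fieldPhase d E (-t) * fieldPhase d E t = 1 := by
  rw [← fieldPhase_add, neg_add_cancel, fieldPhase_zero]

theorem fieldPhase_mul_neg {d : ℕ} [NeZero d] (E t : ℝ) :
    fieldPhase d E t * fieldPhase d E (-t) = 1 := by
  rw [← fieldPhase_add, add_neg_cancel, fieldPhase_zero]

theorem norm_apply_of_star_mul {d : ℕ} {T : OneParticle d →L[ℂ] OneParticle d}
    (h : star T * T = 1) (φ : OneParticle d) : ‖T φ‖ = ‖φ‖ := by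
  have h1 : inner ℂ (T φ) (T φ) = inner ℂ φ φ := by
    rw [← ContinuousLinearMap.adjoint_inner_left, ← ContinuousLinearMap.star_eq_adjoint,
      ← mul_apply_eq_comp, h]
    rfl
  rw [inner_self_eq_norm_sq_to_K, inner_self_eq_norm_sq_to_K] at h1
  have h2 : ‖T φ‖ ^ 2 = ‖φ‖ ^ 2 := by exact_mod_cast h1
  exact (pow_left_inj₀ (norm_nonneg _) (norm_nonneg _) two_ne_zero).1 h2

theorem norm_fieldPhase_apply {d : ℕ} [NeZero d] (E t : ℝ) (φ : OneParticle d) :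
    ‖fieldPhase d E t φ‖ = ‖φ‖ :=
  norm_apply_of_star_mul (by rw [star_fieldPhase, fieldPhase_neg_mul]) φ

/-- The Hamiltonian `e^{itEQ₁} h e^{-itEQ₁}`. -/
noncomputable def rotatedHamiltonian {d : ℕ} [NeZero d] (V : Lattice d → ℝ)
    (hV : ∃ C, ∀ x, |V x| ≤ C) (E t : ℝ) : OneParticle d →L[ℂ] OneParticle d :=
  fieldPhase d E (-t) * hamiltonian V hV * fieldPhase d E t

theorem fieldPhase_conj_translation {d : ℕ} [NeZero d] (E t : ℝ) (v : Lattice d) :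
    fieldPhase d E (-t) * translation v * fieldPhase d E t =
      Complex.exp (-((t * E * v 0 : ℝ) : ℂ) * I) • translation v := by
  ext φ x
  show fieldPhase d E (-t) (translation v (fieldPhase d E t φ)) x =
    Complex.exp (-((t * E * v 0 : ℝ) : ℂ) * I) * translation v φ x
  rw [fieldPhase_apply, translation_apply, fieldPhase_apply, translation_apply, ← mul_assoc,
    ← Complex.exp_add]
  congr 2
  simp only [Pi.add_apply]
  push_cast
  ring

theorem fieldPhase_conj_potentialOp {d : ℕ} [NeZero d] (E t : ℝ) (V : Lattice d → ℝ)
    (hV : ∃ C, ∀ x, |V x| ≤ C) :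
    fieldPhase d E (-t) * potentialOp V hV * fieldPhase d E t = potentialOp V hV := by
  ext φ x
  show fieldPhase d E (-t) (potentialOp V hV (fieldPhase d E t φ)) x = potentialOp V hV φ x
  rw [fieldPhase_apply, potentialOp_apply, fieldPhase_apply, potentialOp_apply, mul_left_comm,
    ← mul_assoc (Complex.exp _), ← Complex.exp_add]
  simp

theorem continuous_rotatedHamiltonian {d : ℕ} [NeZero d] (V : Lattice d → ℝ)
    (hV : ∃ C, ∀ x, |V x| ≤ C) (E : ℝ) : Continuous (rotatedHamiltonian V hV E) := by
  have : rotatedHamiltonian V hV E = fun t =>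
      -(∑ j, (Complex.exp (-((t * E * (unitVec j : Lattice d) 0 : ℝ) : ℂ) * I) •
        translation (unitVec j) +
        Complex.exp (-((t * E * (-unitVec j : Lattice d) 0 : ℝ) : ℂ) * I) •
        translation (-unitVec j))) + potentialOp V hV := by
    funext t
    simp only [← fieldPhase_conj_translation]
    rw [rotatedHamiltonian, hamiltonian, mul_add, add_mul, fieldPhase_conj_potentialOp]
    congr 1
    simp only [mul_neg, neg_mul, Finset.mul_sum, Finset.sum_mul, mul_add, add_mul]
  rw [this]
  fun_prop

theorem star_rotatedHamiltonian {d : ℕ} [NeZero d] (V : Lattice d → ℝ)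
    (hV : ∃ C, ∀ x, |V x| ≤ C) (E t : ℝ) :
    star (rotatedHamiltonian V hV E t) = rotatedHamiltonian V hV E t := by
  rw [rotatedHamiltonian, star_mul, star_mul, star_fieldPhase, star_fieldPhase, star_hamiltonian,
    neg_neg, mul_assoc]

theorem rotatedHamiltonian_conj {d : ℕ} [NeZero d] (V : Lattice d → ℝ)
    (hV : ∃ C, ∀ x, |V x| ≤ C) (E s t : ℝ) :
    fieldPhase d E (-t) * rotatedHamiltonian V hV E s * fieldPhase d E t =
      rotatedHamiltonian V hV E (s + t) := by
  rw [rotatedHamiltonian, rotatedHamiltonian, fieldPhase_add, neg_add_rev, fieldPhase_add]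
  simp only [mul_assoc]

theorem star_mul_const {d : ℕ} {k X Y : ℝ → (OneParticle d →L[ℂ] OneParticle d)}
    (hk : ∀ t, star (k t) = -k t) (hX : ∀ t, HasDerivAt X (k t * X t) t)
    (hY : ∀ t, HasDerivAt Y (k t * Y t) t) (t : ℝ) : star (X t) * Y t = star (X 0) * Y 0 := by
  have h : ∀ t, HasDerivAt (fun t => star (X t) * Y t) 0 t := fun t => by
    have : StarModule ℝ (OneParticle d →L[ℂ] OneParticle d) := ⟨fun r T => by
      have h1 : r • T = (r : ℂ) • T := rfl
      have h2 : r • star T = (r : ℂ) • star T := rfl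
      rw [star_trivial r, h1, h2, star_smul]
      simp⟩
    refine ((hX t).star.mul (hY t)).congr_deriv ?_
    rw [star_mul, hk]
    noncomm_ring
  exact is_const_of_deriv_eq_zero (fun t => (h t).differentiableAt) (fun t => (h t).deriv) t 0

theorem eq_of_linear_ode {d : ℕ} {k X Y : ℝ → (OneParticle d →L[ℂ] OneParticle d)}
    (hk : ∀ t, star (k t) = -k t) (hX : ∀ t, HasDerivAt X (k t * X t) t)
    (hY : ∀ t, HasDerivAt Y (k t * Y t) t) (h0 : X 0 = Y 0) (t : ℝ) : X t = Y t := by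
  rw [← sub_eq_zero, ← CStarRing.star_mul_self_eq_zero_iff]
  rw [star_sub, sub_mul, mul_sub, mul_sub, star_mul_const hk hX hX, star_mul_const hk hX hY,
    star_mul_const hk hY hX, star_mul_const hk hY hY, h0]
  simp

theorem tendsto_weighted {d : ℕ} {m : ℝ → Lattice d → ℂ} (φ : OneParticle d)
    {F : ℝ → OneParticle d} (hF : ∀ t x, F t x = m t x * φ x) {l : Filter ℝ}
    [l.IsCountablyGenerated] {g : Lattice d → ℝ} (hg : Summable fun x => (g x * ‖φ x‖) ^ 2)
    (hb : ∀ t x, ‖m t x‖ ≤ g x) (hm : ∀ x, Tendsto (fun t => m t x) l (𝓝 0)) :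
    Tendsto F l (𝓝 0) := by
  have h : Tendsto (fun t => ‖F t‖ ^ 2) l (𝓝 0) := by
    have : (fun t => ‖F t‖ ^ 2) = fun t => ∑' x, ‖m t x * φ x‖ ^ 2 := by
      funext t
      rw [norm_sq_eq_tsum]
      simp_rw [hF]
    rw [this]
    have h0 : (0 : ℝ) = ∑' _ : Lattice d, (0 : ℝ) := by simp
    rw [h0]
    refine tendsto_tsum_of_dominated_convergence hg (fun x => ?_) (Eventually.of_forall fun t x => ?_)
    · have := ((hm x).mul_const (φ x)).norm.pow 2
      simpa using this
    · rw [Real.norm_eq_abs, abs_of_nonneg (by positivity), norm_mul]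
      gcongr
      exact hb t x
  rw [tendsto_zero_iff_norm_tendsto_zero]
  have := (Real.continuous_sqrt.tendsto 0).comp h
  simpa [Function.comp_def, Real.sqrt_sq] using this

theorem continuous_fieldPhase_apply {d : ℕ} [NeZero d] (E : ℝ) (φ : OneParticle d) :
    Continuous fun t => fieldPhase d E t φ := by
  rw [continuous_iff_continuousAt]
  intro s
  rw [ContinuousAt, tendsto_iff_norm_sub_tendsto_zero, ← tendsto_zero_iff_norm_tendsto_zero]
  refine tendsto_weighted (g := fun _ => 2) φ
    (m := fun t x => Complex.exp (-((t * E * x 0 : ℝ) : ℂ) * I) -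
      Complex.exp (-((s * E * x 0 : ℝ) : ℂ) * I)) (fun t x => ?_) ?_ (fun t x => ?_) (fun x => ?_)
  · rw [sub_mul]
    rfl
  · simpa [mul_pow] using (summable_norm_sq φ).mul_left (2 ^ 2)
  · refine (norm_sub_le _ _).trans ?_
    rw [← Complex.ofReal_neg, ← Complex.ofReal_neg, Complex.norm_exp_ofReal_mul_I,
      Complex.norm_exp_ofReal_mul_I]
    norm_num
  · have : Continuous fun t : ℝ => Complex.exp (-((t * E * x 0 : ℝ) : ℂ) * I) -
      Complex.exp (-((s * E * x 0 : ℝ) : ℂ) * I) := by fun_prop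
    simpa using this.tendsto s

theorem hasDerivAt_fieldPhase_apply {d : ℕ} [NeZero d] (E : ℝ) (φ : (positionOp d).domain) :
    HasDerivAt (fun t => fieldPhase d E t (φ : OneParticle d)) (-(I * E) • positionOp d φ) 0 := by
  rw [hasDerivAt_iff_tendsto_slope_zero, tendsto_iff_norm_sub_tendsto_zero,
    ← tendsto_zero_iff_norm_tendsto_zero]
  refine tendsto_weighted (g := fun x => 2 * |E| * ‖(x 0 : ℂ)‖) (φ : OneParticle d)
    (m := fun t x => (t : ℂ)⁻¹ * (Complex.exp (-((t * E * x 0 : ℝ) : ℂ) * I) - 1)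
      + I * E * x 0) (fun t x => ?_) ?_ (fun t x => ?_) (fun x => ?_)
  · show t⁻¹ • (fieldPhase d E (0 + t) (φ : OneParticle d) x - fieldPhase d E 0 (φ : OneParticle d) x)
        - -(I * E) * ((x 0 : ℂ) * (φ : OneParticle d) x) = _
    rw [fieldPhase_zero, fieldPhase_apply, zero_add, Complex.real_smul, Complex.ofReal_inv]
    show (t : ℂ)⁻¹ * (_ - (φ : OneParticle d) x) - _ = _
    ring
  · have := ((mem_positionOp_domain _).1 φ.2).mul_left ((2 * |E|) ^ 2)
    refine this.congr fun x => ?_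
    rw [norm_mul]
    ring
  · have h1 : ‖(t : ℂ)⁻¹ * (Complex.exp (-((t * E * x 0 : ℝ) : ℂ) * I) - 1)‖ ≤ |E| * ‖(x 0 : ℂ)‖ := by
      rcases eq_or_ne t 0 with rfl | ht
      · simp
        positivity
      rw [norm_mul, norm_inv, Complex.norm_real, Real.norm_eq_abs, inv_mul_le_iff₀ (by positivity),
        ← Complex.ofReal_neg, mul_comm _ I]
      refine (Real.norm_exp_I_mul_ofReal_sub_one_le).trans ?_
      simp [mul_assoc]
    refine (norm_add_le _ _).trans ?_
    have h2 : ‖I * (E : ℂ) * x 0‖ = |E| * ‖(x 0 : ℂ)‖ := by simp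
    rw [h2]
    linarith
  · have h : HasDerivAt (fun t : ℝ => Complex.exp (-((t * E * x 0 : ℝ) : ℂ) * I))
        (-(I * E * x 0)) 0 := by
      have h0 : HasDerivAt (fun t : ℝ => -((t * E * x 0 : ℝ) : ℂ) * I) (-(I * E * x 0)) 0 := by
        have h1 := (((hasDerivAt_id (0 : ℝ)).ofReal_comp.mul_const (E : ℂ)).mul_const
          (x 0 : ℂ)).neg.mul_const I
        refine (h1.congr_deriv ?_).congr_of_eventuallyEq (Eventually.of_forall fun t => ?_)
        · push_cast
          ring
        · simp
      have := h0.cexp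
      simpa using this
    have := (hasDerivAt_iff_tendsto_slope_zero.1 h).add_const (I * (E : ℂ) * x 0)
    simpa [Complex.real_smul] using this

/-- The unitary group of `h_E` exists. -/
theorem exists_unitaryGroup {d : ℕ} [NeZero d] (V : Lattice d → ℝ)
    (hV : ∃ C, ∀ x, |V x| ≤ C) (E : ℝ) :
    ∃ U, IsUnitaryGroupOf (fieldHamiltonian V hV E) U := by
  set k : ℝ → (OneParticle d →L[ℂ] OneParticle d) := fun t => I • rotatedHamiltonian V hV E t with hk
  have hkc : Continuous k := (continuous_rotatedHamiltonian V hV E).const_smul I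
  have hks : ∀ t, star (k t) = -k t := fun t => by
    simp [hk, star_smul, star_rotatedHamiltonian]
  set W := dysonSum k with hWdef
  have hW0 : W 0 = 1 := dysonSum_zero hkc
  have hW : ∀ t, HasDerivAt W (k t * W t) t := hasDerivAt_dysonSum hkc
  have hWi : ∀ t, star (W t) * W t = 1 := fun t => by
    rw [star_mul_const hks hW hW, hW0]
    simp
  have hWg : ∀ s t, W (s + t) = fieldPhase d E (-t) * W s * fieldPhase d E t * W t := fun s t => by
    refine eq_of_linear_ode (k := fun s => k (s + t)) (X := fun s => W (s + t))
      (Y := fun s => fieldPhase d E (-t) * W s * fieldPhase d E t * W t)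
      (fun s => hks _) (fun s => (hW (s + t)).comp_add_const s t) (fun s => ?_) ?_ s
    · have h1 := (((hW s).const_mul (fieldPhase d E (-t))).mul_const (fieldPhase d E t)).mul_const
        (W t)
      refine h1.congr_deriv ?_
      have h2 : k (s + t) = fieldPhase d E (-t) * k s * fieldPhase d E t := by
        simp only [hk, mul_smul_comm, smul_mul_assoc, rotatedHamiltonian_conj]
      rw [h2]
      symm
      calc _ = fieldPhase d E (-t) * k s * (fieldPhase d E t * fieldPhase d E (-t)) * W s *
            fieldPhase d E t * W t := by simp only [mul_assoc]
        _ = _ := by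
            rw [fieldPhase_mul_neg]
            simp only [mul_assoc, one_mul]
    · simp [hW0, fieldPhase_neg_mul]
  set T : ℝ → (OneParticle d →L[ℂ] OneParticle d) := fun t => fieldPhase d E t * W t with hT
  have hT0 : T 0 = 1 := by simp [hT, hW0, fieldPhase_zero]
  have hTg : ∀ s t, T (s + t) = T s * T t := fun s t => by
    simp only [hT]
    rw [hWg, fieldPhase_add]
    calc _ = fieldPhase d E s * (fieldPhase d E t * fieldPhase d E (-t)) * W s *
          fieldPhase d E t * W t := by simp only [mul_assoc]
      _ = _ := by
          rw [fieldPhase_mul_neg]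
          simp only [mul_assoc, one_mul]
  have hTn : ∀ t φ, ‖T t φ‖ = ‖φ‖ := fun t φ => by
    show ‖fieldPhase d E t (W t φ)‖ = ‖φ‖
    rw [norm_fieldPhase_apply, norm_apply_of_star_mul (hWi t)]
  let U : ℝ → OneParticle d ≃ₗᵢ[ℂ] OneParticle d := fun t =>
    LinearIsometryEquiv.ofSurjective ⟨(T t : OneParticle d →ₗ[ℂ] OneParticle d), hTn t⟩ fun φ =>
      ⟨T (-t) φ, by
        show T t (T (-t) φ) = φ
        rw [← mul_apply_eq_comp, ← hTg, add_neg_cancel, hT0]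
        rfl⟩
  have hU : ∀ t φ, U t φ = T t φ := fun t φ => rfl
  have hWc : ∀ φ, Continuous fun t => W t φ := fun φ =>
    continuous_iff_continuousAt.2 fun t =>
      ((ContinuousLinearMap.apply ℂ (OneParticle d) φ).continuous.continuousAt).comp
        (hW t).continuousAt
  refine ⟨U, fun φ => ?_, fun s t φ => ?_, fun φ => ?_, fun φ => ?_⟩
  · rw [hU, hT0]
    rfl
  · simp only [hU, hTg]
    rfl
  · simp only [hU]
    rw [continuous_iff_continuousAt]
    intro s
    have h1 : Tendsto (fun t => fieldPhase d E t (W t φ - W s φ)) (𝓝 s) (𝓝 0) := by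
      rw [tendsto_zero_iff_norm_tendsto_zero]
      simp_rw [norm_fieldPhase_apply]
      rw [← tendsto_iff_norm_sub_tendsto_zero]
      exact (hWc φ).tendsto s
    have h2 := h1.add ((continuous_fieldPhase_apply E (W s φ)).tendsto s)
    rw [zero_add] at h2
    refine h2.congr fun t => ?_
    show fieldPhase d E t (W t φ - W s φ) + fieldPhase d E t (W s φ) = fieldPhase d E t (W t φ)
    rw [← map_add, sub_add_cancel]
  · have hWd : HasDerivAt (fun t => W t (φ : OneParticle d))
        (I • hamiltonian V hV (φ : OneParticle d)) 0 := by
      have h1 := ((ContinuousLinearMap.apply ℂ (OneParticle d)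
        (φ : OneParticle d)).restrictScalars ℝ).hasFDerivAt.comp_hasDerivAt 0 (hW 0)
      have h2 : k 0 * W 0 = I • hamiltonian V hV := by
        simp [hk, hW0, rotatedHamiltonian, fieldPhase_zero]
      rw [h2] at h1
      exact h1
    have h3 : HasDerivAt (fun t => fieldPhase d E t (W t (φ : OneParticle d) - (φ : OneParticle d)))
        (I • hamiltonian V hV (φ : OneParticle d)) 0 := by
      rw [hasDerivAt_iff_tendsto_slope_zero] at hWd ⊢
      have h4 : Tendsto (fun t : ℝ => fieldPhase d E t
          (t⁻¹ • (W (0 + t) (φ : OneParticle d) - W 0 (φ : OneParticle d)) -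
            I • hamiltonian V hV (φ : OneParticle d))) (𝓝[≠] 0) (𝓝 0) := by
        rw [tendsto_zero_iff_norm_tendsto_zero]
        simp_rw [norm_fieldPhase_apply]
        rw [← tendsto_iff_norm_sub_tendsto_zero]
        exact hWd
      have h5 := h4.add (((continuous_fieldPhase_apply E
        (I • hamiltonian V hV (φ : OneParticle d))).tendsto 0).mono_left nhdsWithin_le_nhds)
      rw [zero_add, fieldPhase_zero] at h5
      refine h5.congr fun t => ?_
      rw [← map_add, sub_add_cancel, hW0, zero_add]
      simp only [one_apply_eq_self, sub_self, map_zero, sub_zero]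
      exact ContinuousLinearMap.map_smul_of_tower (fieldPhase d E t) _ _
    have h6 := h3.add (hasDerivAt_fieldPhase_apply E φ)
    have h7 : I • fieldHamiltonian V hV E φ =
        I • hamiltonian V hV (φ : OneParticle d) + -(I * (E : ℂ)) • positionOp d φ := by
      show I • (hamiltonian V hV (φ : OneParticle d) - (E : ℂ) • positionOp d φ) = _
      rw [smul_sub, smul_smul, neg_smul, sub_eq_add_neg]
    rw [h7]
    refine h6.congr_of_eventuallyEq (Eventually.of_forall fun t => ?_)
    show fieldPhase d E t (W t (φ : OneParticle d)) = fieldPhase d E t (W t (φ : OneParticle d) -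
      (φ : OneParticle d)) + fieldPhase d E t (φ : OneParticle d)
    rw [← map_add, sub_add_cancel]

/-- The group `e^{ith_E}`, `t ∈ ℝ`. -/
noncomputable def fieldEvolution {d : ℕ} [NeZero d] (V : Lattice d → ℝ)
    (hV : ∃ C, ∀ x, |V x| ≤ C) (E : ℝ) : ℝ → OneParticle d ≃ₗᵢ[ℂ] OneParticle d :=
  (exists_unitaryGroup V hV E).choose

theorem fieldEvolution_spec {d : ℕ} [NeZero d] (V : Lattice d → ℝ)
    (hV : ∃ C, ∀ x, |V x| ≤ C) (E : ℝ) :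
    IsUnitaryGroupOf (fieldHamiltonian V hV E) (fieldEvolution V hV E) :=
  (exists_unitaryGroup V hV E).choose_spec

section CAR

variable {H : Type*} [NormedAddCommGroup H] [InnerProductSpace ℂ H]

/-- The C*-algebra `A` is the CAR algebra over the Hilbert space `H`: it is generated, as a
C*-algebra, by annihilation operators `a(f)`, antilinear in `f`, and their adjoints `a*(f)`, which
satisfy `{a*(f), a(g)} = ⟨g, f⟩ 1` and `{a(f), a(g)} = 0`. -/
structure CARAlgebra (H : Type*) [NormedAddCommGroup H] [InnerProductSpace ℂ H]
    (A : Type*) [CStarAlgebra A] where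
  /-- The annihilation operators. -/
  ann : H →ₗ⋆[ℂ] A
  star_ann_mul_ann : ∀ f g, star (ann f) * ann g + ann g * star (ann f) = inner ℂ g f • (1 : A)
  ann_mul_ann : ∀ f g, ann f * ann g + ann g * ann f = 0
  generates : (StarAlgebra.adjoin ℂ (Set.range ann)).topologicalClosure = ⊤

namespace CARAlgebra

variable {A : Type*} [CStarAlgebra A] (c : CARAlgebra H A)

/-- The creation operators `a*(f)`. -/
noncomputable def cre (f : H) : A := star (c.ann f)

/-- The linear operators `W` such that `a(f) ↦ a(W f)` is implemented by a unitary of `A`. -/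
def Implemented (W : H →ₗ[ℂ] H) : Prop :=
  ∃ w : A, star w * w = 1 ∧ w * star w = 1 ∧ ∀ f, w * c.ann f * star w = c.ann (W f)

theorem ann_mul_self (f : H) : c.ann f * c.ann f = 0 := by
  have h := c.ann_mul_ann f f
  rw [← two_smul ℂ] at h
  simpa using h

theorem ann_mul_cre (f g : H) :
    c.ann g * star (c.ann f) = inner ℂ g f • (1 : A) - star (c.ann f) * c.ann g :=
  eq_sub_of_add_eq' (c.star_ann_mul_ann f g)

theorem implemented_id : c.Implemented LinearMap.id :=
  ⟨1, by simp, by simp, fun f => by simp⟩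

theorem Implemented.comp {W₁ W₂ : H →ₗ[ℂ] H} (h₁ : c.Implemented W₁) (h₂ : c.Implemented W₂) :
    c.Implemented (W₁ ∘ₗ W₂) := by
  obtain ⟨w₁, h₁, h₁', e₁⟩ := h₁
  obtain ⟨w₂, h₂, h₂', e₂⟩ := h₂
  refine ⟨w₁ * w₂, ?_, ?_, fun f => ?_⟩
  · rw [star_mul, mul_assoc, ← mul_assoc (star w₁), h₁, one_mul, h₂]
  · rw [star_mul, mul_assoc, ← mul_assoc w₂, h₂', one_mul, h₁']
  · rw [LinearMap.comp_apply, ← e₁, ← e₂, star_mul]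
    simp only [mul_assoc]

/-- The rank-one perturbation `f ↦ f + (z - 1) ⟨e, f⟩ e` of the identity. -/
noncomputable def phaseMap (z : ℂ) (e : H) : H →ₗ[ℂ] H :=
  LinearMap.id + (z - 1) • (innerₛₗ ℂ e).smulRight e

theorem phaseMap_apply (z : ℂ) (e f : H) :
    phaseMap z e f = f + ((z - 1) * inner ℂ e f) • e := by
  simp [phaseMap, smul_smul]

theorem implemented_phaseMap {z : ℂ} (hz : starRingEnd ℂ z * z = 1) {e : H}
    (he : inner ℂ e e = (1 : ℂ)) : c.Implemented (phaseMap z e) := by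
  set a := c.ann e with ha
  have haa : a * a = 0 := c.ann_mul_self e
  have hca : a * star a = 1 - star a * a := by
    have := c.ann_mul_cre e e
    rwa [he, one_smul] at this
  have haN : a * (star a * a) = a := by
    rw [← mul_assoc, hca, sub_mul, one_mul, mul_assoc, haa, mul_zero, sub_zero]
  have hNN : (star a * a) * (star a * a) = star a * a := by rw [mul_assoc, haN]
  have hNs : star (star a * a) = star a * a := by simp
  set N := star a * a with hN
  have hws : star (1 + (z - 1) • N) = 1 + (starRingEnd ℂ z - 1) • N := by
    simp [star_smul, hNs]
  have huni : (z - 1) + (starRingEnd ℂ z - 1) + (starRingEnd ℂ z - 1) * (z - 1) = 0 := by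
    linear_combination hz
  refine ⟨1 + (z - 1) • N, ?_, ?_, fun f => ?_⟩
  · rw [hws]
    have : (1 + (starRingEnd ℂ z - 1) • N) * (1 + (z - 1) • N) =
        1 + ((z - 1) + (starRingEnd ℂ z - 1) + (starRingEnd ℂ z - 1) * (z - 1)) • N := by
      simp only [mul_add, add_mul, mul_one, one_mul, smul_mul_smul_comm, hNN]
      module
    rw [this, huni, zero_smul, add_zero]
  · rw [hws]
    have : (1 + (z - 1) • N) * (1 + (starRingEnd ℂ z - 1) • N) =
        1 + ((z - 1) + (starRingEnd ℂ z - 1) + (starRingEnd ℂ z - 1) * (z - 1)) • N := by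
      simp only [mul_add, add_mul, mul_one, one_mul, smul_mul_smul_comm, hNN]
      module
    rw [this, huni, zero_smul, add_zero]
  · set b := c.ann f with hb
    have hab : a * b = -(b * a) := eq_neg_of_add_eq_zero_left (c.ann_mul_ann e f)
    have hba : b * star a = inner ℂ f e • (1 : A) - star a * b := c.ann_mul_cre e f
    have hNb : N * b = b * N - inner ℂ f e • a := by
      have h1 : b * N = inner ℂ f e • a - star a * (b * a) := by
        rw [hN, ← mul_assoc, hba, sub_mul, smul_mul_assoc, one_mul, mul_assoc]
      rw [h1, hN, mul_assoc, hab]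
      simp
    have hbN : b * N * N = b * N := by rw [mul_assoc, hNN]
    rw [hws, phaseMap_apply, map_add, LinearMap.map_smulₛₗ, ← ha, ← hb]
    have h2 : starRingEnd ℂ ((z - 1) * inner ℂ e f) =
        (starRingEnd ℂ z - 1) * inner ℂ f e := by
      simp
    rw [h2]
    have h3 : (1 + (z - 1) • N) * b * (1 + (starRingEnd ℂ z - 1) • N) =
        b + ((z - 1) + (starRingEnd ℂ z - 1) + (starRingEnd ℂ z - 1) * (z - 1)) • (b * N)
          - ((z - 1) * inner ℂ f e * (starRingEnd ℂ z)) • a := by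
      simp only [mul_add, add_mul, mul_one, one_mul, smul_mul_assoc,
        mul_smul_comm, hNb, sub_mul, hbN, haN, smul_sub]
      module
    rw [h3, huni, zero_smul, add_zero, sub_eq_add_neg, ← neg_smul]
    congr 2
    linear_combination (-(inner ℂ f e : ℂ)) * hz

theorem exists_implemented (U : H →ₗᵢ[ℂ] H) (l : List H) :
    ∃ W : H →ₗ[ℂ] H, c.Implemented W ∧ (∀ f g, inner ℂ (W f) (W g) = (inner ℂ f g : ℂ)) ∧
      ∀ f ∈ l, W f = U f := by
  induction l with
  | nil => exact ⟨LinearMap.id, c.implemented_id, fun f g => rfl, by simp⟩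
  | cons g l ih =>
    obtain ⟨W, hW, hi, hl⟩ := ih
    by_cases hg : W g = U g
    · refine ⟨W, hW, hi, ?_⟩
      intro f hf
      rcases List.mem_cons.1 hf with rfl | hf
      · exact hg
      · exact hl f hf
    set x := W g with hx
    set y := U g with hy
    set u := x - y with hu
    have hu0 : u ≠ 0 := sub_ne_zero.2 hg
    have hn0 : (‖u‖ : ℂ) ≠ 0 := by exact_mod_cast norm_ne_zero_iff.2 hu0
    have hxx : inner ℂ x x = (inner ℂ y y : ℂ) := by
      rw [hx, hi, hy, U.inner_map_map]
    have huu : (inner ℂ u u : ℂ) = (‖u‖ : ℂ) ^ 2 := inner_self_eq_norm_sq_to_K u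
    set p : ℂ := inner ℂ u x with hp
    have hpp : p + starRingEnd ℂ p = (‖u‖ : ℂ) ^ 2 := by
      rw [← huu, hp, inner_conj_symm, hu]
      simp only [inner_sub_left, inner_sub_right]
      rw [hxx]
      ring
    have hp0 : p ≠ 0 := fun h0 => by
      rw [h0] at hpp
      simp only [map_zero, add_zero] at hpp
      exact pow_ne_zero 2 hn0 hpp.symm
    set e : H := (‖u‖ : ℂ)⁻¹ • u with he
    have hee : inner ℂ e e = (1 : ℂ) := by
      rw [he, inner_smul_left, inner_smul_right, huu]
      simp
      field_simp
    set z : ℂ := 1 - (‖u‖ : ℂ) ^ 2 / p with hz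
    have hp0' : starRingEnd ℂ p ≠ 0 := by simpa using hp0
    have hzz : starRingEnd ℂ z * z = 1 := by
      have : starRingEnd ℂ z = 1 - (‖u‖ : ℂ) ^ 2 / starRingEnd ℂ p := by simp [hz]
      rw [this, hz]
      field_simp
      rw [← hpp]
      ring
    have hR : ∀ f, phaseMap z e f = f - (inner ℂ u f / p) • u := fun f => by
      rw [phaseMap_apply, he, inner_smul_left, smul_smul, sub_eq_add_neg f, ← neg_smul]
      congr 2
      simp only [hz, map_inv₀, Complex.conj_ofReal]
      field_simp
      ring
    refine ⟨phaseMap z e ∘ₗ W, (c.implemented_phaseMap hzz hee).comp c hW, fun f g' => ?_, ?_⟩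
    · rw [LinearMap.comp_apply, LinearMap.comp_apply, ← hi f g', hR, hR]
      simp only [inner_sub_left, inner_sub_right, inner_smul_left, inner_smul_right, map_div₀,
        inner_conj_symm]
      rw [huu, ← hpp]
      field_simp
      ring
    · intro f hf
      rw [LinearMap.comp_apply, hR]
      rcases List.mem_cons.1 hf with rfl | hf
      · rw [← hx, ← hp, div_self hp0, one_smul, hu, sub_sub_cancel]
      · have : inner ℂ u (W f) = (0 : ℂ) := by
          rw [hu, inner_sub_left, hx, hi, hl f hf, hy, U.inner_map_map, sub_self]
        rw [this, zero_div, zero_smul, sub_zero, hl f hf]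

/-- Every isometry `U` of `H` induces a *-homomorphism of the CAR algebra with
`a(f) ↦ a(U f)`. -/
theorem exists_bogoliubov (U : H →ₗᵢ[ℂ] H) :
    ∃ θ : A →⋆ₐ[ℂ] A, ∀ f, θ (c.ann f) = c.ann (U f) := by
  classical
  have key : ∀ F : Finset H, ∃ w : A, star w * w = 1 ∧ w * star w = 1 ∧
      ∀ f ∈ F, w * c.ann f * star w = c.ann (U f) := fun F => by
    obtain ⟨W, ⟨w, h1, h2, h3⟩, -, hl⟩ := c.exists_implemented U F.toList
    exact ⟨w, h1, h2, fun f hf => by rw [h3, hl f (by simpa using hf)]⟩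
  choose w hw hw' hwa using key
  have hnorm : ∀ F x, ‖w F * x * star (w F)‖ ≤ ‖x‖ := fun F x => by
    have h1 : ‖w F‖ ≤ 1 := by
      have : ‖w F‖ * ‖w F‖ ≤ 1 := by
        rw [← CStarRing.norm_star_mul_self, hw]
        rcases subsingleton_or_nontrivial A with hA | hA
        · simp [Subsingleton.elim (1 : A) 0]
        · simp
      nlinarith [norm_nonneg (w F)]
    calc ‖w F * x * star (w F)‖ ≤ ‖w F‖ * ‖x‖ * ‖star (w F)‖ :=
          (norm_mul_le _ _).trans (by gcongr; exact norm_mul_le _ _)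
      _ ≤ 1 * ‖x‖ * 1 := by
          rw [norm_star]
          gcongr
      _ = ‖x‖ := by ring
  have hconst : ∀ x ∈ StarAlgebra.adjoin ℂ (Set.range c.ann),
      ∃ y, ∀ᶠ F in (atTop : Filter (Finset H)), w F * x * star (w F) = y := by
    intro x hx
    induction hx using StarAlgebra.adjoin_induction with
    | mem x hx =>
      obtain ⟨f, rfl⟩ := hx
      refine ⟨c.ann (U f), ?_⟩
      filter_upwards [eventually_ge_atTop {f}] with F hF
      exact hwa F f (hF (Finset.mem_singleton_self f))
    | algebraMap r =>
      refine ⟨algebraMap ℂ A r, Eventually.of_forall fun F => ?_⟩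
      rw [← Algebra.commutes, mul_assoc, hw', mul_one]
    | add x y _ _ hx hy =>
      obtain ⟨x', hx⟩ := hx
      obtain ⟨y', hy⟩ := hy
      refine ⟨x' + y', ?_⟩
      filter_upwards [hx, hy] with F h1 h2
      rw [← h1, ← h2, mul_add, add_mul]
    | mul x y _ _ hx hy =>
      obtain ⟨x', hx⟩ := hx
      obtain ⟨y', hy⟩ := hy
      refine ⟨x' * y', ?_⟩
      filter_upwards [hx, hy] with F h1 h2
      rw [← h1, ← h2]
      calc _ = w F * x * 1 * y * star (w F) := by simp only [mul_assoc, one_mul]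
        _ = _ := by
            rw [← hw F]
            simp only [mul_assoc]
    | star x _ hx =>
      obtain ⟨x', hx⟩ := hx
      refine ⟨star x', ?_⟩
      filter_upwards [hx] with F h1
      rw [← h1]
      simp [mul_assoc]
  have hlim : ∀ x, ∃ y, Tendsto (fun F => w F * x * star (w F)) atTop (𝓝 y) := by
    intro x
    refine cauchySeq_tendsto_of_complete ?_
    rw [Metric.cauchySeq_iff']
    intro ε hε
    have hx : x ∈ closure (StarAlgebra.adjoin ℂ (Set.range c.ann) : Set A) := by
      have : x ∈ (StarAlgebra.adjoin ℂ (Set.range c.ann)).topologicalClosure := by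
        rw [c.generates]
        trivial
      exact this
    obtain ⟨x', hx', hd⟩ := Metric.mem_closure_iff.1 hx (ε / 2) (by positivity)
    obtain ⟨y, hy⟩ := hconst x' hx'
    obtain ⟨F₀, hF₀⟩ := eventually_atTop.1 hy
    refine ⟨F₀, fun F hF => ?_⟩
    have hb : ∀ F, dist (w F * x * star (w F)) (w F * x' * star (w F)) < ε / 2 := fun F => by
      rw [dist_eq_norm, ← sub_mul, ← mul_sub]
      exact (hnorm F _).trans_lt (by rwa [← dist_eq_norm])
    calc dist (w F * x * star (w F)) (w F₀ * x * star (w F₀))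
        ≤ dist (w F * x * star (w F)) (w F * x' * star (w F)) +
          dist (w F * x' * star (w F)) (w F₀ * x * star (w F₀)) := dist_triangle _ _ _
      _ < ε / 2 + ε / 2 := by
          refine add_lt_add (hb F) ?_
          rw [hF₀ F hF, ← hF₀ F₀ le_rfl, dist_comm]
          exact hb F₀
      _ = ε := by ring
  choose θ hθ using hlim
  refine ⟨{ toFun := θ
            map_one' := ?_
            map_mul' := fun x y => ?_
            map_zero' := ?_
            map_add' := fun x y => ?_
            commutes' := fun r => ?_
            map_star' := fun x => ?_ }, fun f => ?_⟩
  · refine tendsto_nhds_unique (hθ 1) ?_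
    simp [hw']
  · refine tendsto_nhds_unique (hθ (x * y)) (((hθ x).mul (hθ y)).congr fun F => ?_)
    symm
    calc _ = w F * x * 1 * y * star (w F) := by simp only [mul_assoc, one_mul]
      _ = _ := by
          rw [← hw F]
          simp only [mul_assoc]
  · refine tendsto_nhds_unique (hθ 0) ?_
    simp
  · refine tendsto_nhds_unique (hθ (x + y)) (((hθ x).add (hθ y)).congr fun F => ?_)
    rw [mul_add, add_mul]
  · refine tendsto_nhds_unique (hθ (algebraMap ℂ A r)) (tendsto_const_nhds.congr fun F => ?_)
    rw [← Algebra.commutes, mul_assoc, hw', mul_one]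
  · refine tendsto_nhds_unique (hθ (star x)) (((hθ x).star).congr fun F => ?_)
    simp [mul_assoc]
  · refine tendsto_nhds_unique (hθ (c.ann f)) (tendsto_const_nhds.congr' ?_)
    filter_upwards [eventually_ge_atTop {f}] with F hF
    exact (hwa F f (hF (Finset.mem_singleton_self f))).symm

/-- The *-homomorphism of the CAR algebra with `a(f) ↦ a(U f)`. There is only one, because the
`a(f)` generate the algebra. -/
noncomputable def bogoliubov (U : H →ₗᵢ[ℂ] H) : A →⋆ₐ[ℂ] A := (c.exists_bogoliubov U).choose

@[simp] theorem bogoliubov_ann (U : H →ₗᵢ[ℂ] H) (f : H) :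
    c.bogoliubov U (c.ann f) = c.ann (U f) := (c.exists_bogoliubov U).choose_spec f

/-- The automorphism `θ` with `θ(a(f)) = - a(f)` and `θ(a*(f)) = - a*(f)`. -/
noncomputable def parity : A →⋆ₐ[ℂ] A :=
  c.bogoliubov (LinearIsometryEquiv.neg ℂ).toLinearIsometry

theorem parity_ann (f : H) : c.parity (c.ann f) = -c.ann f := by
  simp [parity]

end CARAlgebra

end CAR

section Semigroup

variable {A : Type*} [CStarAlgebra A]

/-- `y` is the value at `x` of the generator of the semigroup `T`, that is
`y = lim_{t ↓ 0} (T_t(x) - x) / t` in norm; `x` is in the domain if there is such a `y`. -/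
def IsGeneratorValue (T : ℝ≥0 → A → A) (x y : A) : Prop :=
  Tendsto (fun t : ℝ≥0 => (t : ℝ)⁻¹ • (T t x - x)) (𝓝[>] 0) (𝓝 y)

/-- A quantum dynamical semigroup on a unital C*-algebra. -/
structure QuantumDynamicalSemigroup (A : Type*) [CStarAlgebra A] [PartialOrder A]
    [StarOrderedRing A] where
  /-- The completely positive map `T_t`, `t ≥ 0`. -/
  map : ℝ≥0 → CompletelyPositiveMap A A
  map_one : ∀ t, map t 1 = 1
  map_zero : ∀ x, map 0 x = x
  map_add : ∀ t s x, map (t + s) x = map t (map s x)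
  tendsto_zero : ∀ x, Tendsto (fun t => ‖map t x - x‖) (𝓝[>] 0) (𝓝 0)

/-- The operator `x ↦ ∑ᵢ cᵢ (2 bᵢ Θ(x) bᵢ* - bᵢ bᵢ* x - x bᵢ bᵢ*)`. -/
noncomputable def lindbladOp {ι : Type*} [Fintype ι] (Θ : A →L[ℂ] A) (κ : ι → ℝ) (b : ι → A) :
    A →L[ℂ] A :=
  ∑ i, (κ i : ℂ) • ((2 : ℂ) • (ContinuousLinearMap.mulLeftRight ℂ A (b i) (star (b i)) * Θ) -
    ContinuousLinearMap.mulLeftRight ℂ A (b i * star (b i)) 1 -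
    ContinuousLinearMap.mulLeftRight ℂ A 1 (b i * star (b i)))

theorem lindbladOp_apply {ι : Type*} [Fintype ι] (Θ : A →L[ℂ] A) (κ : ι → ℝ) (b : ι → A) (x : A) :
    lindbladOp Θ κ b x = ∑ i, (κ i : ℂ) • ((2 : ℂ) • (b i * Θ x * star (b i)) -
      b i * star (b i) * x - x * (b i * star (b i))) := by
  simp [lindbladOp]

theorem linear_ode_unique {k : ℝ → (A →L[ℂ] A)} {K : ℝ} (hK : ∀ t, ‖k t‖ ≤ K) {f g : ℝ → A}
    (hf : ∀ t, HasDerivAt f (k t (f t)) t) (hg : ∀ t, HasDerivAt g (k t (g t)) t)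
    (h0 : f 0 = g 0) : f = g := by
  refine ODE_solution_unique_univ (K := K.toNNReal) (v := fun t => k t) (s := fun _ => Set.univ)
    (t₀ := 0) (fun t => ?_) (fun t => ⟨hf t, trivial⟩) (fun t => ⟨hg t, trivial⟩) h0
  refine (LipschitzWith.weaken (k t).lipschitz ?_).lipschitzOnWith
  rw [← NNReal.coe_le_coe, Real.coe_toNNReal _ ((norm_nonneg _).trans (hK 0))]
  exact hK t

theorem continuous_mulLeftRight {p q : ℝ → A} (hp : Continuous p) (hq : Continuous q) :
    Continuous fun t => ContinuousLinearMap.mulLeftRight ℂ A (p t) (q t) :=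
  ((ContinuousLinearMap.mulLeftRight ℂ A).continuous.comp hp).clm_apply hq

variable [PartialOrder A] [StarOrderedRing A]

/-- Complete positivity of a bounded operator on `A`. -/
def IsCP (T : A →L[ℂ] A) : Prop :=
  ∀ (k : ℕ) (M : CStarMatrix (Fin k) (Fin k) A), 0 ≤ M → 0 ≤ M.map T

/-- Entrywise evaluation at a matrix. -/
noncomputable def evalMatrix {k : ℕ} (M : CStarMatrix (Fin k) (Fin k) A) :
    (A →L[ℂ] A) →L[ℂ] CStarMatrix (Fin k) (Fin k) A where
  toFun T := M.map T
  map_add' _ _ := rfl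
  map_smul' _ _ := rfl
  cont := by
    refine continuous_pi fun i => continuous_pi fun j => ?_
    exact (ContinuousLinearMap.apply ℂ A (M i j)).continuous

theorem IsCP.one : IsCP (1 : A →L[ℂ] A) := fun k M hM => by
  have : M.map (1 : A →L[ℂ] A) = M := CStarMatrix.map_id M
  rwa [this]

theorem IsCP.mul {S T : A →L[ℂ] A} (hS : IsCP S) (hT : IsCP T) : IsCP (S * T) :=
  fun k M hM => hS k _ (hT k M hM)

theorem IsCP.sum {ι : Type*} {T : ι → A →L[ℂ] A} (s : Finset ι) (h : ∀ i ∈ s, IsCP (T i)) :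
    IsCP (∑ i ∈ s, T i) := fun k M hM => by
  have : M.map (∑ i ∈ s, T i : A →L[ℂ] A) = ∑ i ∈ s, M.map (T i) := map_sum (evalMatrix M) T s
  rw [this]
  exact Finset.sum_nonneg fun i hi => h i hi k M hM

theorem IsCP.smul {T : A →L[ℂ] A} (h : IsCP T) {r : ℝ} (hr : 0 ≤ r) : IsCP ((r : ℂ) • T) :=
  fun k M hM => by
    have : M.map ((r : ℂ) • T : A →L[ℂ] A) = r • M.map T := rfl
    rw [this]
    exact smul_nonneg hr (h k M hM)

theorem isClosed_isCP : IsClosed {T : A →L[ℂ] A | IsCP T} := by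
  have : {T : A →L[ℂ] A | IsCP T} = ⋂ (k : ℕ) (M : CStarMatrix (Fin k) (Fin k) A) (_ : 0 ≤ M),
      evalMatrix M ⁻¹' Set.Ici 0 := by
    ext T
    simp only [Set.mem_ofPred_eq, Set.mem_iInter, Set.mem_preimage, Set.mem_Ici]
    rfl
  rw [this]
  exact isClosed_iInter fun k => isClosed_iInter fun M => isClosed_iInter fun _ =>
    isClosed_Ici.preimage (evalMatrix M).continuous

theorem intervalIntegral_nonneg {X : Type*} [NonUnitalCStarAlgebra X] [PartialOrder X]
    [StarOrderedRing X] {f : ℝ → X} {t : ℝ} (ht : 0 ≤ t) (h : ∀ s, 0 ≤ s → 0 ≤ f s) :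
    0 ≤ ∫ s in (0 : ℝ)..t, f s := by
  have h1 : SMulPosMono ℝ X := ⟨fun x hx r s hrs => by
    show r • x ≤ s • x
    rw [← sub_nonneg, ← sub_smul]
    exact smul_nonneg (sub_nonneg.2 hrs) hx⟩
  have : IsOrderedModule ℝ X := {}
  rw [intervalIntegral.integral_of_le ht]
  refine MeasureTheory.integral_nonneg_of_ae ?_
  exact (MeasureTheory.ae_restrict_iff' measurableSet_Ioc).2
    (Eventually.of_forall fun s hs => h s hs.1.le)

theorem IsCP.intervalIntegral {T : ℝ → (A →L[ℂ] A)} (hc : Continuous T) {t : ℝ} (ht : 0 ≤ t)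
    (h : ∀ s, 0 ≤ s → IsCP (T s)) : IsCP (∫ s in (0 : ℝ)..t, T s) := fun k M hM => by
  have e : M.map (∫ s in (0 : ℝ)..t, T s : A →L[ℂ] A) = ∫ s in (0 : ℝ)..t, M.map (T s) :=
    ((evalMatrix M).intervalIntegral_comp_comm (hc.intervalIntegrable _ _)).symm
  rw [e]
  exact intervalIntegral_nonneg ht fun s hs => h s hs k M hM

theorem isCP_dysonSum {k : ℝ → (A →L[ℂ] A)} (hk : Continuous k) (h : ∀ s, 0 ≤ s → IsCP (k s))
    {t : ℝ} (ht : 0 ≤ t) : IsCP (dysonSum k t) := by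
  have h1 : ∀ n s, 0 ≤ s → IsCP (dysonTerm k n s) := by
    intro n
    induction n with
    | zero => exact fun s _ => IsCP.one
    | succ n ih =>
      exact fun s hs => IsCP.intervalIntegral (hk.mul (dysonTerm_continuous hk n)) hs
        fun r hr => (h r hr).mul (ih r hr)
  exact isClosed_isCP.mem_of_tendsto (summable_dysonTerm hk t).hasSum
    (Eventually.of_forall fun s => IsCP.sum s fun n _ => h1 n t ht)

theorem isCP_sandwich (p : A) : IsCP (ContinuousLinearMap.mulLeftRight ℂ A p (star p)) :=
  fun k M hM => by
    let P : CStarMatrix (Fin k) (Fin k) A := CStarMatrix.ofMatrix (Matrix.diagonal fun _ => p)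
    have e : M.map (ContinuousLinearMap.mulLeftRight ℂ A p (star p)) = P * M * star P := by
      have h1 : star P = CStarMatrix.ofMatrix (Matrix.diagonal fun _ => star p) := by
        show (Matrix.diagonal fun _ => p).conjTranspose = (Matrix.diagonal fun _ => star p)
        rw [Matrix.diagonal_conjTranspose]
        rfl
      rw [h1]
      let M' : Matrix (Fin k) (Fin k) A := M
      show _ = (Matrix.diagonal (fun _ : Fin k => p) * M') * Matrix.diagonal (fun _ : Fin k => star p)
      refine Matrix.ext fun i j => ?_
      rw [Matrix.mul_diagonal, Matrix.diagonal_mul]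
      rfl
    rw [e]
    exact star_right_conjugate_nonneg hM P

theorem isCP_of_starAlgHom (φ : A →⋆ₐ[ℂ] A) (L : A →L[ℂ] A) (hL : ∀ x, L x = φ x) : IsCP L :=
  fun k M hM => by
    have : M.map L = M.map φ := by
      ext i j
      exact hL _
    rw [this]
    exact CompletelyPositiveMapClass.map_cstarMatrix_nonneg' φ k M hM

/-- A *-homomorphism as a bounded operator. -/
noncomputable def homCLM (φ : A →⋆ₐ[ℂ] A) : A →L[ℂ] A :=
  LinearMap.mkContinuous (φ : A →ₗ[ℂ] A) 1 fun x => by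
    simpa using NonUnitalStarAlgHom.norm_apply_le φ x

@[simp] theorem homCLM_apply (φ : A →⋆ₐ[ℂ] A) (x : A) : homCLM φ x = φ x := rfl

end Semigroup

section Generation

variable {A : Type*} [CStarAlgebra A] [PartialOrder A] [StarOrderedRing A]

/-- A bounded perturbation `x ↦ ∑ᵢ cᵢ (2 bᵢ θ(x) bᵢ* - bᵢ bᵢ* x - x bᵢ bᵢ*)`, `cᵢ ≥ 0`, of the
generator of a strongly continuous group `α` of *-homomorphisms commuting with `θ` generates a
quantum dynamical semigroup. -/
theorem exists_qds {ι : Type*} [Fintype ι] (α : ℝ → A →⋆ₐ[ℂ] A) (hα0 : ∀ x, α 0 x = x)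
    (hα : ∀ s t x, α (s + t) x = α s (α t x)) (hαc : ∀ x, Continuous fun t => α t x)
    (θ : A →⋆ₐ[ℂ] A) (hθ : ∀ t x, θ (α t x) = α t (θ x)) (κ : ι → ℝ) (hκ : ∀ i, 0 ≤ κ i)
    (b : ι → A) :
    ∃ T : QuantumDynamicalSemigroup A, ∀ x y, IsGeneratorValue (fun t => T.map t) x y ↔
      ∃ y', IsGeneratorValue (fun t => α t) x y' ∧ y = y' + lindbladOp (homCLM θ) κ b x := by
  have hαi : ∀ t x, α (-t) (α t x) = x := fun t x => by rw [← hα, neg_add_cancel, hα0]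
  have hαi' : ∀ t x, α t (α (-t) x) = x := fun t x => by rw [← hα, add_neg_cancel, hα0]
  have hαn : ∀ t x, ‖α t x‖ ≤ ‖x‖ := fun t x => NonUnitalStarAlgHom.norm_apply_le (α t) x
  set k : ℝ → (A →L[ℂ] A) := fun t => lindbladOp (homCLM θ) κ fun i => α (-t) (b i) with hk
  have hbc : ∀ i, Continuous fun t => α (-t) (b i) := fun i => (hαc (b i)).comp continuous_neg
  have hkα : ∀ s t x, k (s + t) x = α (-t) (k s (α t x)) := fun s t x => by
    simp only [hk, lindbladOp_apply, map_sum, map_smul, map_sub, map_mul, map_star, homCLM_apply,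
      hθ, hαi]
    simp only [neg_add_rev, hα]
  have hkc : Continuous k := by
    refine continuous_finsetSum _ fun i _ => ?_
    have h1 := continuous_mulLeftRight (hbc i) (hbc i).star
    have h2 := continuous_mulLeftRight ((hbc i).mul (hbc i).star) (continuous_const (y := (1 : A)))
    have h3 := continuous_mulLeftRight (continuous_const (y := (1 : A))) ((hbc i).mul (hbc i).star)
    exact ((((h1.mul (continuous_const (y := homCLM θ))).const_smul (2 : ℂ)).sub h2).sub
      h3).const_smul (κ i : ℂ)
  have hk0 : k 0 = lindbladOp (homCLM θ) κ b := by
    simp only [hk, neg_zero, hα0]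
  have hkb : ∀ t, ‖k t‖ ≤ ‖k 0‖ := fun t => by
    refine ContinuousLinearMap.opNorm_le_bound _ (norm_nonneg _) fun x => ?_
    have := hkα 0 t x
    rw [zero_add] at this
    rw [this]
    exact (hαn _ _).trans (((k 0).le_opNorm _).trans (by gcongr; exact hαn _ _))
  set R := dysonSum k with hR
  have hR0 : R 0 = 1 := dysonSum_zero hkc
  have happ : ∀ {F : ℝ → (A →L[ℂ] A)} {F' : A →L[ℂ] A} {t : ℝ}, HasDerivAt F F' t → ∀ x,
      HasDerivAt (fun t => F t x) (F' x) t := fun {F F' t} h x =>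
    ((ContinuousLinearMap.apply ℂ A x).restrictScalars ℝ).hasFDerivAt.comp_hasDerivAt t h
  have hRd : ∀ x t, HasDerivAt (fun t => R t x) (k t (R t x)) t := fun x t =>
    happ (hasDerivAt_dysonSum hkc t) x
  have hsmul : ∀ (φ : A →⋆ₐ[ℂ] A) {F : ℝ → A} {F' : A} {t : ℝ}, HasDerivAt F F' t →
      HasDerivAt (fun t => φ (F t)) (φ F') t := fun φ {F F' t} h =>
    ((homCLM φ).restrictScalars ℝ).hasFDerivAt.comp_hasDerivAt t h
  have hRg : ∀ s t x, R (s + t) x = α (-t) (R s (α t (R t x))) := fun s t x => by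
    have := linear_ode_unique (k := fun s => k (s + t)) (fun s => hkb (s + t))
      (f := fun s => R (s + t) x) (g := fun s => α (-t) (R s (α t (R t x))))
      (fun s => (hRd x (s + t)).comp_add_const s t)
      (fun s => by
        have h1 := hsmul (α (-t)) (hRd (α t (R t x)) s)
        refine h1.congr_deriv ?_
        rw [hkα, hαi'])
      (by simp [hR0, hαi])
    exact congrFun this s
  have hR1 : ∀ t, R t 1 = 1 := fun t => by
    have := linear_ode_unique hkb (f := fun s => R s 1) (g := fun _ => (1 : A)) (hRd 1)
      (fun s => by
        have : k s 1 = 0 := by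
          simp [hk, lindbladOp_apply, two_smul]
        rw [this]
        exact hasDerivAt_const _ _)
      (by simp [hR0])
    exact congrFun this t
  -- complete positivity
  set m : ℝ → A := fun t => ∑ i, (κ i : ℂ) • (α (-t) (b i) * star (α (-t) (b i))) with hm
  have hmc : Continuous m := by
    refine continuous_finsetSum _ fun i _ => Continuous.const_smul ((hbc i).mul (hbc i).star) _
  have hms : ∀ t, star (m t) = m t := fun t => by
    simp [hm, star_smul]
  have hmn : ∀ t, ‖m t‖ ≤ ‖m 0‖ := fun t => by
    have : m t = α (-t) (m 0) := by
      simp only [hm, map_sum, map_smul, map_mul, map_star, neg_zero, hα0]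
    rw [this]
    exact hαn _ _
  set φ : ℝ → (A →L[ℂ] A) := fun t => ∑ i, ((2 * κ i : ℝ) : ℂ) •
    (ContinuousLinearMap.mulLeftRight ℂ A (α (-t) (b i)) (star (α (-t) (b i))) * homCLM θ) with hφ
  have hφc : Continuous φ := by
    refine continuous_finsetSum _ fun i _ => ?_
    exact ((continuous_mulLeftRight (hbc i) (hbc i).star).mul
      (continuous_const (y := homCLM θ))).const_smul ((2 * κ i : ℝ) : ℂ)
  have hkφ : ∀ t x, k t x = φ t x - m t * x - x * m t := fun t x => by
    simp only [hk, lindbladOp_apply, hφ, hm, sum_apply,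
      smul_apply, mul_apply_eq_comp, homCLM_apply, smul_sub, smul_smul,
      Finset.sum_sub_distrib, ContinuousLinearMap.mulLeftRight_apply, Finset.sum_mul,
      Finset.mul_sum, smul_mul_assoc, mul_smul_comm]
    congr 2
    refine Finset.sum_congr rfl fun i _ => ?_
    push_cast
    rw [mul_comm]
  set q := dysonSum fun t => -m t with hq
  set p : ℝ → A := fun t => star (dysonSum m t) with hp
  have hqd : ∀ t, HasDerivAt q (-m t * q t) t := fun t => hasDerivAt_dysonSum hmc.neg t
  have hstar : ∀ {F : ℝ → A} {F' : A} {t : ℝ}, HasDerivAt F F' t →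
      HasDerivAt (fun t => star (F t)) (star F') t := by
    have : StarModule ℝ A := ⟨fun r T => by
      have h1 : r • T = (r : ℂ) • T := rfl
      have h2 : r • star T = (r : ℂ) • star T := rfl
      rw [star_trivial r, h1, h2, star_smul]
      simp⟩
    exact fun {F F' t} h => HasDerivAt.star h
  have hpd : ∀ t, HasDerivAt p (p t * m t) t := fun t => by
    have := hstar (hasDerivAt_dysonSum hmc t)
    rwa [star_mul, hms] at this
  have hq0 : q 0 = 1 := dysonSum_zero hmc.neg
  have hp0 : p 0 = 1 := by simp [hp, dysonSum_zero hmc]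
  have hqp : ∀ t, q t * p t = 1 := fun t => by
    have := linear_ode_unique (K := 2 * (‖m 0‖ * ‖(1 : A)‖))
      (k := fun t => -ContinuousLinearMap.mulLeftRight ℂ A (m t) 1 +
        ContinuousLinearMap.mulLeftRight ℂ A 1 (m t))
      (fun t => by
        refine (norm_add_le _ _).trans ?_
        rw [norm_neg, two_mul]
        refine add_le_add ?_ ?_
        · refine (ContinuousLinearMap.opNorm_mulLeftRight_apply_apply_le ℂ A _ _).trans ?_
          gcongr
          exact hmn t
        · refine (ContinuousLinearMap.opNorm_mulLeftRight_apply_apply_le ℂ A _ _).trans ?_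
          rw [mul_comm]
          gcongr
          exact hmn t)
      (f := fun t => q t * p t) (g := fun _ => 1)
      (fun t => ((hqd t).mul (hpd t)).congr_deriv (by simp [mul_assoc]))
      (fun t => (hasDerivAt_const t (1 : A)).congr_deriv (by simp))
      (by simp [hq0, hp0])
    exact congrFun this t
  have hcq : Continuous q := continuous_iff_continuousAt.2 fun t => (hqd t).continuousAt
  have hcp : Continuous p := continuous_iff_continuousAt.2 fun t => (hpd t).continuousAt
  set ψ : ℝ → (A →L[ℂ] A) := fun t => ContinuousLinearMap.mulLeftRight ℂ A (p t) (star (p t)) *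
    φ t * ContinuousLinearMap.mulLeftRight ℂ A (q t) (star (q t)) with hψ
  have hψc : Continuous ψ := ((continuous_mulLeftRight hcp hcp.star).mul hφc).mul
    (continuous_mulLeftRight hcq hcq.star)
  have hθCP : IsCP (homCLM θ) := isCP_of_starAlgHom θ _ fun _ => rfl
  have hψCP : ∀ t, IsCP (ψ t) := fun t =>
    ((isCP_sandwich _).mul (IsCP.sum _ fun i _ =>
      IsCP.smul ((isCP_sandwich _).mul hθCP) (mul_nonneg zero_le_two (hκ i)))).mul (isCP_sandwich _)
  have hRq : ∀ t x, R t x = q t * dysonSum ψ t x * star (q t) := fun t x => by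
    have := linear_ode_unique hkb (f := fun t => R t x)
      (g := fun t => q t * dysonSum ψ t x * star (q t)) (hRd x)
      (fun t => by
        have h1 := ((hqd t).mul (happ (hasDerivAt_dysonSum hψc t) x)).mul (hstar (hqd t))
        refine h1.congr_deriv ?_
        have hpq' : star (p t) * star (q t) = 1 := by rw [← star_mul, hqp, star_one]
        have h2 : q t * (ψ t * dysonSum ψ t) x * star (q t) =
            φ t (q t * dysonSum ψ t x * star (q t)) := by
          show q t * (p t * φ t (q t * dysonSum ψ t x * star (q t)) * star (p t)) * star (q t) = _
          calc _ = (q t * p t) * φ t (q t * dysonSum ψ t x * star (q t)) *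
                (star (p t) * star (q t)) := by simp only [mul_assoc]
            _ = _ := by rw [hqp, hpq', one_mul, mul_one]
        rw [hkφ, add_mul, h2, star_mul, star_neg, hms]
        show _ + q t * dysonSum ψ t x * _ = _
        simp only [mul_assoc, neg_mul, mul_neg]
        abel)
      (by simp [hR0, hq0, dysonSum_zero hψc])
    exact congrFun this t
  have hRCP : ∀ t, 0 ≤ t → IsCP (R t) := fun t ht => by
    have : R t = ContinuousLinearMap.mulLeftRight ℂ A (q t) (star (q t)) * dysonSum ψ t := by
      ext x
      exact hRq t x
    rw [this]
    exact (isCP_sandwich _).mul (isCP_dysonSum hψc (fun s _ => hψCP s) ht)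
  have hTCP : ∀ t, 0 ≤ t → IsCP (homCLM (α t) * R t) := fun t ht =>
    (isCP_of_starAlgHom (α t) _ fun _ => rfl).mul (hRCP t ht)
  have hjoint : ∀ (u : ℝ≥0 → A) (y : A), Tendsto u (𝓝[>] 0) (𝓝 y) →
      Tendsto (fun t : ℝ≥0 => α t (u t)) (𝓝[>] 0) (𝓝 y) := fun u y hu => by
    have h1 : Tendsto (fun t : ℝ≥0 => α t y) (𝓝[>] 0) (𝓝 y) := by
      have : Continuous fun t : ℝ≥0 => α t y := (hαc y).comp NNReal.continuous_coe
      have := (this.tendsto 0).mono_left (nhdsWithin_le_nhds (s := Set.Ioi 0))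
      simpa [hα0] using this
    have h2 : Tendsto (fun t : ℝ≥0 => α t (u t - y)) (𝓝[>] 0) (𝓝 0) := by
      rw [tendsto_iff_norm_sub_tendsto_zero] at hu
      exact squeeze_zero_norm (fun t => hαn _ _) hu
    simpa using h2.add h1
  have hRlim : ∀ x, Tendsto (fun t : ℝ≥0 => R t x) (𝓝[>] 0) (𝓝 x) := fun x => by
    have h1 : Continuous fun t => R t x :=
      continuous_iff_continuousAt.2 fun t => (hRd x t).continuousAt
    have : Continuous fun t : ℝ≥0 => R t x := h1.comp NNReal.continuous_coe
    have := (this.tendsto 0).mono_left (nhdsWithin_le_nhds (s := Set.Ioi 0))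
    simpa [hR0] using this
  refine ⟨{ map := fun t => ⟨(homCLM (α t) * R t : A →L[ℂ] A), hTCP t t.2⟩
            map_one := fun t => ?_
            map_zero := fun x => ?_
            map_add := fun t s x => ?_
            tendsto_zero := fun x => ?_ }, fun x y => ?_⟩
  · show α t (R t 1) = 1
    rw [hR1, map_one]
  · show α ((0 : ℝ≥0) : ℝ) (R ((0 : ℝ≥0) : ℝ) x) = x
    simp [hR0, hα0]
  · show α ((t + s : ℝ≥0) : ℝ) (R ((t + s : ℝ≥0) : ℝ) x) = α t (R t (α s (R s x)))
    rw [NNReal.coe_add, hRg, hα, hαi']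
  · show Tendsto (fun t : ℝ≥0 => ‖α t (R t x) - x‖) _ _
    rw [← tendsto_iff_norm_sub_tendsto_zero]
    exact hjoint _ _ (hRlim x)
  · show Tendsto (fun t : ℝ≥0 => (t : ℝ)⁻¹ • (α t (R t x) - x)) (𝓝[>] 0) (𝓝 y) ↔ _
    have h1 : Tendsto (fun t : ℝ≥0 => (t : ℝ)⁻¹ • (R t x - x)) (𝓝[>] 0) (𝓝 (k 0 x)) := by
      have h2 := (hasDerivAt_iff_tendsto_slope_zero.1 (hRd x 0))
      simp only [zero_add, hR0, one_apply_eq_self] at h2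
      refine h2.comp ?_
      refine tendsto_nhdsWithin_iff.2 ⟨?_, ?_⟩
      · have := (NNReal.continuous_coe.tendsto 0).mono_left (nhdsWithin_le_nhds (s := Set.Ioi 0))
        simpa using this
      · filter_upwards [self_mem_nhdsWithin] with t ht
        have : (0 : ℝ≥0) < t := ht
        exact (NNReal.coe_pos.2 this).ne'
    have h3 := hjoint _ _ h1
    rw [hk0] at h3
    have h4 : ∀ t : ℝ≥0, (t : ℝ)⁻¹ • (α t (R t x) - x) =
        (t : ℝ)⁻¹ • (α t x - x) + α t ((t : ℝ)⁻¹ • (R t x - x)) := fun t => by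
      have : α t ((t : ℝ)⁻¹ • (R t x - x)) = (t : ℝ)⁻¹ • (α t (R t x) - α t x) := by
        rw [← map_sub]
        exact map_smul (α t) (((t : ℝ)⁻¹ : ℝ) : ℂ) _
      rw [this, ← smul_add]
      congr 1
      abel
    constructor
    · intro h
      refine ⟨y - lindbladOp (homCLM θ) κ b x, ?_, by simp⟩
      refine (h.sub h3).congr fun t => ?_
      rw [h4, add_sub_cancel_right]
    · rintro ⟨y', hy', rfl⟩
      refine (hy'.add h3).congr fun t => ?_
      rw [h4]

end Generation

section Dynamics

variable {H : Type*} [NormedAddCommGroup H] [InnerProductSpace ℂ H]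
variable {A : Type*} [CStarAlgebra A]

theorem continuous_starAlgHom (φ : A →⋆ₐ[ℂ] A) : Continuous φ :=
  (LinearMap.mkContinuous (φ : A →ₗ[ℂ] A) 1 fun x => by
    simpa using NonUnitalStarAlgHom.norm_apply_le φ x).continuous

theorem CARAlgebra.hom_ext (c : CARAlgebra H A) {φ ψ : A →⋆ₐ[ℂ] A}
    (h : ∀ f, φ (c.ann f) = ψ (c.ann f)) (x : A) : φ x = ψ x := by
  have hφ : Continuous φ := continuous_starAlgHom φ
  have hψ : Continuous ψ := continuous_starAlgHom ψ
  have hcl : IsClosed {x | φ x = ψ x} := isClosed_eq hφ hψ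
  have hsub : (StarAlgebra.adjoin ℂ (Set.range c.ann) : Set A) ⊆ {x | φ x = ψ x} := by
    intro x hx
    have : StarAlgebra.adjoin ℂ (Set.range c.ann) ≤ StarAlgHom.equalizer φ ψ := by
      refine StarAlgebra.adjoin_le ?_
      rintro _ ⟨f, rfl⟩
      exact h f
    exact this hx
  have hx : x ∈ closure (StarAlgebra.adjoin ℂ (Set.range c.ann) : Set A) := by
    have : x ∈ (StarAlgebra.adjoin ℂ (Set.range c.ann)).topologicalClosure := by
      rw [c.generates]
      trivial
    exact this
  exact hcl.closure_subset_iff.2 hsub hx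

theorem CARAlgebra.norm_ann_le (c : CARAlgebra H A) (f : H) : ‖c.ann f‖ ≤ ‖f‖ := by
  set a := c.ann f with ha
  have h1 : (star a * a) * (star a * a) = inner ℂ f f • (star a * a) := by
    have h2 : a * star a = inner ℂ f f • (1 : A) - star a * a := c.ann_mul_cre f f
    calc (star a * a) * (star a * a) = star a * (a * star a) * a := by simp only [mul_assoc]
      _ = inner ℂ f f • (star a * a) := by
          rw [h2, mul_sub, sub_mul, mul_smul_comm, mul_one, smul_mul_assoc]
          have : star a * (star a * a) * a = star a * star a * (a * a) := by
            simp only [mul_assoc]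
          rw [this, c.ann_mul_self f, mul_zero, sub_zero]
  have h3 : ‖star a * a‖ * ‖star a * a‖ = ‖f‖ ^ 2 * ‖star a * a‖ := by
    have h4 : star (star a * a) = star a * a := by simp
    rw [← CStarRing.norm_star_mul_self (x := star a * a), h4, h1, norm_smul,
      inner_self_eq_norm_sq_to_K]
    simp
  rw [CStarRing.norm_star_mul_self] at h3
  by_contra hlt
  push Not at hlt
  have h5 : 0 ≤ ‖f‖ := norm_nonneg f
  have h6 : 0 < ‖a‖ := h5.trans_lt hlt
  have h7 : ‖a‖ * ‖a‖ = ‖f‖ ^ 2 := mul_right_cancel₀ (mul_pos h6 h6).ne' h3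
  nlinarith

/-- If `t ↦ U_t f` is continuous for all `f`, then `t ↦ β_t(x)` is continuous for all `x`, with
`β_t` the *-homomorphism induced by `U_t`. -/
theorem CARAlgebra.continuous_bogoliubov (c : CARAlgebra H A) (U : ℝ → H →ₗᵢ[ℂ] H)
    (hU : ∀ f, Continuous fun t => U t f) (x : A) : Continuous fun t => c.bogoliubov (U t) x := by
  have hadj : ∀ x ∈ StarAlgebra.adjoin ℂ (Set.range c.ann),
      Continuous fun t => c.bogoliubov (U t) x := by
    intro x hx
    induction hx using StarAlgebra.adjoin_induction with
    | mem x hx =>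
      obtain ⟨f, rfl⟩ := hx
      simp only [c.bogoliubov_ann]
      have : Continuous c.ann :=
        (LinearMap.mkContinuous c.ann 1 fun f => by simpa using c.norm_ann_le f).continuous
      exact this.comp (hU f)
    | algebraMap r => simpa only [AlgHomClass.commutes] using continuous_const
    | add x y _ _ hx hy =>
      simp only [map_add]
      exact hx.add hy
    | mul x y _ _ hx hy =>
      simp only [map_mul]
      exact hx.mul hy
    | star x _ hx => simpa only [map_star] using hx.star
  rw [Metric.continuous_iff]
  intro s ε hε
  have hx : x ∈ closure (StarAlgebra.adjoin ℂ (Set.range c.ann) : Set A) := by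
    have : x ∈ (StarAlgebra.adjoin ℂ (Set.range c.ann)).topologicalClosure := by
      rw [c.generates]
      trivial
    exact this
  obtain ⟨y, hy, hd⟩ := Metric.mem_closure_iff.1 hx (ε / 3) (by positivity)
  obtain ⟨δ, hδ, h⟩ := Metric.continuous_iff.1 (hadj y hy) s (ε / 3) (by positivity)
  have hb : ∀ t, dist (c.bogoliubov (U t) x) (c.bogoliubov (U t) y) < ε / 3 := fun t => by
    rw [dist_eq_norm, ← map_sub]
    refine (NonUnitalStarAlgHom.norm_apply_le (c.bogoliubov (U t)) _).trans_lt ?_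
    rwa [← dist_eq_norm]
  refine ⟨δ, hδ, fun t ht => ?_⟩
  have h1 := hb t
  have h2 := hb s
  rw [dist_comm] at h2
  have h3 := h t ht
  have h4 := dist_triangle4 (c.bogoliubov (U t) x) (c.bogoliubov (U t) y) (c.bogoliubov (U s) y)
    (c.bogoliubov (U s) x)
  linarith

end Dynamics

/-- The Fermi-Dirac distribution `f_{β,μ}(ε) = 1 / (1 + e^{β(ε - μ)})`. -/
noncomputable def fermiDirac (β μ ε : ℝ) : ℝ := 1 / (1 + Real.exp (β * (ε - μ)))

/-- The functional calculus `f(T)` of a bounded self-adjoint operator `T` on a Hilbert space. -/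
noncomputable def functionOf {H : Type*} [NormedAddCommGroup H] [InnerProductSpace ℂ H]
    [CompleteSpace H] (f : ℝ → ℝ) (T : H →L[ℂ] H) : H →L[ℂ] H :=
  cfc f T

/-- The operator `f_{β,μ}(h)`. -/
noncomputable def fermiOp {d : ℕ} (V : Lattice d → ℝ) (hV : ∃ C, ∀ x, |V x| ≤ C) (β μ : ℝ) :
    OneParticle d →L[ℂ] OneParticle d :=
  functionOf (fermiDirac β μ) (hamiltonian V hV)

/-- The box `Λ_N = [-N, N]^d ∩ ℤ^d`. -/
noncomputable def box (d N : ℕ) : Finset (Lattice d) := Finset.Icc (fun _ => -(N : ℤ)) (fun _ => (N : ℤ))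

open Classical in
/-- The projection `P_N` onto the functions supported in `Λ_N`. -/
noncomputable def boxProj (d N : ℕ) : OneParticle d →L[ℂ] OneParticle d :=
  weightedShift (Equiv.refl _) (fun x => if x ∈ box d N then 1 else 0)
    ⟨1, fun x => by split_ifs <;> simp⟩

/-- The restricted Hamiltonian `h_N = P_N h P_N`. -/
noncomputable def boxHamiltonian {d : ℕ} (V : Lattice d → ℝ) (hV : ∃ C, ∀ x, |V x| ≤ C) (N : ℕ) :
    OneParticle d →L[ℂ] OneParticle d :=
  boxProj d N * hamiltonian V hV * boxProj d N

/-- An orthonormal basis `φ_1, …, φ_{|Λ_N|}` of `ℓ²(Λ_N)` consisting of eigenvectors of `h_N`,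
with the eigenvalues `ε_1, …, ε_{|Λ_N|}`. -/
structure BoxEigenbasis {d : ℕ} (V : Lattice d → ℝ) (hV : ∃ C, ∀ x, |V x| ≤ C) (N : ℕ) where
  /-- The eigenvalues. -/
  energy : Fin (box d N).card → ℝ
  /-- The eigenvectors. -/
  vec : Fin (box d N).card → OneParticle d
  orthonormal : Orthonormal ℂ vec
  supported : ∀ n, ∀ x ∉ box d N, vec n x = 0
  eigen : ∀ n, boxHamiltonian V hV N (vec n) = (energy n : ℂ) • vec n

section Model

variable {d : ℕ} {A : Type*} [CStarAlgebra A]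

/-- The dissipative part of the generator `L_N`. -/
noncomputable def dissipator (c : CARAlgebra (OneParticle d) A) {V : Lattice d → ℝ}
    {hV : ∃ C, ∀ x, |V x| ≤ C} (β μ lam : ℝ) {N : ℕ} (φ : BoxEigenbasis V hV N) (x : A) : A :=
  (lam : ℂ) • ∑ n, (fermiDirac β μ (φ.energy n) : ℂ) •
      ((2 : ℂ) • (c.ann (φ.vec n) * c.parity x * c.cre (φ.vec n)) -
        c.ann (φ.vec n) * c.cre (φ.vec n) * x - x * (c.ann (φ.vec n) * c.cre (φ.vec n))) +
    (lam : ℂ) • ∑ n, ((1 - fermiDirac β μ (φ.energy n) : ℝ) : ℂ) •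
      ((2 : ℂ) • (c.cre (φ.vec n) * c.parity x * c.ann (φ.vec n)) -
        c.cre (φ.vec n) * c.ann (φ.vec n) * x - x * (c.cre (φ.vec n) * c.ann (φ.vec n)))

/-- The dynamics `α_t^E` of non-interacting particles with one-particle Hamiltonian `h_E`: the
*-homomorphism with `α_t^E(a(f)) = a(e^{ith_E} f)` and `α_t^E(a*(f)) = a*(e^{ith_E} f)`. -/
noncomputable def freeDynamics [NeZero d] (c : CARAlgebra (OneParticle d) A) (V : Lattice d → ℝ)
    (hV : ∃ C, ∀ x, |V x| ≤ C) (E t : ℝ) : A →⋆ₐ[ℂ] A :=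
  c.bogoliubov (fieldEvolution V hV E t).toLinearIsometry

/-- `y = L_N(x)`, where `L_N = δ_E + (dissipator)` has the domain of the generator `δ_E` of the
dynamics `α_t^E`. -/
def IsDaviesGeneratorValue [NeZero d] (c : CARAlgebra (OneParticle d) A) {V : Lattice d → ℝ}
    {hV : ∃ C, ∀ x, |V x| ≤ C} (β μ lam E : ℝ) {N : ℕ} (φ : BoxEigenbasis V hV N) (x y : A) :
    Prop :=
  ∃ y', IsGeneratorValue (fun t => freeDynamics c V hV E t) x y' ∧
    y = y' + dissipator c β μ lam φ x

theorem fermiDirac_mem (β μ ε : ℝ) : 0 ≤ fermiDirac β μ ε ∧ 0 ≤ 1 - fermiDirac β μ ε := by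
  have h : 0 < Real.exp (β * (ε - μ)) := Real.exp_pos _
  refine ⟨by unfold fermiDirac; positivity, ?_⟩
  rw [sub_nonneg, fermiDirac, div_le_one (by positivity)]
  linarith

variable [PartialOrder A] [StarOrderedRing A]

/-- The operator `L_N` generates a quantum dynamical semigroup. -/
theorem exists_daviesSemigroup [NeZero d] (c : CARAlgebra (OneParticle d) A) {V : Lattice d → ℝ}
    {hV : ∃ C, ∀ x, |V x| ≤ C} (β μ : ℝ) {lam : ℝ} (hlam : 0 < lam) (E : ℝ) {N : ℕ}
    (φ : BoxEigenbasis V hV N) :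
    ∃ T : QuantumDynamicalSemigroup A, ∀ x y, IsGeneratorValue (fun t => T.map t) x y ↔
      IsDaviesGeneratorValue c β μ lam E φ x y := by
  have hU := fieldEvolution_spec V hV E
  let κ : Fin (box d N).card ⊕ Fin (box d N).card → ℝ :=
    Sum.elim (fun n => lam * fermiDirac β μ (φ.energy n))
      (fun n => lam * (1 - fermiDirac β μ (φ.energy n)))
  let b : Fin (box d N).card ⊕ Fin (box d N).card → A :=
    Sum.elim (fun n => c.ann (φ.vec n)) (fun n => c.cre (φ.vec n))
  obtain ⟨T, hT⟩ := exists_qds (freeDynamics c V hV E)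
    (fun x => c.hom_ext (ψ := StarAlgHom.id ℂ A)
      (fun f => by simp [freeDynamics, hU.map_zero]) x)
    (fun s t x => c.hom_ext (ψ := (freeDynamics c V hV E s).comp (freeDynamics c V hV E t))
      (fun f => by simp [freeDynamics, hU.map_add]) x)
    (fun x => c.continuous_bogoliubov _ (fun f => hU.continuous f) x) c.parity
    (fun t x => c.hom_ext (φ := c.parity.comp (freeDynamics c V hV E t))
      (ψ := (freeDynamics c V hV E t).comp c.parity)
      (fun f => by simp [freeDynamics, CARAlgebra.parity_ann]) x)
    κ (by
      rintro (n | n)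
      · exact mul_nonneg hlam.le (fermiDirac_mem _ _ _).1
      · exact mul_nonneg hlam.le (fermiDirac_mem _ _ _).2) b
  refine ⟨T, fun x y => ?_⟩
  rw [hT, IsDaviesGeneratorValue]
  have h : lindbladOp (homCLM c.parity) κ b x = dissipator c β μ lam φ x := by
    rw [lindbladOp_apply, Fintype.sum_sum_type, dissipator, Finset.smul_sum, Finset.smul_sum]
    simp only [κ, b, Sum.elim_inl, Sum.elim_inr, CARAlgebra.cre, smul_smul, homCLM_apply,
      Complex.ofReal_mul, star_star]
  rw [h]

/-- Davies' quantum dynamical semigroup `T_t^{E,N}`, generated by `L_N`. (A strongly continuous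
semigroup is determined by its generator.) -/
noncomputable def daviesSemigroup [NeZero d] (c : CARAlgebra (OneParticle d) A) {V : Lattice d → ℝ}
    {hV : ∃ C, ∀ x, |V x| ≤ C} (β μ : ℝ) {lam : ℝ} (hlam : 0 < lam) (E : ℝ) {N : ℕ}
    (φ : BoxEigenbasis V hV N) : QuantumDynamicalSemigroup A :=
  (exists_daviesSemigroup c β μ hlam E φ).choose

theorem daviesSemigroup_spec [NeZero d] (c : CARAlgebra (OneParticle d) A) {V : Lattice d → ℝ}
    {hV : ∃ C, ∀ x, |V x| ≤ C} (β μ : ℝ) {lam : ℝ} (hlam : 0 < lam) (E : ℝ) {N : ℕ}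
    (φ : BoxEigenbasis V hV N) (x y : A) :
    IsGeneratorValue (fun t => (daviesSemigroup c β μ hlam E φ).map t) x y ↔
      IsDaviesGeneratorValue c β μ lam E φ x y :=
  (exists_daviesSemigroup c β μ hlam E φ).choose_spec x y

/-- States: normalized positive linear functionals on `A`. -/
noncomputable def State (A : Type*) [CStarAlgebra A] [PartialOrder A] [StarOrderedRing A] : Type _ :=
  {ω : A →ₚ[ℂ] ℂ // ω 1 = 1}

noncomputable instance : CoeFun (State A) fun _ => A → ℂ := ⟨fun ω => ω.1⟩

end Model

section Current

variable {d : ℕ} {A : Type*} [CStarAlgebra A]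

/-- The observable `i (a*_x a_y - a*_y a_x)`: the number of particles flowing from `y` to `x` per
unit time. -/
noncomputable def flow (c : CARAlgebra (OneParticle d) A) (y x : Lattice d) : A :=
  I • (c.cre (basisVec x) * c.ann (basisVec y) - c.cre (basisVec y) * c.ann (basisVec x))

/-- The current observable `ĵ_{1,x}`: the average of the flow from `x - e₁` to `x` and the flow
from `x` to `x + e₁`. -/
noncomputable def currentObservable [NeZero d] (c : CARAlgebra (OneParticle d) A)
    (x : Lattice d) : A :=
  (1 / 2 : ℂ) • (flow c (x - unitVec 0) x + flow c x (x + unitVec 0))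

/-- `K` is the bounded operator on `ℓ²(ℤ^d)` extending the commutator `[Q₁, B]`; in particular
`B` maps `D(Q₁)` into itself. As `D(Q₁)` is dense, there is at most one such `K`. -/
def IsPositionCommutator [NeZero d] (B K : OneParticle d →L[ℂ] OneParticle d) : Prop :=
  ∀ φ : (positionOp d).domain, ∃ hB : B φ ∈ (positionOp d).domain,
    K φ = positionOp d ⟨B φ, hB⟩ - B (positionOp d φ)

/-- `v` is the velocity operator `v₁ = i[h, Q₁]`, extended from `D(Q₁)` to `ℓ²(ℤ^d)`. -/
def IsVelocity [NeZero d] (V : Lattice d → ℝ) (hV : ∃ C, ∀ x, |V x| ≤ C)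
    (v : OneParticle d →L[ℂ] OneParticle d) : Prop :=
  ∀ φ : (positionOp d).domain, ∃ hφ : hamiltonian V hV φ ∈ (positionOp d).domain,
    v φ = I • (hamiltonian V hV (positionOp d φ) - positionOp d ⟨hamiltonian V hV φ, hφ⟩)

/-- The group `e^{ish}` of the bounded operator `h`. -/
noncomputable def evolution (V : Lattice d → ℝ) (hV : ∃ C, ∀ x, |V x| ≤ C) (s : ℝ) :
    OneParticle d →L[ℂ] OneParticle d :=
  NormedSpace.exp ((I * (s : ℂ)) • hamiltonian V hV)

/-- The integrand `e^{-2λs} ⟨η_x, e^{-ish} i K e^{ish} v η_x⟩`. -/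
noncomputable def kuboIntegrand (V : Lattice d → ℝ) (hV : ∃ C, ∀ x, |V x| ≤ C) (lam : ℝ)
    (K v : OneParticle d →L[ℂ] OneParticle d) (x : Lattice d) (s : ℝ) : ℂ :=
  (Real.exp (-2 * lam * s) : ℂ) *
    inner ℂ (basisVec x)
      (evolution V hV (-s) (I • K (evolution V hV s (v (basisVec x)))))

end Current

end Davies

/-! The dissipator is quasi-free. Write `α` for the free dynamics in the field, `U` for the
one-particle group in the field, and `ρ` for the Fermi function of `h`. When one field is moved out
of a product of `n` annihilation and creation operators, the dissipator of the box produces a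
damping term `-λ` with the projection `P_N` on the field, and a contraction governed by the Fermi
function of `h_N`, which removes two fields (`dissipator_ann_mul`, `dissipator_cre_mul`). Since
`P_N` tends to the identity and the Fermi function of `h_N` tends to `ρ` strongly
(`tendsto_apply_functionOf`), the dissipator converges on products of degree `n` to `-nλ` plus a map
into degree `n - 2`.

Duhamel's formula with the damping factor `e^{-nλs}` therefore expresses the semigroup in degree `n`
through `e^{-nλt} α_t` and a source of degree `n - 2`. Induction on the degree gives the limit of
infinite volume (`exists_limit`) and, because the free term decays for `n > 0`, the convergence of
every observable to a multiple of the identity as time goes to infinity (`exists_tendsto_atTop`).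
That multiple is the steady state, and every initial state reaches it. All semigroups are bounded by
the same constant, so statements about products of fields extend to their closed span, which is the
whole algebra.

In degree two the source is a scalar, which makes the steady state explicit: `a*(f) a(g)` has the
value `∫ 2λ e^{-2λs} ⟨U_s g, ρ U_s f⟩ ds` over `s > 0`. As `ρ` commutes with `h`, the correlation in
this integral varies with `s` only through the field term: its derivative is `E ⟨U_s g, i[Q₁, ρ] U_s
f⟩`. Integration by parts gives the current in the exact form `a + E Φ(E)`, and differentiability at
`E = 0` needs only the continuity of `Φ` there, which is dominated convergence. The value `Φ(0)` is
the Kubo integral.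

Two analytic facts enter. The commutator `[Q₁, f(h)]` is bounded because `e^{isQ₁} h e^{-isQ₁}` is
differentiable in norm and `f(h)` is the inverse of `1 + e^{β(h - μ)}`. The group `e^{ith_E}`, known
only through its generator on `D(Q₁)`, leaves `D(Q₁)` invariant and tends strongly to `e^{ith}`
there as `E` tends to `0`. -/

namespace Davies

/-! ### Uniform bounds and joint continuity of quantum dynamical semigroups. -/

section SemigroupEstimates

variable {A : Type*} [CStarAlgebra A] [PartialOrder A] [StarOrderedRing A]

/-- A unital completely positive map is bounded by `4`. -/
theorem norm_apply_le_of_map_one (φ : CompletelyPositiveMap A A) (h1 : φ 1 = 1) (x : A) :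
    ‖φ x‖ ≤ 4 * ‖x‖ := by
  have hpos : ∀ y, 0 ≤ y → ‖φ y‖ ≤ ‖y‖ := fun y hy => by
    have h := (PositiveLinearMap.ofClass φ).norm_apply_le_of_nonneg y hy
    have e1 : (PositiveLinearMap.ofClass φ) 1 = 1 := h1
    have e2 : (PositiveLinearMap.ofClass φ) y = φ y := rfl
    rw [e1, e2] at h
    refine h.trans ?_
    rcases subsingleton_or_nontrivial A with hA | hA
    · simp [Subsingleton.elim (1 : A) 0, Subsingleton.elim y 0]
    · simp
  -- The constant 4 counts the positive parts in this decomposition. Contractivity is not needed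
  -- later, only a bound that is the same for all semigroups.
  obtain ⟨y, hy, hn, hx⟩ := CStarAlgebra.exists_sum_four_nonneg x
  conv_lhs => rw [hx]
  rw [map_sum]
  refine (norm_sum_le _ _).trans ?_
  refine (Finset.sum_le_sum (g := fun _ => ‖x‖) fun i _ => ?_).trans (by simp)
  rw [map_smul, norm_smul, norm_pow, norm_I, one_pow, one_mul]
  exact (hpos _ (hy i)).trans (hn i)

namespace QuantumDynamicalSemigroup

variable (T : QuantumDynamicalSemigroup A)

theorem norm_map_le (t : ℝ≥0) (x : A) : ‖T.map t x‖ ≤ 4 * ‖x‖ :=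
  norm_apply_le_of_map_one _ (T.map_one t) x

/-- The maps of a quantum dynamical semigroup as bounded operators. -/
noncomputable def clm (t : ℝ≥0) : A →L[ℂ] A :=
  LinearMap.mkContinuous (T.map t : A →ₗ[ℂ] A) 4 (T.norm_map_le t)

@[simp] theorem clm_apply (t : ℝ≥0) (x : A) : T.clm t x = T.map t x := rfl

theorem tendsto_map_zero (x : A) : Tendsto (fun t => T.map t x) (𝓝 0) (𝓝 x) := by
  have h : Tendsto (fun t => T.map t x) (𝓝[>] 0) (𝓝 x) :=
    tendsto_iff_norm_sub_tendsto_zero.2 (T.tendsto_zero x)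
  have h2 : (𝓝 (0 : ℝ≥0)) = 𝓝[>] 0 ⊔ pure 0 := by
    have h3 : (Set.univ : Set ℝ≥0) = insert 0 (Set.Ioi 0) := by
      ext t
      simp
    rw [← nhdsWithin_univ, h3, nhdsWithin_insert, sup_comm]
  rw [h2, tendsto_sup]
  refine ⟨h, ?_⟩
  rw [tendsto_pure_left]
  intro s hs
  rw [T.map_zero]
  exact mem_of_mem_nhds hs

/-- In `ℝ≥0` one of the two truncated differences vanishes, so their sum is `|t - s|`; the smaller
time is factored out with the semigroup law. -/
theorem norm_map_sub_le (s t : ℝ≥0) (x : A) :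
    ‖T.map t x - T.map s x‖ ≤ 4 * ‖T.map (t - s + (s - t)) x - x‖ := by
  wlog h : s ≤ t generalizing s t
  · rw [norm_sub_rev, add_comm]
    exact this t s (le_of_not_ge h)
  rw [tsub_eq_zero_of_le h, add_zero]
  have : T.map t x = T.map s (T.map (t - s) x) := by
    rw [← T.map_add, add_tsub_cancel_of_le h]
  rw [this, ← map_sub]
  exact T.norm_map_le _ _

/-- Strong continuity together with the bound uniform in time gives joint continuity in time and
observable. -/
theorem tendsto_map {ι : Type*} {l : Filter ι} {f : ι → ℝ≥0} {g : ι → A} {t : ℝ≥0} {x : A}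
    (hf : Tendsto f l (𝓝 t)) (hg : Tendsto g l (𝓝 x)) :
    Tendsto (fun i => T.map (f i) (g i)) l (𝓝 (T.map t x)) := by
  rw [tendsto_iff_norm_sub_tendsto_zero]
  have h1 : Tendsto (fun i => 4 * ‖g i - x‖ + 4 * ‖T.map (f i - t + (t - f i)) x - x‖) l (𝓝 0) := by
    have h2 : Tendsto (fun i => f i - t + (t - f i)) l (𝓝 0) := by
      have hc : Continuous fun r : ℝ≥0 => r - t + (t - r) := by fun_prop
      have := (hc.tendsto t).comp hf
      simpa [Function.comp_def] using this
    have h3 := tendsto_iff_norm_sub_tendsto_zero.1 ((T.tendsto_map_zero x).comp h2)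
    have h4 := (tendsto_iff_norm_sub_tendsto_zero.1 hg).const_mul 4
    simpa using h4.add (h3.const_mul 4)
  refine squeeze_zero (fun i => norm_nonneg _) (fun i => ?_) h1
  have : T.map (f i) (g i) - T.map t x =
      T.map (f i) (g i - x) + (T.map (f i) x - T.map t x) := by
    rw [map_sub]
    abel
  rw [this]
  exact (norm_add_le _ _).trans (add_le_add (T.norm_map_le _ _) (T.norm_map_sub_le _ _ _))

theorem continuous_map {X : Type*} [TopologicalSpace X] {f : X → ℝ≥0} {g : X → A}
    (hf : Continuous f) (hg : Continuous g) : Continuous fun p => T.map (f p) (g p) :=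
  continuous_iff_continuousAt.2 fun p => T.tendsto_map (hf.tendsto p) (hg.tendsto p)

end QuantumDynamicalSemigroup

end SemigroupEstimates

/-! ### Duhamel's formula for a bounded perturbation of a group of *-homomorphisms. -/

section Duhamel

variable {A : Type*} [CStarAlgebra A] [PartialOrder A] [StarOrderedRing A]

/-- The averages of `α_s x` over `0 ≤ s ≤ h`, divided by `h`, lie in the domain, because `α_t` only
shifts the interval of integration; they tend to `x` as `h` tends to `0`. -/
theorem dense_generator_domain (α : ℝ → A →⋆ₐ[ℂ] A) (hα0 : ∀ x, α 0 x = x)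
    (hα : ∀ s t x, α (s + t) x = α s (α t x)) (hαc : ∀ x, Continuous fun t => α t x) :
    Dense {x | ∃ y, IsGeneratorValue (fun t => α t) x y} := by
  intro x
  set F : ℝ → A := fun t => ∫ s in (0 : ℝ)..t, α s x with hF
  have hFd : ∀ t, HasDerivAt F (α t x) t := fun t =>
    (Continuous.integral_hasStrictDerivAt (hαc x) 0 t).hasDerivAt
  have hcomm : ∀ t h : ℝ, ∫ s in (0 : ℝ)..h, α t (α s x) = α t (F h) := fun t h =>
    (homCLM (α t)).intervalIntegral_comp_comm ((hαc x).intervalIntegrable _ _)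
  have hmem : ∀ h : ℝ, ∃ y, IsGeneratorValue (fun t => α t) (h⁻¹ • F h) y := fun h => by
    refine ⟨h⁻¹ • (α h x - x), ?_⟩
    have h1 : ∀ t, α t (F h) = F (t + h) - F t := fun t => by
      have e : α t (F h) = ∫ s in (0 : ℝ)..h, α (t + s) x := by
        simp only [hα]
        exact (hcomm t h).symm
      rw [e, intervalIntegral.integral_comp_add_left (fun s => α s x), add_zero]
      exact (intervalIntegral.integral_interval_sub_left ((hαc x).intervalIntegrable _ _)
        ((hαc x).intervalIntegrable _ _)).symm
    have h2 : HasDerivAt (fun t => α t (F h)) (α h x - x) 0 := by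
      have h3 : HasDerivAt (fun t => F (t + h)) (α h x) 0 := by
        have := hFd (0 + h)
        rw [zero_add] at this
        exact HasDerivAt.comp_add_const 0 h (by rwa [zero_add])
      have h4 := h3.sub (hFd 0)
      rw [hα0] at h4
      exact h4.congr_of_eventuallyEq (Eventually.of_forall h1)
    have h5 := (hasDerivAt_iff_tendsto_slope_zero.1 h2).const_smul h⁻¹
    have h6 : Tendsto (fun t : ℝ≥0 => (t : ℝ)) (𝓝[>] 0) (𝓝[≠] 0) := by
      refine tendsto_nhdsWithin_iff.2 ⟨?_, ?_⟩
      · have := (NNReal.continuous_coe.tendsto 0).mono_left (nhdsWithin_le_nhds (s := Set.Ioi 0))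
        simpa using this
      · filter_upwards [self_mem_nhdsWithin] with t ht
        exact (NNReal.coe_pos.2 ht).ne'
    refine (h5.comp h6).congr fun t => ?_
    have e : ∀ y : A, α t (h⁻¹ • y) = h⁻¹ • α t y := fun y =>
      map_smul (α t) ((h⁻¹ : ℝ) : ℂ) y
    simp only [Function.comp_apply, zero_add, hα0, e, ← smul_sub]
    rw [smul_comm]
  have hlim : Tendsto (fun h : ℝ => h⁻¹ • F h) (𝓝[≠] 0) (𝓝 x) := by
    have := hasDerivAt_iff_tendsto_slope_zero.1 (hFd 0)
    have hF0 : F 0 = 0 := by simp [hF]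
    simpa [hF0, hα0] using this
  exact mem_closure_of_tendsto hlim (Eventually.of_forall hmem)

/-- Duhamel's formula for the semigroup generated by `δ + D`, with `D` bounded and `δ` the
generator of the group `α`. -/
theorem QuantumDynamicalSemigroup.duhamel (T : QuantumDynamicalSemigroup A)
    (α : ℝ → A →⋆ₐ[ℂ] A) (hα0 : ∀ x, α 0 x = x)
    (hα : ∀ s t x, α (s + t) x = α s (α t x)) (hαc : ∀ x, Continuous fun t => α t x)
    (D : A →L[ℂ] A) (hT : ∀ x y, IsGeneratorValue (fun t => T.map t) x y ↔
      ∃ y', IsGeneratorValue (fun t => α t) x y' ∧ y = y' + D x) (c : ℝ) (t : ℝ≥0) (x : A) :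
    T.map t x = Real.exp (-c * t) • α t x +
      ∫ s in (0 : ℝ)..t, Real.exp (-c * s) •
        T.map (Real.toNNReal (t - s)) (D (α s x) + c • α s x) := by
  have hjc : Continuous fun p : A × ℝ => α p.2 p.1 := by
    rw [continuous_iff_continuousAt]
    rintro ⟨z, s⟩
    have h1 : Tendsto (fun p : A × ℝ => α p.2 (p.1 - z)) (𝓝 (z, s)) (𝓝 0) := by
      have h2 : Tendsto (fun p : A × ℝ => ‖p.1 - z‖) (𝓝 (z, s)) (𝓝 0) := by
        have hc : Continuous fun p : A × ℝ => ‖p.1 - z‖ := by fun_prop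
        simpa using hc.tendsto (z, s)
      exact squeeze_zero_norm (fun p => NonUnitalStarAlgHom.norm_apply_le (α p.2) _) h2
    have h3 : Tendsto (fun p : A × ℝ => α p.2 z) (𝓝 (z, s)) (𝓝 (α s z)) :=
      ((hαc z).comp continuous_snd).tendsto (z, s)
    simpa [ContinuousAt] using h1.add h3
  have hvc : Continuous fun p : A × ℝ => Real.exp (-c * p.2) •
      T.map (Real.toNNReal (t - p.2)) (D (α p.2 p.1) + c • α p.2 p.1) := by
    have he : Continuous fun p : A × ℝ => Real.exp (-c * p.2) :=
      Real.continuous_exp.comp (continuous_snd.const_mul (-c))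
    refine he.smul (T.continuous_map (by fun_prop) ?_)
    exact (D.continuous.comp hjc).add (hjc.const_smul c)
  -- Both sides are continuous in `x`, so the formula needs a proof only on the dense domain of the
  -- generator, where orbits can be differentiated.
  have hclosed : IsClosed {x | T.map t x = Real.exp (-c * t) • α t x +
      ∫ s in (0 : ℝ)..t, Real.exp (-c * s) •
        T.map (Real.toNNReal (t - s)) (D (α s x) + c • α s x)} := by
    refine isClosed_eq (T.continuous_map continuous_const continuous_id) ?_
    refine ((continuous_starAlgHom (α t)).const_smul _).add ?_
    exact intervalIntegral.continuous_parametric_intervalIntegral_of_continuous' hvc _ _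
  refine hclosed.closure_subset_iff.2 ?_ (dense_generator_domain α hα0 hα hαc x)
  rintro x ⟨y, hy⟩
  have hgen : ∀ s, IsGeneratorValue (fun t => α t) (α s x) (α s y) := fun s => by
    refine (((continuous_starAlgHom (α s)).tendsto y).comp hy).congr fun r => ?_
    have e : ∀ y : A, α s ((r : ℝ)⁻¹ • y) = (r : ℝ)⁻¹ • α s y := fun y =>
      map_smul (α s) (((r : ℝ)⁻¹ : ℝ) : ℂ) y
    simp only [Function.comp_apply]
    rw [e, map_sub, ← hα, ← hα, add_comm s]
  -- The path `w` interpolates between `T_t x` at `s = 0` and `α_t x` at `s = t`. In its derivative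
  -- the generator of `α` cancels and only the bounded `D` survives. Generator values are one-sided
  -- limits, so only right derivatives are available; for a continuous path they suffice in the
  -- fundamental theorem of calculus.
  set w : ℝ → A := fun s => T.map (Real.toNNReal (t - s)) (α s x) with hw
  have hwd : ∀ s ∈ Set.Ioo (0 : ℝ) t,
      HasDerivWithinAt w (-T.map (Real.toNNReal (t - s)) (D (α s x))) (Set.Ioi s) s := by
    intro s hs
    rw [hasDerivWithinAt_iff_tendsto_slope' (by simp)]
    have h1 := (hT (α s x) _).2 ⟨_, hgen s, rfl⟩
    have h2 := (hgen s).sub h1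
    rw [sub_add_cancel_left] at h2
    have h3 : Tendsto (fun r : ℝ => Real.toNNReal (r - s)) (𝓝[>] s) (𝓝[>] 0) := by
      refine tendsto_nhdsWithin_iff.2 ⟨?_, ?_⟩
      · have hc : Continuous fun r : ℝ => Real.toNNReal (r - s) := by fun_prop
        have := (hc.tendsto s).mono_left (nhdsWithin_le_nhds (s := Set.Ioi s))
        simpa using this
      · filter_upwards [self_mem_nhdsWithin] with r hr
        simpa using hr
    have h4 : Tendsto (fun r : ℝ => Real.toNNReal (t - r)) (𝓝[>] s)
        (𝓝 (Real.toNNReal (t - s))) := by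
      have hc : Continuous fun r : ℝ => Real.toNNReal (t - r) := by fun_prop
      exact (hc.tendsto s).mono_left nhdsWithin_le_nhds
    have h5 := T.tendsto_map h4 (h2.comp h3)
    rw [map_neg] at h5
    refine h5.congr' ?_
    filter_upwards [Ioo_mem_nhdsGT hs.2] with r hr
    have hr1 : ((Real.toNNReal (r - s) : ℝ≥0) : ℝ) = r - s :=
      Real.coe_toNNReal _ (sub_nonneg.2 hr.1.le)
    have hr2 : Real.toNNReal (t - s) = Real.toNNReal (t - r) + Real.toNNReal (r - s) := by
      rw [← Real.toNNReal_add (sub_nonneg.2 hr.2.le) (sub_nonneg.2 hr.1.le)]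
      congr 1
      ring
    have e : ∀ z : A, T.map (Real.toNNReal (t - r)) ((r - s)⁻¹ • z) =
        (r - s)⁻¹ • T.map (Real.toNNReal (t - r)) z := fun z =>
      map_smul (T.map _) (((r - s)⁻¹ : ℝ) : ℂ) z
    simp only [Function.comp_apply, slope_def_module, hw, hr1]
    rw [← smul_sub, sub_sub_sub_cancel_right, e, map_sub, ← hα, sub_add_cancel, hr2, T.map_add]
  have hwc : Continuous w := T.continuous_map (by fun_prop) (hαc x)
  -- The factor `e^{-cs}` replaces `D` by `D + c`; the constant will be chosen to cancel the damping
  -- of products of a given degree.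
  have hud : ∀ s ∈ Set.Ioo (0 : ℝ) t, HasDerivWithinAt (fun s => Real.exp (-c * s) • w s)
      (-(Real.exp (-c * s) •
        T.map (Real.toNNReal (t - s)) (D (α s x) + c • α s x))) (Set.Ioi s) s := by
    intro s hs
    have h1 : HasDerivAt (fun s => Real.exp (-c * s)) (Real.exp (-c * s) * (-c * 1)) s :=
      ((hasDerivAt_id s).const_mul (-c)).exp
    refine (h1.hasDerivWithinAt.smul (hwd s hs)).congr_deriv ?_
    have e : T.map (Real.toNNReal (t - s)) (c • α s x) = c • w s := map_smul (T.map _) (c : ℂ) _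
    rw [_root_.map_add, e]
    module
  have hint := intervalIntegral.integral_eq_sub_of_hasDeriv_right_of_le t.2
    (Continuous.continuousOn (by fun_prop)) hud
    (Continuous.intervalIntegrable
      ((hvc.comp (continuous_const.prodMk continuous_id)).neg :
        Continuous fun s : ℝ => _) _ _)
  have hw1 : w t = α t x := by simp [hw, T.map_zero]
  have hw0 : w 0 = T.map t x := by simp [hw, hα0]
  have hint' : -(∫ s in (0 : ℝ)..t, Real.exp (-c * s) •
        T.map (Real.toNNReal (t - s)) (D (α s x) + c • α s x)) =
      Real.exp (-c * t) • α t x - T.map t x := by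
    rw [← intervalIntegral.integral_neg]
    rw [← hw1, ← hw0]
    simpa using hint
  show T.map t x = _
  rw [neg_eq_iff_eq_neg] at hint'
  rw [hint']
  abel

end Duhamel

/-! ### Products of fields, contractions, and quasi-free dissipators. -/

namespace CARAlgebra

variable {H : Type*} [NormedAddCommGroup H] [InnerProductSpace ℂ H]
variable {A : Type*} [CStarAlgebra A] (c : CARAlgebra H A)

theorem norm_cre_le (f : H) : ‖c.cre f‖ ≤ ‖f‖ := by
  rw [cre, norm_star]
  exact c.norm_ann_le f

theorem continuous_ann : Continuous c.ann :=
  (LinearMap.mkContinuous c.ann 1 fun f => by simpa using c.norm_ann_le f).continuous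

theorem continuous_cre : Continuous c.cre := c.continuous_ann.star

theorem bogoliubov_cre (U : H →ₗᵢ[ℂ] H) (f : H) : c.bogoliubov U (c.cre f) = c.cre (U f) := by
  rw [cre, map_star, bogoliubov_ann, cre]

theorem parity_cre (f : H) : c.parity (c.cre f) = -c.cre f := by
  rw [cre, map_star, parity_ann, star_neg]

/-- The annihilation and creation operators. -/
def IsField (w : A) : Prop := ∃ f, w = c.ann f ∨ w = c.cre f

theorem IsField.ann (f : H) : c.IsField (c.ann f) := ⟨f, Or.inl rfl⟩

theorem IsField.cre (f : H) : c.IsField (c.cre f) := ⟨f, Or.inr rfl⟩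

theorem IsField.parity {w : A} (hw : c.IsField w) : c.parity w = -w := by
  obtain ⟨f, rfl | rfl⟩ := hw
  · exact c.parity_ann f
  · exact c.parity_cre f

theorem IsField.bogoliubov {w : A} (hw : c.IsField w) (U : H →ₗᵢ[ℂ] H) :
    c.IsField (c.bogoliubov U w) := by
  obtain ⟨f, rfl | rfl⟩ := hw
  · exact ⟨U f, Or.inl (c.bogoliubov_ann U f)⟩
  · exact ⟨U f, Or.inr (c.bogoliubov_cre U f)⟩

theorem cre_mul_ann_add (f g : H) :
    c.cre f * c.ann g + c.ann g * c.cre f = inner ℂ g f • (1 : A) := c.star_ann_mul_ann f g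

theorem ann_mul_cre_add (f g : H) :
    c.ann g * c.cre f + c.cre f * c.ann g = inner ℂ g f • (1 : A) := by
  rw [add_comm]
  exact c.cre_mul_ann_add f g

theorem cre_mul_cre_add (f g : H) : c.cre f * c.cre g + c.cre g * c.cre f = 0 := by
  have := congrArg star (c.ann_mul_ann g f)
  simpa [cre] using this

theorem IsField.anticommutator {v w : A} (hv : c.IsField v) (hw : c.IsField w) :
    ∃ z : ℂ, v * w + w * v = z • (1 : A) := by
  obtain ⟨f, rfl | rfl⟩ := hv <;> obtain ⟨g, rfl | rfl⟩ := hw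
  · exact ⟨0, by rw [c.ann_mul_ann, zero_smul]⟩
  · exact ⟨_, c.ann_mul_cre_add g f⟩
  · exact ⟨_, c.cre_mul_ann_add f g⟩
  · exact ⟨0, by rw [c.cre_mul_cre_add, zero_smul]⟩

/-- The graded commutator `b x - θ(x) b` with an odd element `b`. -/
noncomputable def gradedComm (b x : A) : A := b * x - c.parity x * b

theorem gradedComm_one (b : A) : c.gradedComm b 1 = 0 := by simp [gradedComm]

theorem gradedComm_add (b x y : A) :
    c.gradedComm b (x + y) = c.gradedComm b x + c.gradedComm b y := by
  simp only [gradedComm, map_add, mul_add, add_mul]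
  abel

theorem gradedComm_smul (b : A) (z : ℂ) (x : A) :
    c.gradedComm b (z • x) = z • c.gradedComm b x := by
  simp only [gradedComm, map_smul, mul_smul_comm, smul_mul_assoc, smul_sub]

theorem gradedComm_zero (b : A) : c.gradedComm b 0 = 0 := by simp [gradedComm]

theorem gradedComm_field (b : A) {w : A} (hw : c.IsField w) :
    c.gradedComm b w = b * w + w * b := by
  rw [gradedComm, hw.parity, neg_mul, sub_neg_eq_add]

/-- An antiderivation rule: the parity automorphism supplies the sign when `b` passes the field `w`.
-/
theorem gradedComm_field_mul (b : A) {w : A} (hw : c.IsField w) (x : A) :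
    c.gradedComm b (w * x) = (b * w + w * b) * x - w * c.gradedComm b x := by
  simp only [gradedComm, map_mul, hw.parity]
  noncomm_ring

theorem norm_gradedComm_le (b x : A) : ‖c.gradedComm b x‖ ≤ 2 * ‖b‖ * ‖x‖ := by
  have h1 : ‖c.parity x‖ ≤ ‖x‖ := NonUnitalStarAlgHom.norm_apply_le c.parity x
  calc ‖c.gradedComm b x‖ ≤ ‖b‖ * ‖x‖ + ‖c.parity x‖ * ‖b‖ :=
        (norm_sub_le _ _).trans (add_le_add (norm_mul_le _ _) (norm_mul_le _ _))
    _ ≤ ‖b‖ * ‖x‖ + ‖x‖ * ‖b‖ := by gcongr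
    _ = _ := by ring

/-- The span of the products of `n` annihilation and creation operators. -/
noncomputable def monomialSpan : ℕ → Submodule ℂ A
  | 0 => Submodule.span ℂ {1}
  | n + 1 => Submodule.span ℂ {y | ∃ w x, c.IsField w ∧ x ∈ monomialSpan n ∧ y = w * x}

/-- The span of the products of `n - 2` annihilation and creation operators. -/
noncomputable def contractionSpan : ℕ → Submodule ℂ A
  | 0 => ⊥
  | 1 => ⊥
  | n + 2 => c.monomialSpan n

theorem mul_mem_monomialSpan {w x : A} {n : ℕ} (hw : c.IsField w) (hx : x ∈ c.monomialSpan n) :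
    w * x ∈ c.monomialSpan (n + 1) :=
  Submodule.subset_span ⟨w, x, hw, hx, rfl⟩

theorem mul_mem_contractionSpan {w x : A} {n : ℕ} (hw : c.IsField w)
    (hx : x ∈ c.contractionSpan n) : w * x ∈ c.contractionSpan (n + 1) := by
  match n, hx with
  | 0, hx =>
    rw [(Submodule.mem_bot ℂ).1 hx, mul_zero]
    exact zero_mem _
  | 1, hx =>
    rw [(Submodule.mem_bot ℂ).1 hx, mul_zero]
    exact zero_mem _
  | n + 2, hx => exact c.mul_mem_monomialSpan hw hx

/-- Induction over products of annihilation and creation operators. -/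
theorem monomialSpan_induction {p : ℕ → A → Prop} (one : p 0 1)
    (mul : ∀ n w x, c.IsField w → x ∈ c.monomialSpan n → p n x → p (n + 1) (w * x))
    (zero : ∀ n, p n 0) (add : ∀ n x y, p n x → p n y → p n (x + y))
    (smul : ∀ n (z : ℂ) x, p n x → p n (z • x)) (n : ℕ) (x : A) (hx : x ∈ c.monomialSpan n) :
    p n x := by
  induction n generalizing x with
  | zero =>
    obtain ⟨z, rfl⟩ := Submodule.mem_span_singleton.1 hx
    exact smul _ _ _ one
  | succ n ih =>
    induction hx using Submodule.span_induction with
    | mem y hy =>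
      obtain ⟨w, x, hw, hx, rfl⟩ := hy
      exact mul n w x hw hx (ih x hx)
    | zero => exact zero _
    | add y z _ _ hy hz => exact add _ _ _ hy hz
    | smul z y _ hy => exact smul _ _ _ hy

theorem bogoliubov_mem_monomialSpan (U : H →ₗᵢ[ℂ] H) (n : ℕ) (x : A) (hx : x ∈ c.monomialSpan n) :
    c.bogoliubov U x ∈ c.monomialSpan n := by
  refine c.monomialSpan_induction (p := fun n x => c.bogoliubov U x ∈ c.monomialSpan n)
    ?_ ?_ ?_ ?_ ?_ n x hx
  · rw [map_one]
    exact Submodule.mem_span_singleton_self 1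
  · intro n w x hw _ hx
    rw [map_mul]
    exact c.mul_mem_monomialSpan (hw.bogoliubov c U) hx
  · intro n
    rw [map_zero]
    exact zero_mem _
  · intro n x y hx hy
    rw [map_add]
    exact add_mem hx hy
  · intro n z x hx
    rw [map_smul]
    exact Submodule.smul_mem _ z hx

/-- By the antiderivation rule `b` is contracted with each field of the product in turn, and each
anticommutator is a scalar. The index `n + 1` counts `b` as well, so the result has degree `n - 1`,
and it vanishes for `n = 0`. -/
theorem gradedComm_mem {b : A} (hb : c.IsField b) (n : ℕ) (x : A) (hx : x ∈ c.monomialSpan n) :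
    c.gradedComm b x ∈ c.contractionSpan (n + 1) := by
  refine c.monomialSpan_induction (p := fun n x => c.gradedComm b x ∈ c.contractionSpan (n + 1))
    ?_ ?_ ?_ ?_ ?_ n x hx
  · rw [gradedComm_one]
    exact zero_mem _
  · intro n w x hw hx hx'
    rw [c.gradedComm_field_mul b hw]
    refine sub_mem ?_ (c.mul_mem_contractionSpan hw hx')
    obtain ⟨z, hz⟩ := hb.anticommutator c hw
    rw [hz, smul_mul_assoc, one_mul]
    exact Submodule.smul_mem _ z hx
  · intro n
    rw [gradedComm_zero]
    exact zero_mem _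
  · intro n x y hx hy
    rw [gradedComm_add]
    exact add_mem hx hy
  · intro n z x hx
    rw [gradedComm_smul]
    exact Submodule.smul_mem _ z hx

/-- A closed subspace containing the products of annihilation and creation operators is the whole
algebra. -/
theorem mem_of_monomialSpan_le (S : Submodule ℂ A) (hS : IsClosed (S : Set A))
    (h : ∀ n, c.monomialSpan n ≤ S) (x : A) : x ∈ S := by
  have hadj : (StarAlgebra.adjoin ℂ (Set.range c.ann) : Set A) ⊆ S := by
    intro y hy
    -- The *-subalgebra generated by the `a(f)` is the plain algebra generated by the `a(f)` and
    -- `a*(f)`, hence the span of their products.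
    have hy' : y ∈ (Algebra.adjoin ℂ (Set.range c.ann ∪ star (Set.range c.ann))) := hy
    rw [← Subalgebra.mem_toSubmodule, Algebra.adjoin_eq_span] at hy'
    refine Submodule.span_le.2 ?_ hy'
    intro z hz
    have : ∃ n, z ∈ c.monomialSpan n := by
      induction hz using Submonoid.closure_induction_left with
      | one => exact ⟨0, Submodule.mem_span_singleton_self 1⟩
      | mul_left w hw z _ ih =>
        obtain ⟨n, hn⟩ := ih
        refine ⟨n + 1, c.mul_mem_monomialSpan ?_ hn⟩
        rcases hw with ⟨f, rfl⟩ | ⟨f, hf⟩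
        · exact IsField.ann c f
        · refine ⟨f, Or.inr ?_⟩
          rw [cre, hf, star_star]
    obtain ⟨n, hn⟩ := this
    exact h n hn
  have hx : x ∈ closure (StarAlgebra.adjoin ℂ (Set.range c.ann) : Set A) := by
    have : x ∈ (StarAlgebra.adjoin ℂ (Set.range c.ann)).topologicalClosure := by
      rw [c.generates]
      trivial
    exact this
  exact hS.closure_subset_iff.2 hadj hx

/-- `D` is a quasi-free dissipator: it acts as `- λ P` on one-particle space, up to contractions
given by the density operator `ρ`. -/
structure IsQuasiFreeDissipator (lam : ℝ) (P ρ : H → H) (D : A →L[ℂ] A) : Prop where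
  map_one : D 1 = 0
  ann_mul : ∀ f x, D (c.ann f * x) = c.ann f * D x - (lam : ℂ) • (c.ann (P f) * x) +
    (2 * lam : ℂ) • c.gradedComm (c.ann (P f - ρ f)) x
  cre_mul : ∀ f x, D (c.cre f * x) = c.cre f * D x - (lam : ℂ) • (c.cre (P f) * x) +
    (2 * lam : ℂ) • c.gradedComm (c.cre (ρ f)) x
  norm_le : ∀ f, ‖P f‖ ≤ ‖f‖ ∧ ‖ρ f‖ ≤ ‖f‖

variable {c}

namespace IsQuasiFreeDissipator

variable {ι : Type*} {lam : ℝ} {P ρ : ι → H → H} {D : ι → A →L[ℂ] A}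

/-- One form for both kinds of fields, with bounds that depend neither on `i` nor on the isometry.
The bound on `m` is `2 * r` because the contraction of an annihilation operator involves the
difference `P - ρ`. -/
theorem field_mul (h : ∀ i, c.IsQuasiFreeDissipator lam (P i) (ρ i) (D i)) {w : A}
    (hw : c.IsField w) :
    ∃ r : ℝ, 0 ≤ r ∧ ∀ i, ∀ U : H →ₗᵢ[ℂ] H, ∃ p m, ‖c.bogoliubov U w‖ ≤ r ∧ ‖p‖ ≤ r ∧
      ‖m‖ ≤ 2 * r ∧ ∀ x, D i (c.bogoliubov U w * x) = c.bogoliubov U w * D i x -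
        (lam : ℂ) • (p * x) + (2 * lam : ℂ) • c.gradedComm m x := by
  obtain ⟨f, rfl | rfl⟩ := hw
  · refine ⟨‖f‖, norm_nonneg f, fun i U => ⟨c.ann (P i (U f)), c.ann (P i (U f) - ρ i (U f)),
      ?_, ?_, ?_, fun x => ?_⟩⟩
    · rw [bogoliubov_ann]
      exact (c.norm_ann_le _).trans (U.norm_map f).le
    · exact (c.norm_ann_le _).trans (((h i).norm_le _).1.trans (U.norm_map f).le)
    · refine (c.norm_ann_le _).trans ((norm_sub_le _ _).trans ?_)
      rw [two_mul]
      exact add_le_add (((h i).norm_le _).1.trans (U.norm_map f).le)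
        (((h i).norm_le _).2.trans (U.norm_map f).le)
    · rw [bogoliubov_ann]
      exact (h i).ann_mul _ x
  · refine ⟨‖f‖, norm_nonneg f, fun i U => ⟨c.cre (P i (U f)), c.cre (ρ i (U f)),
      ?_, ?_, ?_, fun x => ?_⟩⟩
    · rw [bogoliubov_cre]
      exact (c.norm_cre_le _).trans (U.norm_map f).le
    · exact (c.norm_cre_le _).trans (((h i).norm_le _).1.trans (U.norm_map f).le)
    · refine (c.norm_cre_le _).trans (((h i).norm_le _).2.trans ((U.norm_map f).le.trans ?_))
      linarith [norm_nonneg f]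
    · rw [bogoliubov_cre]
      exact (h i).cre_mul _ x

/-- On products of `n` fields the dissipators are `- n λ`, up to uniformly bounded operators. -/
theorem exists_bound (h : ∀ i, c.IsQuasiFreeDissipator lam (P i) (ρ i) (D i)) (n : ℕ) (x : A)
    (hx : x ∈ c.monomialSpan n) :
    ∃ C : ℝ, ∀ i, ∀ U : H →ₗᵢ[ℂ] H,
      ‖D i (c.bogoliubov U x) + (n * lam : ℝ) • c.bogoliubov U x‖ ≤ C := by
  refine c.monomialSpan_induction (p := fun n x => ∃ C : ℝ, ∀ i, ∀ U : H →ₗᵢ[ℂ] H,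
      ‖D i (c.bogoliubov U x) + (n * lam : ℝ) • c.bogoliubov U x‖ ≤ C) ?_ ?_ ?_ ?_ ?_ n x hx
  · exact ⟨0, fun i U => by simp [(h i).map_one]⟩
  · rintro n w x hw - ⟨C, hC⟩
    obtain ⟨r, hr, h1⟩ := field_mul h hw
    refine ⟨r * C + |lam| * (r * ‖x‖ + r * ‖x‖) + |lam| * (2 * (2 * (2 * r) * ‖x‖)),
      fun i U => ?_⟩
    obtain ⟨p, m, hwr, hp, hm, hD⟩ := h1 i U
    have hx : ‖c.bogoliubov U x‖ ≤ ‖x‖ := NonUnitalStarAlgHom.norm_apply_le _ x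
    set w' := c.bogoliubov U w
    set x' := c.bogoliubov U x
    -- The additional `λ` from `n + 1` does not cancel the damping exactly, since `P i` need not be
    -- the identity. What remains is the bounded error `λ (w' - p) x'`.
    have e : D i (c.bogoliubov U (w * x)) + ((n + 1 : ℕ) * lam : ℝ) • c.bogoliubov U (w * x) =
        w' * (D i x' + (n * lam : ℝ) • x') + (lam : ℂ) • (w' * x' - p * x') +
          (lam : ℂ) • ((2 : ℂ) • c.gradedComm m x') := by
      rw [map_mul, hD, mul_add]
      have e1 : ∀ (q : ℝ) (y : A), q • y = (q : ℂ) • y := fun _ _ => rfl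
      rw [e1, e1, mul_smul_comm]
      push_cast
      module
    rw [e]
    refine (norm_add_le _ _).trans (add_le_add ((norm_add_le _ _).trans (add_le_add ?_ ?_)) ?_)
    · exact (norm_mul_le _ _).trans (mul_le_mul hwr (hC i U) (norm_nonneg _) hr)
    · rw [norm_smul, Complex.norm_real, Real.norm_eq_abs]
      gcongr
      refine (norm_sub_le _ _).trans (add_le_add ?_ ?_)
      · exact (norm_mul_le _ _).trans (mul_le_mul hwr hx (norm_nonneg _) hr)
      · exact (norm_mul_le _ _).trans (mul_le_mul hp hx (norm_nonneg _) hr)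
    · rw [norm_smul, norm_smul, Complex.norm_real, Real.norm_eq_abs, Complex.norm_two]
      gcongr
      refine (c.norm_gradedComm_le _ _).trans ?_
      gcongr
  · exact fun n => ⟨0, fun i U => by simp⟩
  · rintro n x y ⟨C, hC⟩ ⟨C', hC'⟩
    refine ⟨C + C', fun i U => ?_⟩
    have e : D i (c.bogoliubov U (x + y)) + (n * lam : ℝ) • c.bogoliubov U (x + y) =
        (D i (c.bogoliubov U x) + (n * lam : ℝ) • c.bogoliubov U x) +
        (D i (c.bogoliubov U y) + (n * lam : ℝ) • c.bogoliubov U y) := by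
      rw [map_add, map_add, smul_add]
      abel
    rw [e]
    exact (norm_add_le _ _).trans (add_le_add (hC i U) (hC' i U))
  · rintro n z x ⟨C, hC⟩
    refine ⟨‖z‖ * C, fun i U => ?_⟩
    have e : D i (c.bogoliubov U (z • x)) + (n * lam : ℝ) • c.bogoliubov U (z • x) =
        z • (D i (c.bogoliubov U x) + (n * lam : ℝ) • c.bogoliubov U x) := by
      rw [map_smul, map_smul, smul_add, smul_comm]
    rw [e, norm_smul]
    gcongr
    exact hC i U

variable {l : Filter ι} {ρ' : H → H}

theorem tendsto_field_mul {w p' m' x y : A} {p m : ι → A}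
    (hD : ∀ i, D i (w * x) = w * D i x - (lam : ℂ) • (p i * x) +
      (2 * lam : ℂ) • c.gradedComm (m i) x) (hp : Tendsto p l (𝓝 p'))
    (hm : Tendsto m l (𝓝 m')) (hy : Tendsto (fun i => D i x) l (𝓝 y)) :
    Tendsto (fun i => D i (w * x)) l (𝓝 (w * y - (lam : ℂ) • (p' * x) +
      (2 * lam : ℂ) • c.gradedComm m' x)) := by
  simp only [hD]
  refine ((hy.const_mul w).sub ((hp.mul_const x).const_smul _)).add (Tendsto.const_smul ?_ _)
  exact (hm.mul_const x).sub (hm.const_mul (c.parity x))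

theorem tendsto_ann_mul (h : ∀ i, c.IsQuasiFreeDissipator lam (P i) (ρ i) (D i))
    (hP : ∀ f, Tendsto (fun i => P i f) l (𝓝 f)) (hρ : ∀ f, Tendsto (fun i => ρ i f) l (𝓝 (ρ' f)))
    (f : H) {x y : A} (hy : Tendsto (fun i => D i x) l (𝓝 y)) :
    Tendsto (fun i => D i (c.ann f * x)) l (𝓝 (c.ann f * y - (lam : ℂ) • (c.ann f * x) +
      (2 * lam : ℂ) • c.gradedComm (c.ann (f - ρ' f)) x)) :=
  tendsto_field_mul (fun i => (h i).ann_mul f x) ((c.continuous_ann.tendsto _).comp (hP f))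
    ((c.continuous_ann.tendsto _).comp ((hP f).sub (hρ f))) hy

theorem tendsto_cre_mul (h : ∀ i, c.IsQuasiFreeDissipator lam (P i) (ρ i) (D i))
    (hP : ∀ f, Tendsto (fun i => P i f) l (𝓝 f)) (hρ : ∀ f, Tendsto (fun i => ρ i f) l (𝓝 (ρ' f)))
    (f : H) {x y : A} (hy : Tendsto (fun i => D i x) l (𝓝 y)) :
    Tendsto (fun i => D i (c.cre f * x)) l (𝓝 (c.cre f * y - (lam : ℂ) • (c.cre f * x) +
      (2 * lam : ℂ) • c.gradedComm (c.cre (ρ' f)) x)) :=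
  tendsto_field_mul (fun i => (h i).cre_mul f x) ((c.continuous_cre.tendsto _).comp (hP f))
    ((c.continuous_cre.tendsto _).comp (hρ f)) hy

/-- On products of `n` fields the dissipators converge to `- n λ`, up to contractions. -/
theorem exists_tendsto (h : ∀ i, c.IsQuasiFreeDissipator lam (P i) (ρ i) (D i))
    (hP : ∀ f, Tendsto (fun i => P i f) l (𝓝 f)) (hρ : ∀ f, Tendsto (fun i => ρ i f) l (𝓝 (ρ' f)))
    (n : ℕ) (x : A) (hx : x ∈ c.monomialSpan n) :
    ∃ y ∈ c.contractionSpan n, Tendsto (fun i => D i x + (n * lam : ℝ) • x) l (𝓝 y) := by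
  have e1 : ∀ (q : ℝ) (y : A), q • y = (q : ℂ) • y := fun _ _ => rfl
  refine c.monomialSpan_induction (p := fun n x => ∃ y ∈ c.contractionSpan n,
    Tendsto (fun i => D i x + (n * lam : ℝ) • x) l (𝓝 y)) ?_ ?_ ?_ ?_ ?_ n x hx
  · exact ⟨0, zero_mem _, by simpa [(h _).map_one] using tendsto_const_nhds⟩
  · rintro n w x hw hx ⟨y, hy, hlim⟩
    have hlim' := hlim.sub_const ((n * lam : ℝ) • x)
    simp only [add_sub_cancel_right] at hlim'
    -- In the limit the damping of the new field is exactly `-λ`, which the additional `λ` from `n +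
    -- 1` cancels. Only contractions are left.
    have key : ∀ m, c.IsField m → Tendsto (fun i => D i (w * x)) l
        (𝓝 (w * (y - (n * lam : ℝ) • x) - (lam : ℂ) • (w * x) +
          (2 * lam : ℂ) • c.gradedComm m x)) →
        ∃ y ∈ c.contractionSpan (n + 1),
          Tendsto (fun i => D i (w * x) + ((n + 1 : ℕ) * lam : ℝ) • (w * x)) l (𝓝 y) := by
      intro m hm hl
      refine ⟨w * y + (2 * lam : ℂ) • c.gradedComm m x, add_mem (c.mul_mem_contractionSpan hw hy)
        (Submodule.smul_mem _ _ (c.gradedComm_mem hm n x hx)), ?_⟩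
      have := hl.add_const (((n + 1 : ℕ) * lam : ℝ) • (w * x))
      convert this using 2
      rw [e1, e1, mul_sub, mul_smul_comm]
      push_cast
      module
    obtain ⟨f, rfl | rfl⟩ := hw
    · exact key _ (IsField.ann c _) (tendsto_ann_mul h hP hρ f hlim')
    · exact key _ (IsField.cre c _) (tendsto_cre_mul h hP hρ f hlim')
  · exact fun n => ⟨0, zero_mem _, by simpa using tendsto_const_nhds⟩
  · rintro n x y ⟨x', hx, hlx⟩ ⟨y', hy, hly⟩
    refine ⟨x' + y', add_mem hx hy, (hlx.add hly).congr fun i => ?_⟩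
    rw [map_add, smul_add]
    abel
  · rintro n z x ⟨x', hx, hlx⟩
    refine ⟨z • x', Submodule.smul_mem _ _ hx, (hlx.const_smul z).congr fun i => ?_⟩
    rw [map_smul, smul_add, smul_comm]

/-- In degree two only one contraction occurs, that of `a*(ρ' f)` with `a(g)`. This explicit scalar
is the source of the two-point function of the steady state. -/
theorem tendsto_cre_mul_ann (h : ∀ i, c.IsQuasiFreeDissipator lam (P i) (ρ i) (D i))
    (hP : ∀ f, Tendsto (fun i => P i f) l (𝓝 f)) (hρ : ∀ f, Tendsto (fun i => ρ i f) l (𝓝 (ρ' f)))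
    (f g : H) :
    Tendsto (fun i => D i (c.cre f * c.ann g) + (2 * lam : ℝ) • (c.cre f * c.ann g)) l
      (𝓝 ((2 * lam * inner ℂ g (ρ' f) : ℂ) • (1 : A))) := by
  have h0 : Tendsto (fun i => D i 1) l (𝓝 0) := by
    simp only [(h _).map_one]
    exact tendsto_const_nhds
  have h1 := tendsto_ann_mul h hP hρ g h0
  simp only [mul_one, mul_zero, zero_sub, gradedComm_one, smul_zero, add_zero] at h1
  have h2 := (tendsto_cre_mul h hP hρ f h1).add_const ((2 * lam : ℝ) • (c.cre f * c.ann g))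
  convert h2 using 2
  have e1 : ∀ (q : ℝ) (y : A), q • y = (q : ℂ) • y := fun _ _ => rfl
  rw [c.gradedComm_field _ (IsField.ann c g), c.cre_mul_ann_add, e1, mul_neg, mul_smul_comm]
  push_cast
  module

end IsQuasiFreeDissipator

end CARAlgebra

/-! ### Extension of convergence from a subspace to its closure. -/

section ConvergenceSubmodule

variable {A : Type*} [NormedAddCommGroup A] [NormedSpace ℂ A] {ι : Type*}

/-- The vectors on which `L` converges to an element of `M`. -/
def convergenceSubmodule (L : ι → A →L[ℂ] A) (l : Filter ι) (M : Submodule ℂ A) :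
    Submodule ℂ A where
  carrier := {x | ∃ y ∈ M, Tendsto (fun i => L i x) l (𝓝 y)}
  add_mem' := by
    rintro x y ⟨x', hx, hlx⟩ ⟨y', hy, hly⟩
    exact ⟨x' + y', add_mem hx hy, by simpa using hlx.add hly⟩
  zero_mem' := ⟨0, zero_mem _, by simpa using tendsto_const_nhds⟩
  smul_mem' := by
    rintro z x ⟨x', hx, hlx⟩
    exact ⟨z • x', Submodule.smul_mem _ _ hx, by simpa using hlx.const_smul z⟩

/-- The uniform bound makes the limits along an approximating sequence a Cauchy sequence. The
subspace `M` is `⊤` for the existence of limits, `⊥` for strong continuity, and the multiples of the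
identity for relaxation. -/
theorem isClosed_convergenceSubmodule [CompleteSpace A] {L : ι → A →L[ℂ] A} {l : Filter ι}
    [l.NeBot] {M : Submodule ℂ A} (hM : IsClosed (M : Set A)) {C : ℝ}
    (hC : ∀ i x, ‖L i x‖ ≤ C * ‖x‖) :
    IsClosed (convergenceSubmodule L l M : Set A) := by
  refine isClosed_of_closure_subset fun x hx => ?_
  obtain ⟨u, hu, hux⟩ := mem_closure_iff_seq_limit.1 hx
  choose y hyM hy using hu
  have hd : ∀ j k, ‖y j - y k‖ ≤ C * ‖u j - u k‖ := fun j k => by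
    refine le_of_tendsto ((hy j).sub (hy k)).norm (Eventually.of_forall fun i => ?_)
    rw [← map_sub]
    exact hC i _
  have hcau : CauchySeq y := by
    rw [cauchySeq_iff_tendsto_dist_atTop_0]
    have h1 := (cauchySeq_iff_tendsto_dist_atTop_0.1 hux.cauchySeq).const_mul C
    rw [mul_zero] at h1
    refine squeeze_zero (fun _ => dist_nonneg) (fun p => ?_) h1
    rw [dist_eq_norm, dist_eq_norm]
    exact hd _ _
  obtain ⟨z, hz⟩ := cauchySeq_tendsto_of_complete hcau
  refine ⟨z, hM.mem_of_tendsto hz (Eventually.of_forall hyM), ?_⟩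
  rw [Metric.tendsto_nhds]
  intro ε hε
  have h1 : Tendsto (fun k => C * ‖x - u k‖ + ‖y k - z‖) atTop (𝓝 0) := by
    have h2 := ((tendsto_const_nhds (x := x)).sub hux).norm.const_mul C
    have h3 := (hz.sub_const z).norm
    simpa using h2.add h3
  obtain ⟨k, hk⟩ := ((Metric.tendsto_nhds.1 h1) (ε / 2) (by positivity)).exists
  rw [dist_zero_right, Real.norm_eq_abs] at hk
  have hk' := (le_abs_self _).trans_lt hk
  filter_upwards [(Metric.tendsto_nhds.1 (hy k)) (ε / 2) (by positivity)] with i hi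
  rw [dist_eq_norm] at hi ⊢
  have e : L i x - z = L i (x - u k) + (L i (u k) - y k) + (y k - z) := by
    rw [map_sub]
    abel
  rw [e]
  have := hC i (x - u k)
  calc _ ≤ ‖L i (x - u k)‖ + ‖L i (u k) - y k‖ + ‖y k - z‖ :=
        (norm_add_le _ _).trans (by gcongr; exact norm_add_le _ _)
    _ < ε := by linarith

end ConvergenceSubmodule

/-! ### The limit of infinite volume, by induction on the degree. -/

section Limit

variable {H : Type*} [NormedAddCommGroup H] [InnerProductSpace ℂ H]
variable {A : Type*} [CStarAlgebra A] [PartialOrder A] [StarOrderedRing A]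

/-- The semigroups `T N` are perturbations, by quasi-free dissipators `D N`, of the group of
*-homomorphisms induced by `U`, and the one-particle data of `D N` converge. -/
structure IsDissipativeApproximation (c : CARAlgebra H A) (lam : ℝ) (ρ' : H → H)
    (U : ℝ → H →ₗᵢ[ℂ] H) (P ρ : ℕ → H → H) (D : ℕ → A →L[ℂ] A)
    (T : ℕ → QuantumDynamicalSemigroup A) : Prop where
  isQuasiFree : ∀ N, c.IsQuasiFreeDissipator lam (P N) (ρ N) (D N)
  tendsto_one : ∀ f, Tendsto (fun N => P N f) atTop (𝓝 f)
  tendsto_density : ∀ f, Tendsto (fun N => ρ N f) atTop (𝓝 (ρ' f))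
  continuous : ∀ f, Continuous fun t => U t f
  zero : ∀ f, U 0 f = f
  duhamel : ∀ (N : ℕ) (k : ℝ) (t : ℝ≥0) (x : A), (T N).map t x =
    Real.exp (-k * t) • c.bogoliubov (U t) x + ∫ s in (0 : ℝ)..t, Real.exp (-k * s) •
      (T N).map (Real.toNNReal (t - s)) (D N (c.bogoliubov (U s) x) + k • c.bogoliubov (U s) x)

namespace IsDissipativeApproximation

variable {c : CARAlgebra H A} {lam : ℝ} {ρ' : H → H} {U : ℝ → H →ₗᵢ[ℂ] H} {P ρ : ℕ → H → H}
  {D : ℕ → A →L[ℂ] A} {T : ℕ → QuantumDynamicalSemigroup A}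

/-- The function `z` is the limiting source in Duhamel's formula with damping `nλ`; it is of degree
`n - 2`, which is what the inductions below use. It is measurable in `s` as a pointwise limit of
continuous functions. -/
theorem exists_source (h : IsDissipativeApproximation c lam ρ' U P ρ D T) {n : ℕ} {x : A}
    (hx : x ∈ c.monomialSpan n) :
    ∃ (z : ℝ → A) (C : ℝ), (∀ s, z s ∈ c.contractionSpan n) ∧ (∀ s, ‖z s‖ ≤ C) ∧
      MeasureTheory.StronglyMeasurable z ∧
      (∀ N s, ‖D N (c.bogoliubov (U s) x) + (n * lam : ℝ) • c.bogoliubov (U s) x‖ ≤ C) ∧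
      ∀ s, Tendsto (fun N => D N (c.bogoliubov (U s) x) +
        (n * lam : ℝ) • c.bogoliubov (U s) x) atTop (𝓝 (z s)) := by
  obtain ⟨C, hC⟩ := CARAlgebra.IsQuasiFreeDissipator.exists_bound h.isQuasiFree n x hx
  have hex := fun s => CARAlgebra.IsQuasiFreeDissipator.exists_tendsto h.isQuasiFree h.tendsto_one
    h.tendsto_density n _ (c.bogoliubov_mem_monomialSpan (U s) n x hx)
  choose z hzY hz using hex
  refine ⟨z, C, hzY, fun s => ?_, ?_, fun N s => hC N (U s), hz⟩
  · exact le_of_tendsto (hz s).norm (Eventually.of_forall fun N => hC N (U s))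
  · refine stronglyMeasurable_of_tendsto atTop (f := fun N s => D N (c.bogoliubov (U s) x) +
      (n * lam : ℝ) • c.bogoliubov (U s) x) (fun N => ?_) (tendsto_pi_nhds.2 hz)
    have hc := c.continuous_bogoliubov U h.continuous x
    exact (((D N).continuous.comp hc).add (hc.const_smul _)).stronglyMeasurable

theorem norm_damped_le (S : QuantumDynamicalSemigroup A) (hlam : 0 ≤ lam) (n : ℕ) {s : ℝ}
    (hs : 0 ≤ s) {r : ℝ≥0} {y : A} {C : ℝ} (hy : ‖y‖ ≤ C) :
    ‖Real.exp (-(n * lam) * s) • S.map r y‖ ≤ 4 * C := by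
  rw [norm_smul, Real.norm_eq_abs, Real.abs_exp]
  have h1 : Real.exp (-(n * lam) * s) ≤ 1 := by
    rw [Real.exp_le_one_iff, neg_mul, neg_nonpos]
    positivity
  have h2 := S.norm_map_le r y
  calc _ ≤ 1 * (4 * C) := by
        gcongr
        linarith
    _ = 4 * C := one_mul _

/-- The inductive step: if the semigroups converge on the source, they converge on `x`. The sources
depend on `N` too, but replacing them by their limit costs at most four times their distance from
it; the integrals converge by domination with the constant `4 * C`. -/
theorem tendsto_duhamel (h : IsDissipativeApproximation c lam ρ' U P ρ D T) {n : ℕ} {x : A}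
    {z : ℝ → A} {C : ℝ} (hlam : 0 ≤ lam)
    (hC : ∀ N s, ‖D N (c.bogoliubov (U s) x) + (n * lam : ℝ) • c.bogoliubov (U s) x‖ ≤ C)
    {g : ℝ≥0 → ℝ → A} (t : ℝ≥0)
    (hz : ∀ s, Tendsto (fun N => D N (c.bogoliubov (U s) x) +
        (n * lam : ℝ) • c.bogoliubov (U s) x) atTop (𝓝 (z s)))
    (hg : ∀ r s, Tendsto (fun N => (T N).map r (z s)) atTop (𝓝 (g r s))) :
    Tendsto (fun N => (T N).map t x) atTop (𝓝 (Real.exp (-(n * lam) * t) • c.bogoliubov (U t) x +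
      ∫ s in (0 : ℝ)..t, Real.exp (-(n * lam) * s) • g (Real.toNNReal (t - s)) s)) := by
  simp only [fun N => h.duhamel N (n * lam) t x]
  refine tendsto_const_nhds.add ?_
  refine intervalIntegral.tendsto_integral_filter_of_dominated_convergence (fun _ => 4 * C) ?_ ?_
    (by simp) ?_
  · refine Eventually.of_forall fun N => Continuous.aestronglyMeasurable ?_
    have hc := c.continuous_bogoliubov U h.continuous x
    have he : Continuous fun s : ℝ => Real.exp (-(n * lam) * s) :=
      Real.continuous_exp.comp (continuous_const.mul continuous_id)
    exact he.smul ((T N).continuous_map (by fun_prop)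
      (((D N).continuous.comp hc).add (hc.const_smul _)))
  · refine Eventually.of_forall fun N => Eventually.of_forall fun s hs => ?_
    exact norm_damped_le (T N) hlam n ((Set.uIoc_of_le t.coe_nonneg ▸ hs).1.le) (hC N s)
  · refine Eventually.of_forall fun s _ => Tendsto.const_smul ?_ _
    have h1 := (tendsto_iff_norm_sub_tendsto_zero.1 (hz s)).const_mul 4
    rw [mul_zero] at h1
    have h2 : Tendsto (fun N => (T N).map (Real.toNNReal (t - s))
        (D N (c.bogoliubov (U s) x) + (n * lam : ℝ) • c.bogoliubov (U s) x - z s)) atTop (𝓝 0) :=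
      squeeze_zero_norm (fun N => (T N).norm_map_le _ _) h1
    have h3 := h2.add (hg (Real.toNNReal (t - s)) s)
    simp only [← map_add, sub_add_cancel, zero_add] at h3
    exact h3

/-- Strong induction, because the source drops the degree by two. In degrees 0 and 1 nothing can be
contracted, and the source is zero. -/
theorem exists_tendsto_of_mem (h : IsDissipativeApproximation c lam ρ' U P ρ D T) (hlam : 0 ≤ lam)
    (n : ℕ) : ∀ x ∈ c.monomialSpan n, ∀ t, ∃ y, Tendsto (fun N => (T N).map t x) atTop (𝓝 y) := by
  induction n using Nat.strong_induction_on with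
  | _ n ih =>
    intro x hx t
    obtain ⟨z, C, hzY, -, -, hC, hz⟩ := h.exists_source hx
    have hg : ∀ r s, ∃ y, Tendsto (fun N => (T N).map r (z s)) atTop (𝓝 y) := by
      intro r s
      have := hzY s
      match n, ih, this with
      | 0, _, h0 => exact ⟨0, by simp [(Submodule.mem_bot ℂ).1 h0]⟩
      | 1, _, h0 => exact ⟨0, by simp [(Submodule.mem_bot ℂ).1 h0]⟩
      | m + 2, ih, h0 => exact ih m (by omega) _ h0 r
    choose g hg using hg
    exact ⟨_, h.tendsto_duhamel hlam hC t hz hg⟩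

theorem exists_tendsto (h : IsDissipativeApproximation c lam ρ' U P ρ D T) (hlam : 0 ≤ lam)
    (t : ℝ≥0) (x : A) : ∃ y, Tendsto (fun N => (T N).map t x) atTop (𝓝 y) := by
  have := c.mem_of_monomialSpan_le (convergenceSubmodule (fun N => (T N).clm t) atTop ⊤)
    (isClosed_convergenceSubmodule isClosed_univ fun N x => (T N).norm_map_le t x)
    (fun n x hx => by
      obtain ⟨y, hy⟩ := h.exists_tendsto_of_mem hlam n x hx t
      exact ⟨y, trivial, hy⟩) x
  obtain ⟨y, -, hy⟩ := this
  exact ⟨y, hy⟩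

/-- Pointwise limits of semigroups need not be strongly continuous. Here Duhamel's formula bounds
the distance from `e^{-nλt} α_t x` by `4 * C * t` uniformly in `N`, and this bound survives the
limit. -/
theorem tendsto_zero_of_tendsto (h : IsDissipativeApproximation c lam ρ' U P ρ D T)
    (hlam : 0 ≤ lam) {L : ℝ≥0 → A →L[ℂ] A}
    (hL : ∀ t x, Tendsto (fun N => (T N).map t x) atTop (𝓝 (L t x))) (x : A) :
    Tendsto (fun t => L t x) (𝓝[>] 0) (𝓝 x) := by
  have hb : ∀ t x, ‖L t x‖ ≤ 4 * ‖x‖ := fun t x =>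
    le_of_tendsto (hL t x).norm (Eventually.of_forall fun N => (T N).norm_map_le t x)
  have hmem := c.mem_of_monomialSpan_le (convergenceSubmodule (fun t => L t - 1) (𝓝[>] (0 : ℝ≥0)) ⊥)
    -- The bound `5` is `4` for `L t` plus `1` for the identity.
    (isClosed_convergenceSubmodule (C := 5) (by simp) (fun t x => by
        refine (norm_sub_le _ _).trans ?_
        have := hb t x
        show ‖L t x‖ + ‖x‖ ≤ _
        linarith))
    (fun n x hx => by
      refine ⟨0, zero_mem _, ?_⟩
      obtain ⟨C, hC⟩ := CARAlgebra.IsQuasiFreeDissipator.exists_bound h.isQuasiFree n x hx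
      have h1 : ∀ t : ℝ≥0, ‖L t x - Real.exp (-(n * lam) * t) • c.bogoliubov (U t) x‖ ≤
          (4 * C) * t := fun t => by
        refine le_of_tendsto ((hL t x).sub_const _).norm (Eventually.of_forall fun N => ?_)
        rw [h.duhamel N (n * lam) t x, add_sub_cancel_left]
        have := intervalIntegral.norm_integral_le_of_norm_le_const (a := 0) (b := t) (C := 4 * C)
          (f := fun s => Real.exp (-(n * lam) * s) • (T N).map (Real.toNNReal (t - s))
            (D N (c.bogoliubov (U s) x) + (n * lam : ℝ) • c.bogoliubov (U s) x)) (fun s hs => by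
            exact norm_damped_le (T N) hlam n ((Set.uIoc_of_le t.coe_nonneg ▸ hs).1.le)
              (hC N (U s)))
        simpa using this
      have h2 : Tendsto (fun t : ℝ≥0 => L t x - Real.exp (-(n * lam) * t) • c.bogoliubov (U t) x)
          (𝓝[>] 0) (𝓝 0) := by
        refine squeeze_zero_norm h1 ?_
        have : Continuous fun t : ℝ≥0 => (4 * C) * (t : ℝ) := by fun_prop
        simpa using (this.tendsto 0).mono_left (nhdsWithin_le_nhds (s := Set.Ioi 0))
      have h3 : Tendsto (fun t : ℝ≥0 => Real.exp (-(n * lam) * t) • c.bogoliubov (U t) x)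
          (𝓝[>] 0) (𝓝 x) := by
        have he : Continuous fun t : ℝ≥0 => Real.exp (-(n * lam) * t) :=
          Real.continuous_exp.comp (continuous_const.mul NNReal.continuous_coe)
        have hc : Continuous fun t : ℝ≥0 => Real.exp (-(n * lam) * t) • c.bogoliubov (U t) x :=
          he.smul ((c.continuous_bogoliubov U h.continuous x).comp NNReal.continuous_coe)
        have h0 : c.bogoliubov (U 0) x = x :=
          c.hom_ext (φ := c.bogoliubov (U 0)) (ψ := StarAlgHom.id ℂ A)
            (fun f => by simp [h.zero]) x
        have := (hc.tendsto 0).mono_left (nhdsWithin_le_nhds (s := Set.Ioi 0))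
        simpa [h0] using this
      have h4 := (h2.add h3).sub_const x
      simpa using h4) x
  obtain ⟨y, hy, hl⟩ := hmem
  rw [(Submodule.mem_bot ℂ).1 hy] at hl
  have := hl.add_const x
  simpa using this

/-- The limit of the semigroups. -/
theorem exists_limit (h : IsDissipativeApproximation c lam ρ' U P ρ D T) (hlam : 0 ≤ lam) :
    ∃ S : QuantumDynamicalSemigroup A,
      ∀ t x, Tendsto (fun N => (T N).map t x) atTop (𝓝 (S.map t x)) := by
  choose F hF using h.exists_tendsto hlam
  have hb : ∀ t x, ‖F t x‖ ≤ 4 * ‖x‖ := fun t x =>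
    le_of_tendsto (hF t x).norm (Eventually.of_forall fun N => (T N).norm_map_le t x)
  let L : ℝ≥0 → A →L[ℂ] A := fun t => LinearMap.mkContinuous
    { toFun := F t
      map_add' := fun x y => tendsto_nhds_unique (hF t (x + y)) (by
        simpa using (hF t x).add (hF t y))
      map_smul' := fun z x => tendsto_nhds_unique (hF t (z • x)) (by
        simpa using (hF t x).const_smul z) } 4 (hb t)
  have hL : ∀ t x, L t x = F t x := fun _ _ => rfl
  have hCP : ∀ t, IsCP (L t) := fun t k M hM => by
    have h1 : Tendsto (fun N => M.map (T N |>.map t)) atTop (𝓝 (M.map (L t))) := by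
      refine tendsto_pi_nhds.2 fun i => tendsto_pi_nhds.2 fun j => ?_
      exact hF t (M i j)
    exact ge_of_tendsto' h1 fun N => ((T N).map t).map_cstarMatrix_nonneg M hM
  refine ⟨{ map := fun t => ⟨(L t : A →ₗ[ℂ] A), hCP t⟩
            map_one := fun t => ?_
            map_zero := fun x => ?_
            map_add := fun t s x => ?_
            tendsto_zero := fun x => ?_ }, fun t x => hF t x⟩
  · refine tendsto_nhds_unique (hF t 1) ?_
    simp only [(T _).map_one]
    exact tendsto_const_nhds
  · refine tendsto_nhds_unique (hF 0 x) ?_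
    simp only [(T _).map_zero]
    exact tendsto_const_nhds
  · refine tendsto_nhds_unique (hF (t + s) x) ?_
    have h1 := (tendsto_iff_norm_sub_tendsto_zero.1 (hF s x)).const_mul 4
    rw [mul_zero] at h1
    have h2 : Tendsto (fun N => (T N).map t ((T N).map s x - F s x)) atTop (𝓝 0) :=
      squeeze_zero_norm (fun N => (T N).norm_map_le _ _) h1
    have h3 := h2.add (hF t (F s x))
    simp only [← map_add, sub_add_cancel, zero_add] at h3
    refine h3.congr fun N => ?_
    exact ((T N).map_add t s x).symm
  · rw [← tendsto_iff_norm_sub_tendsto_zero]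
    exact h.tendsto_zero_of_tendsto hlam (L := L) hF x

end IsDissipativeApproximation

end Limit

/-! ### Relaxation to multiples of the identity and the steady state. -/

section SteadyState

variable {H : Type*} [NormedAddCommGroup H] [InnerProductSpace ℂ H]
variable {A : Type*} [CStarAlgebra A] [PartialOrder A] [StarOrderedRing A]

namespace IsDissipativeApproximation

variable {c : CARAlgebra H A} {lam : ℝ} {ρ' : H → H} {U : ℝ → H →ₗᵢ[ℂ] H} {P ρ : ℕ → H → H}
  {D : ℕ → A →L[ℂ] A} {T : ℕ → QuantumDynamicalSemigroup A} {S : QuantumDynamicalSemigroup A}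

/-- For `n ≠ 0` the free term in Duhamel's formula dies like `e^{-nλt}`. For fixed `s` the source at
`s` has the time `t - s` to relax to `ζ s`, and `4 * C * e^{-nλs}` is an integrable bound. -/
theorem tendsto_atTop_of_source (h : IsDissipativeApproximation c lam ρ' U P ρ D T)
    (hlam : 0 < lam) (hS : ∀ t x, Tendsto (fun N => (T N).map t x) atTop (𝓝 (S.map t x)))
    {n : ℕ} (hn : n ≠ 0) {x : A} {z : ℝ → A} {C : ℝ} (hzC : ∀ s, ‖z s‖ ≤ C)
    (hzm : MeasureTheory.StronglyMeasurable z)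
    (hC : ∀ N s, ‖D N (c.bogoliubov (U s) x) + (n * lam : ℝ) • c.bogoliubov (U s) x‖ ≤ C)
    (hz : ∀ s, Tendsto (fun N => D N (c.bogoliubov (U s) x) +
        (n * lam : ℝ) • c.bogoliubov (U s) x) atTop (𝓝 (z s))) {ζ : ℝ → ℂ}
    (hζ : ∀ s, Tendsto (fun r => S.map r (z s)) atTop (𝓝 (ζ s • (1 : A)))) :
    Tendsto (fun t => S.map t x) atTop
      (𝓝 ((∫ s in Set.Ioi (0 : ℝ), Real.exp (-(n * lam) * s) • ζ s) • (1 : A))) := by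
  have hpos : 0 < n * lam := mul_pos (by exact_mod_cast Nat.pos_of_ne_zero hn) hlam
  -- The indicator turns the integral up to `t` into one over a fixed half-line, so that dominated
  -- convergence applies as `t` grows.
  have hform : ∀ t : ℝ≥0, S.map t x = Real.exp (-(n * lam) * t) • c.bogoliubov (U t) x +
      ∫ s in Set.Ioi (0 : ℝ), (Set.Iic (t : ℝ)).indicator (fun s => Real.exp (-(n * lam) * s) •
        S.map (Real.toNNReal (t - s)) (z s)) s := fun t => by
    rw [MeasureTheory.setIntegral_indicator measurableSet_Iic, Set.Ioi_inter_Iic,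
      ← intervalIntegral.integral_of_le t.coe_nonneg]
    exact tendsto_nhds_unique (hS t x)
      (h.tendsto_duhamel hlam.le hC t hz fun r s => hS r (z s))
  have hexp : Continuous fun s : ℝ => Real.exp (-(n * lam) * s) :=
    Real.continuous_exp.comp (continuous_const.mul continuous_id)
  have h1 : Tendsto (fun t : ℝ≥0 => Real.exp (-(n * lam) * t) • c.bogoliubov (U t) x) atTop
      (𝓝 0) := by
    have h2 : Tendsto (fun t : ℝ≥0 => Real.exp (-(n * lam) * t) * ‖x‖) atTop (𝓝 0) := by
      have h3 : Tendsto (fun t : ℝ≥0 => -(n * lam) * (t : ℝ)) atTop atBot :=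
        (NNReal.tendsto_coe_atTop.2 tendsto_id).const_mul_atTop_of_neg (neg_lt_zero.2 hpos)
      have := (Real.tendsto_exp_atBot.comp h3).mul_const ‖x‖
      simpa [Function.comp_def] using this
    refine squeeze_zero_norm (fun t => ?_) h2
    rw [norm_smul, Real.norm_eq_abs, Real.abs_exp]
    gcongr
    exact NonUnitalStarAlgHom.norm_apply_le _ x
  have h2 : Tendsto (fun t : ℝ≥0 => ∫ s in Set.Ioi (0 : ℝ), (Set.Iic (t : ℝ)).indicator
      (fun s => Real.exp (-(n * lam) * s) • S.map (Real.toNNReal (t - s)) (z s)) s) atTop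
      (𝓝 (∫ s in Set.Ioi (0 : ℝ), (Real.exp (-(n * lam) * s) • ζ s) • (1 : A))) := by
    refine MeasureTheory.tendsto_integral_filter_of_dominated_convergence
      (fun s => Real.exp (-(n * lam) * s) * (4 * C)) ?_ ?_ ?_ ?_
    · refine Eventually.of_forall fun t => MeasureTheory.StronglyMeasurable.aestronglyMeasurable ?_
      refine MeasureTheory.StronglyMeasurable.indicator ?_ measurableSet_Iic
      refine hexp.stronglyMeasurable.smul ?_
      have hc : Continuous fun p : ℝ × A => S.map (Real.toNNReal (t - p.1)) p.2 :=
        S.continuous_map (by fun_prop) continuous_snd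
      exact hc.comp_stronglyMeasurable (stronglyMeasurable_id.prodMk hzm)
    · refine Eventually.of_forall fun t => Eventually.of_forall fun s => ?_
      refine (norm_indicator_le_norm_self _ _).trans ?_
      rw [norm_smul, Real.norm_eq_abs, Real.abs_exp]
      gcongr
      exact (S.norm_map_le _ _).trans (by linarith [hzC s])
    · exact (exp_neg_integrableOn_Ioi 0 hpos).mul_const _
    · refine Eventually.of_forall fun s => ?_
      have h3 : Tendsto (fun t : ℝ≥0 => Real.toNNReal (t - s)) atTop atTop := by
        refine tendsto_real_toNNReal_atTop.comp ?_
        exact tendsto_atTop_add_const_right _ _ (NNReal.tendsto_coe_atTop.2 tendsto_id)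
      have h4 := ((hζ s).comp h3).const_smul (Real.exp (-(n * lam) * s))
      rw [smul_assoc]
      refine h4.congr' ?_
      filter_upwards [eventually_ge_atTop (Real.toNNReal s)] with t ht
      rw [Set.indicator_of_mem]
      · rfl
      · exact Real.toNNReal_le_iff_le_coe.1 ht
  rw [integral_smul_const] at h2
  have h3 := h1.add h2
  rw [zero_add] at h3
  exact h3.congr fun t => (hform t).symm

theorem exists_tendsto_atTop_of_mem (h : IsDissipativeApproximation c lam ρ' U P ρ D T)
    (hlam : 0 < lam) (hS : ∀ t x, Tendsto (fun N => (T N).map t x) atTop (𝓝 (S.map t x)))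
    (n : ℕ) : ∀ x ∈ c.monomialSpan n, ∃ z : ℂ,
      Tendsto (fun t => S.map t x) atTop (𝓝 (z • (1 : A))) := by
  induction n using Nat.strong_induction_on with
  | _ n ih =>
    intro x hx
    -- Degree zero has no damping and is treated separately: scalars are fixed by unital maps.
    rcases eq_or_ne n 0 with rfl | hn
    · obtain ⟨z, rfl⟩ := Submodule.mem_span_singleton.1 hx
      refine ⟨z, ?_⟩
      simp only [map_smul, S.map_one]
      exact tendsto_const_nhds
    obtain ⟨z, C, hzY, hzC, hzm, hC, hz⟩ := h.exists_source hx
    have hζ : ∀ s, ∃ ζ : ℂ, Tendsto (fun r => S.map r (z s)) atTop (𝓝 (ζ • (1 : A))) := by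
      intro s
      have := hzY s
      match n, ih, this with
      | 0, _, h0 => exact ⟨0, by simp [(Submodule.mem_bot ℂ).1 h0]⟩
      | 1, _, h0 => exact ⟨0, by simp [(Submodule.mem_bot ℂ).1 h0]⟩
      | m + 2, ih, h0 => exact ih m (by omega) _ h0
    choose ζ hζ using hζ
    exact ⟨_, h.tendsto_atTop_of_source hlam hS hn hzC hzm hC hz hζ⟩

theorem exists_tendsto_atTop (h : IsDissipativeApproximation c lam ρ' U P ρ D T)
    (hlam : 0 < lam) (hS : ∀ t x, Tendsto (fun N => (T N).map t x) atTop (𝓝 (S.map t x)))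
    (x : A) : ∃ z : ℂ, Tendsto (fun t => S.map t x) atTop (𝓝 (z • (1 : A))) := by
  have := c.mem_of_monomialSpan_le (convergenceSubmodule S.clm atTop (Submodule.span ℂ {1}))
    (isClosed_convergenceSubmodule (Submodule.closed_of_finiteDimensional _) S.norm_map_le)
    (fun n x hx => by
      obtain ⟨z, hz⟩ := h.exists_tendsto_atTop_of_mem hlam hS n x hx
      exact ⟨z • 1, Submodule.mem_span_singleton.2 ⟨z, rfl⟩, hz⟩) x
  obtain ⟨y, hy, hl⟩ := this
  obtain ⟨z, rfl⟩ := Submodule.mem_span_singleton.1 hy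
  exact ⟨z, hl⟩

/-- The steady-state value of `a*(f) a(g)`. -/
theorem tendsto_atTop_cre_mul_ann (h : IsDissipativeApproximation c lam ρ' U P ρ D T)
    (hlam : 0 < lam) (hS : ∀ t x, Tendsto (fun N => (T N).map t x) atTop (𝓝 (S.map t x)))
    (hρ' : Continuous ρ') (f g : H) :
    Tendsto (fun t => S.map t (c.cre f * c.ann g)) atTop
      (𝓝 ((∫ s in Set.Ioi (0 : ℝ), Real.exp (-(2 * lam) * s) •
        (2 * lam * inner ℂ (U s g) (ρ' (U s f)) : ℂ)) • (1 : A))) := by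
  have hmem : c.cre f * c.ann g ∈ c.monomialSpan 2 := by
    refine c.mul_mem_monomialSpan (CARAlgebra.IsField.cre c f) ?_
    rw [← mul_one (c.ann g)]
    exact c.mul_mem_monomialSpan (CARAlgebra.IsField.ann c g) (Submodule.mem_span_singleton_self 1)
  obtain ⟨C, hC⟩ := CARAlgebra.IsQuasiFreeDissipator.exists_bound h.isQuasiFree 2 _ hmem
  have hz : ∀ s, Tendsto (fun N => D N (c.bogoliubov (U s) (c.cre f * c.ann g)) +
      ((2 : ℕ) * lam : ℝ) • c.bogoliubov (U s) (c.cre f * c.ann g)) atTop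
      (𝓝 ((2 * lam * inner ℂ (U s g) (ρ' (U s f)) : ℂ) • (1 : A))) := fun s => by
    rw [map_mul, c.bogoliubov_cre, c.bogoliubov_ann]
    exact CARAlgebra.IsQuasiFreeDissipator.tendsto_cre_mul_ann h.isQuasiFree h.tendsto_one
      h.tendsto_density _ _
  -- The source in degree two is a multiple of the identity, which `S` fixes; hence `ζ` is this
  -- scalar itself and no further recursion is needed.
  have hcont : Continuous fun s : ℝ => (2 * lam * inner ℂ (U s g) (ρ' (U s f)) : ℂ) • (1 : A) := by
    refine Continuous.smul (continuous_const.mul ?_) continuous_const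
    exact (h.continuous g).inner (hρ'.comp (h.continuous f))
  have := h.tendsto_atTop_of_source hlam hS (n := 2) two_ne_zero
    (fun s => le_of_tendsto (hz s).norm (Eventually.of_forall fun N => hC N (U s)))
    hcont.stronglyMeasurable (fun N s => hC N (U s)) hz
    (ζ := fun s => 2 * lam * inner ℂ (U s g) (ρ' (U s f)))
    (fun s => by
      simp only [map_smul, S.map_one]
      exact tendsto_const_nhds)
  exact_mod_cast this

end IsDissipativeApproximation

/-- In a nontrivial algebra `z` is the spectrum of `z • 1`. -/
theorem nonneg_of_smul_one_nonneg [Nontrivial A] {z : ℂ} (hz : 0 ≤ z • (1 : A)) : 0 ≤ z := by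
  have hz' : 0 ≤ algebraMap ℂ A z := by rwa [Algebra.algebraMap_eq_smul_one]
  have := spectrum_nonneg_of_nonneg hz' (x := z) (by simp [spectrum.scalar_eq])
  exact this

/-- A semigroup which relaxes to multiples of the identity has a unique steady state. -/
theorem exists_state_of_tendsto [Nontrivial A] {S : QuantumDynamicalSemigroup A}
    (h : ∀ x, ∃ z : ℂ, Tendsto (fun t => S.map t x) atTop (𝓝 (z • (1 : A)))) :
    ∃ ω : State A, ∀ x, Tendsto (fun t => S.map t x) atTop (𝓝 (ω x • (1 : A))) := by
  choose ω hω using h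
  -- The algebra is nontrivial, so a multiple of the identity determines its coefficient; linearity
  -- and normalization of `ω` follow from uniqueness of limits.
  have huniq : ∀ {x : A} {z : ℂ}, Tendsto (fun t => S.map t x) atTop (𝓝 (z • (1 : A))) →
      ω x = z := fun {x z} hz => smul_left_injective ℂ (one_ne_zero (α := A))
        (tendsto_nhds_unique (hω x) hz)
  let φ : A →ₗ[ℂ] ℂ :=
    { toFun := ω
      map_add' := fun x y => huniq (by simpa [add_smul] using (hω x).add (hω y))
      map_smul' := fun z x => huniq (by simpa [mul_smul] using (hω x).const_smul z) }
  refine ⟨⟨PositiveLinearMap.mk₀ φ fun x hx => ?_, ?_⟩, hω⟩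
  · refine nonneg_of_smul_one_nonneg (A := A) (ge_of_tendsto' (hω x) fun t => ?_)
    have := OrderHomClass.mono (S.map t) hx
    simpa using this
  · refine huniq ?_
    simp only [S.map_one, one_smul]
    exact tendsto_const_nhds

theorem State.continuous (ψ : State A) : Continuous ψ := by
  obtain ⟨C, hC⟩ := ψ.1.exists_norm_apply_le
  exact (LinearMap.mkContinuous ψ.1.toLinearMap C hC).continuous

/-- The steady state does not depend on the initial one, because every state takes the value 1 at
the identity. -/
theorem State.tendsto_of_tendsto_smul_one (ψ : State A) {ι : Type*} {l : Filter ι} {u : ι → A}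
    {z : ℂ} (h : Tendsto u l (𝓝 (z • (1 : A)))) : Tendsto (fun i => ψ (u i)) l (𝓝 z) := by
  have h1 := (ψ.continuous.tendsto _).comp h
  have h2 : ψ (z • (1 : A)) = z := by
    have := map_smul ψ.1 z (1 : A)
    rw [ψ.2, smul_eq_mul, mul_one] at this
    exact this
  rwa [h2] at h1

end SteadyState

/-! ### Polynomial approximation of functions of an operator. -/

section FunctionalCalculus

variable {H : Type*} [NormedAddCommGroup H] [InnerProductSpace ℂ H] [CompleteSpace H]

theorem norm_functionOf_sub_aeval_le {T : H →L[ℂ] H} (hT : IsSelfAdjoint T) {F : ℝ → ℝ}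
    (hF : Continuous F) (p : Polynomial ℝ) {η : ℝ} (hη : 0 ≤ η)
    (h : ∀ x, |x| ≤ ‖T‖ → |F x - p.eval x| ≤ η) :
    ‖functionOf F T - Polynomial.aeval T p‖ ≤ η := by
  rw [functionOf, ← cfc_polynomial p T hT, ← cfc_sub (a := T) F (fun x => p.eval x)]
  refine norm_cfc_le hη fun x hx => h x ?_
  refine (spectrum.norm_le_norm_mul_of_mem hx).trans ?_
  -- The spectral bound carries a factor `‖1‖`, which is at most 1 even on the zero space.
  calc _ ≤ ‖T‖ * 1 := by
        gcongr
        exact ContinuousLinearMap.norm_id_le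
    _ = ‖T‖ := mul_one _

end FunctionalCalculus

/-! ### Strong convergence of functions of the box Hamiltonians. -/

section OneParticleLimit

variable {d : ℕ}

theorem lp_ext {f g : OneParticle d} (h : ∀ x, f x = g x) : f = g :=
  lp.ext (funext h)

theorem boxProj_apply (N : ℕ) (f : OneParticle d) (x : Lattice d) :
    boxProj d N f x = if x ∈ box d N then f x else 0 := by
  classical
  rw [boxProj, weightedShift_apply]
  split_ifs <;> simp

theorem boxProj_of_supported {N : ℕ} {f : OneParticle d} (h : ∀ x ∉ box d N, f x = 0) :
    boxProj d N f = f := by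
  refine lp_ext fun x => ?_
  rw [boxProj_apply]
  split_ifs with hx
  · rfl
  · exact (h x hx).symm

theorem norm_boxProj_apply_le (N : ℕ) (f : OneParticle d) : ‖boxProj d N f‖ ≤ ‖f‖ := by
  refine abs_le_of_sq_le_sq' ?_ (norm_nonneg _) |>.2
  rw [norm_sq_eq_tsum, norm_sq_eq_tsum]
  refine Summable.tsum_le_tsum (fun x => ?_) (summable_norm_sq _) (summable_norm_sq _)
  rw [boxProj_apply]
  split_ifs
  · exact le_rfl
  · simp

theorem inner_boxProj (N : ℕ) (f g : OneParticle d) :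
    inner ℂ (boxProj d N f) g = (inner ℂ f (boxProj d N g) : ℂ) := by
  rw [inner_eq, inner_eq]
  refine tsum_congr fun x => ?_
  rw [boxProj_apply, boxProj_apply]
  split_ifs <;> simp

theorem eventually_mem_box (x : Lattice d) : ∀ᶠ N in atTop, x ∈ box d N := by
  have h : ∀ i, ∀ᶠ N : ℕ in atTop, |x i| ≤ (N : ℤ) := fun i => by
    filter_upwards [eventually_ge_atTop (x i).natAbs] with N hN
    rw [Int.abs_eq_natAbs]
    exact_mod_cast hN
  filter_upwards [eventually_all.2 h] with N hN
  rw [box, Finset.mem_Icc]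
  exact ⟨fun i => (abs_le.1 (hN i)).1, fun i => (abs_le.1 (hN i)).2⟩

theorem tendsto_boxProj (f : OneParticle d) :
    Tendsto (fun N => boxProj d N f) atTop (𝓝 f) := by
  have h : Tendsto (fun N => ‖boxProj d N f - f‖ ^ 2) atTop (𝓝 0) := by
    simp only [norm_sq_eq_tsum]
    have h0 : (0 : ℝ) = ∑' _ : Lattice d, (0 : ℝ) := by simp
    rw [h0]
    have he : ∀ N x, (boxProj d N f - f : OneParticle d) x = if x ∈ box d N then 0 else -f x := by
      intro N x
      show boxProj d N f x - f x = _
      rw [boxProj_apply]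
      split_ifs <;> simp
    refine tendsto_tsum_of_dominated_convergence (summable_norm_sq f) (fun x => ?_)
      (Eventually.of_forall fun N x => ?_)
    · refine tendsto_const_nhds.congr' ?_
      filter_upwards [eventually_mem_box x] with N hN
      simp [he, hN]
    · rw [he]
      split_ifs <;> simp
  rw [tendsto_iff_norm_sub_tendsto_zero]
  have := (Real.continuous_sqrt.tendsto 0).comp h
  simpa [Function.comp_def, Real.sqrt_sq] using this

theorem basisVec_apply (x y : Lattice d) : basisVec x y = if y = x then 1 else 0 := by
  rw [basisVec, lp.single_apply]
  split_ifs with h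
  · subst h
    exact Pi.single_eq_same _ _
  · simp [h]

theorem boxProj_eq_sum (N : ℕ) (f : OneParticle d) :
    boxProj d N f = ∑ x ∈ box d N, f x • basisVec x := by
  refine lp_ext fun y => ?_
  rw [boxProj_apply, sum_coe_apply]
  have : ∀ x, (f x • basisVec x : OneParticle d) y = if y = x then f x else 0 := fun x => by
    show f x * basisVec x y = _
    rw [basisVec_apply]
    split_ifs <;> simp
  simp only [this]
  rw [Finset.sum_ite_eq]

variable {V : Lattice d → ℝ} {hV : ∃ C, ∀ x, |V x| ≤ C}

theorem norm_boxHamiltonian_apply_le (N : ℕ) (f : OneParticle d) :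
    ‖boxHamiltonian V hV N f‖ ≤ ‖hamiltonian V hV‖ * ‖f‖ := by
  show ‖boxProj d N (hamiltonian V hV (boxProj d N f))‖ ≤ _
  refine (norm_boxProj_apply_le _ _).trans (((hamiltonian V hV).le_opNorm _).trans ?_)
  gcongr
  exact norm_boxProj_apply_le _ _

/-- The projections are contractions and tend strongly to the identity. The argument varies with `N`
so that the statement can be iterated to powers of `h_N`. -/
theorem tendsto_boxHamiltonian {g : ℕ → OneParticle d} {f : OneParticle d}
    (hg : Tendsto g atTop (𝓝 f)) :
    Tendsto (fun N => boxHamiltonian V hV N (g N)) atTop (𝓝 (hamiltonian V hV f)) := by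
  have hP : ∀ {u : ℕ → OneParticle d} {v : OneParticle d}, Tendsto u atTop (𝓝 v) →
      Tendsto (fun N => boxProj d N (u N)) atTop (𝓝 v) := fun {u v} hu => by
    have h1 : Tendsto (fun N => boxProj d N (u N - v)) atTop (𝓝 0) :=
      squeeze_zero_norm (fun N => norm_boxProj_apply_le _ _)
        (tendsto_iff_norm_sub_tendsto_zero.1 hu)
    have := h1.add (tendsto_boxProj v)
    simpa using this
  exact hP (((hamiltonian V hV).continuous.tendsto _).comp (hP hg))

namespace BoxEigenbasis

variable {N : ℕ} (φ : BoxEigenbasis V hV N)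

/-- The function `F(h_N)` of the Hamiltonian of the box, extended by zero. -/
noncomputable def apply (F : ℝ → ℝ) (f : OneParticle d) : OneParticle d :=
  ∑ n, ((F (φ.energy n) : ℂ) * inner ℂ (φ.vec n) f) • φ.vec n

/-- Completeness of the eigenvectors: they are independent, supported in the box, and as many as its
points, so a dimension count shows that they span the functions on the box. -/
theorem apply_one (f : OneParticle d) : φ.apply (fun _ => 1) f = boxProj d N f := by
  classical
  have hsup : ∀ n, boxProj d N (φ.vec n) = φ.vec n := fun n =>
    boxProj_of_supported (φ.supported n)
  have hle : Submodule.span ℂ (Set.range φ.vec) ≤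
      Submodule.span ℂ (((box d N).image basisVec : Finset (OneParticle d)) :
        Set (OneParticle d)) := by
    refine Submodule.span_le.2 ?_
    rintro _ ⟨n, rfl⟩
    rw [← hsup n, boxProj_eq_sum]
    refine Submodule.sum_mem _ fun x hx => Submodule.smul_mem _ _ (Submodule.subset_span ?_)
    exact Finset.mem_coe.2 (Finset.mem_image_of_mem _ hx)
  have heq := Submodule.eq_of_le_of_finrank_le hle (by
    rw [finrank_span_eq_card φ.orthonormal.linearIndependent, Fintype.card_fin]
    exact (finrank_span_finset_le_card _).trans Finset.card_image_le)
  have hmem : boxProj d N f ∈ Submodule.span ℂ (Set.range φ.vec) := by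
    rw [heq, boxProj_eq_sum]
    refine Submodule.sum_mem _ fun x hx => Submodule.smul_mem _ _ (Submodule.subset_span ?_)
    exact Finset.mem_coe.2 (Finset.mem_image_of_mem _ hx)
  have hexp : ∀ g ∈ Submodule.span ℂ (Set.range φ.vec),
      ∑ n, (inner ℂ (φ.vec n) g : ℂ) • φ.vec n = g := by
    intro g hg
    induction hg using Submodule.span_induction with
    | mem g hg =>
      obtain ⟨m, rfl⟩ := hg
      simp [orthonormal_iff_ite.1 φ.orthonormal]
    | zero => simp
    | add g g' _ _ hg hg' =>
      simp only [inner_add_right, add_smul, Finset.sum_add_distrib, hg, hg']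
    | smul z g _ hg =>
      simp only [inner_smul_right, mul_smul, ← Finset.smul_sum, hg]
  rw [apply, ← hexp _ hmem]
  refine Finset.sum_congr rfl fun n _ => ?_
  rw [← inner_boxProj, hsup]
  simp

/-- Compression does not increase the norm. All energies of all boxes lie in one compact interval,
on which a single polynomial approximation serves every `N`. -/
theorem abs_energy_le (n : Fin (box d N).card) : |φ.energy n| ≤ ‖hamiltonian V hV‖ := by
  have h := norm_boxHamiltonian_apply_le (V := V) (hV := hV) N (φ.vec n)
  rw [φ.eigen, norm_smul, φ.orthonormal.1 n, Complex.norm_real, mul_one, mul_one] at h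
  exact h

theorem apply_mul (F : ℝ → ℝ) (f : OneParticle d) :
    φ.apply (fun x => x * F x) f = boxHamiltonian V hV N (φ.apply F f) := by
  rw [apply, apply, map_sum]
  refine Finset.sum_congr rfl fun n _ => ?_
  rw [map_smul, φ.eigen, smul_smul]
  congr 1
  push_cast
  ring

theorem apply_add (F G : ℝ → ℝ) (f : OneParticle d) :
    φ.apply (fun x => F x + G x) f = φ.apply F f + φ.apply G f := by
  rw [apply, apply, apply, ← Finset.sum_add_distrib]
  refine Finset.sum_congr rfl fun n _ => ?_
  rw [← add_smul]
  congr 1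
  push_cast
  ring

theorem apply_const_mul (r : ℝ) (F : ℝ → ℝ) (f : OneParticle d) :
    φ.apply (fun x => r * F x) f = r • φ.apply F f := by
  rw [apply, apply, Finset.smul_sum]
  refine Finset.sum_congr rfl fun n _ => ?_
  rw [← smul_assoc, Complex.real_smul]
  congr 1
  push_cast
  ring

theorem apply_sub (F G : ℝ → ℝ) (f : OneParticle d) :
    φ.apply (fun x => F x - G x) f = φ.apply F f - φ.apply G f := by
  have := φ.apply_add (fun x => F x - G x) G f
  simp only [sub_add_cancel] at this
  rw [this, add_sub_cancel_right]

/-- Orthonormality gives the norm of the sum, and Bessel's inequality bounds the coefficients. -/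
theorem norm_apply_le {F : ℝ → ℝ} {C : ℝ} (hC : 0 ≤ C)
    (hF : ∀ x, |x| ≤ ‖hamiltonian V hV‖ → |F x| ≤ C) (f : OneParticle d) :
    ‖φ.apply F f‖ ≤ C * ‖f‖ := by
  refine abs_le_of_sq_le_sq' ?_ (by positivity) |>.2
  have h1 : ‖φ.apply F f‖ ^ 2 =
      ∑ n, ‖((F (φ.energy n) : ℂ) * inner ℂ (φ.vec n) f)‖ ^ 2 := by
    have h2 : (inner ℂ (φ.apply F f) (φ.apply F f) : ℂ) = (‖φ.apply F f‖ : ℂ) ^ 2 :=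
      inner_self_eq_norm_sq_to_K _
    have h3 := φ.orthonormal.inner_sum
      (fun n => (F (φ.energy n) : ℂ) * inner ℂ (φ.vec n) f)
      (fun n => (F (φ.energy n) : ℂ) * inner ℂ (φ.vec n) f) Finset.univ
    have h4 : (‖φ.apply F f‖ : ℂ) ^ 2 = _ := h2.symm.trans h3
    simp only [Complex.conj_mul'] at h4
    exact_mod_cast h4
  rw [h1, mul_pow]
  calc _ ≤ ∑ n, C ^ 2 * ‖(inner ℂ (φ.vec n) f : ℂ)‖ ^ 2 := by
        refine Finset.sum_le_sum fun n _ => ?_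
        rw [norm_mul, mul_pow, Complex.norm_real, Real.norm_eq_abs]
        gcongr
        exact hF _ (φ.abs_energy_le n)
    _ = C ^ 2 * ∑ n, ‖(inner ℂ (φ.vec n) f : ℂ)‖ ^ 2 := by rw [Finset.mul_sum]
    _ ≤ _ := by
        gcongr
        exact φ.orthonormal.sum_inner_products_le f

end BoxEigenbasis

theorem isSelfAdjoint_hamiltonian : IsSelfAdjoint (hamiltonian V hV) := star_hamiltonian V hV

/-- Powers are obtained by iterating `tendsto_boxHamiltonian`. The zeroth power in the box is the
projection, whose strong limit is the identity. -/
theorem tendsto_apply_polynomial (φ : ∀ N, BoxEigenbasis V hV N) (p : Polynomial ℝ)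
    (f : OneParticle d) :
    Tendsto (fun N => (φ N).apply (fun x => p.eval x) f) atTop
      (𝓝 (Polynomial.aeval (hamiltonian V hV) p f)) := by
  have hpow : ∀ k : ℕ, Tendsto (fun N => (φ N).apply (fun x => x ^ k) f) atTop
      (𝓝 ((hamiltonian V hV ^ k) f)) := by
    intro k
    induction k with
    | zero =>
      simp only [pow_zero, BoxEigenbasis.apply_one]
      exact tendsto_boxProj f
    | succ k ih =>
      have := tendsto_boxHamiltonian (V := V) (hV := hV) ih
      simp only [← BoxEigenbasis.apply_mul, ← pow_succ'] at this
      rw [pow_succ']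
      exact this
  induction p using Polynomial.induction_on' with
  | add p q hp hq =>
    simp only [Polynomial.eval_add, BoxEigenbasis.apply_add, map_add]
    exact hp.add hq
  | monomial k r =>
    simp only [Polynomial.eval_monomial, BoxEigenbasis.apply_const_mul, Polynomial.aeval_monomial,
      ← Algebra.smul_def]
    exact (hpow k).const_smul r

/-- Functions of the Hamiltonians of the boxes converge strongly. -/
theorem tendsto_apply_functionOf (φ : ∀ N, BoxEigenbasis V hV N) {F : ℝ → ℝ} (hF : Continuous F)
    (f : OneParticle d) :
    Tendsto (fun N => (φ N).apply F f) atTop (𝓝 (functionOf F (hamiltonian V hV) f)) := by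
  set R := ‖hamiltonian V hV‖
  rw [Metric.tendsto_nhds]
  intro ε hε
  -- Three errors of size `ε / 4` are added below: the polynomial approximation in the box, the one
  -- in infinite volume, and the convergence for the polynomial. The `+ 1` covers `f = 0`.
  set η := ε / (4 * (‖f‖ + 1)) with hη
  have hη0 : 0 < η := by positivity
  obtain ⟨p, hp⟩ := exists_polynomial_near_of_continuousOn (-R) R F hF.continuousOn η hη0
  have hp' : ∀ x, |x| ≤ R → |F x - p.eval x| ≤ η := fun x hx => by
    rw [abs_sub_comm]
    exact (hp x (abs_le.1 hx)).le
  have h1 : ‖functionOf F (hamiltonian V hV) - Polynomial.aeval (hamiltonian V hV) p‖ ≤ η :=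
    norm_functionOf_sub_aeval_le isSelfAdjoint_hamiltonian hF p hη0.le hp'
  have hηf : η * ‖f‖ ≤ ε / 4 := by
    rw [hη, div_mul_eq_mul_div, div_le_div_iff₀ (by positivity) (by positivity)]
    nlinarith [norm_nonneg f]
  filter_upwards [(Metric.tendsto_nhds.1 (tendsto_apply_polynomial φ p f)) (ε / 4)
    (by positivity)] with N hN
  rw [dist_eq_norm] at hN ⊢
  have e : (φ N).apply F f - functionOf F (hamiltonian V hV) f =
      (φ N).apply (fun x => F x - p.eval x) f +
      ((φ N).apply (fun x => p.eval x) f - Polynomial.aeval (hamiltonian V hV) p f) -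
      (functionOf F (hamiltonian V hV) - Polynomial.aeval (hamiltonian V hV) p) f := by
    rw [BoxEigenbasis.apply_sub]
    show _ = _ - (functionOf F (hamiltonian V hV) f - Polynomial.aeval (hamiltonian V hV) p f)
    abel
  rw [e]
  have h2 := (φ N).norm_apply_le hη0.le hp' f
  have h3 := (ContinuousLinearMap.le_opNorm (functionOf F (hamiltonian V hV) -
    Polynomial.aeval (hamiltonian V hV) p) f).trans (mul_le_mul_of_nonneg_right h1 (norm_nonneg f))
  refine (norm_sub_le _ _).trans_lt ?_
  have h4 := norm_add_le ((φ N).apply (fun x => F x - p.eval x) f)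
    ((φ N).apply (fun x => p.eval x) f - Polynomial.aeval (hamiltonian V hV) p f)
  linarith

end OneParticleLimit

/-! ### A single Lindblad term acting on a product with a field. -/

section Lindblad

variable {H : Type*} [NormedAddCommGroup H] [InnerProductSpace ℂ H]
variable {A : Type*} [CStarAlgebra A] (c : CARAlgebra H A)

/-- Everything follows from moving `w` to the left through `b` and `star b` by means of the scalar
anticommutators. In the jump term the automorphism `θ` compensates the sign, so that `w` comes out
in front with the same sign in all three terms; the scalars that split off form the damping and the
contraction. -/
theorem CARAlgebra.lindblad_term_mul {b w : A} (hw : c.IsField w) {g g' : ℂ}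
    (hg : b * w + w * b = g • (1 : A)) (hg' : star b * w + w * star b = g' • (1 : A)) (x : A) :
    (2 : ℂ) • (b * c.parity (w * x) * star b) - b * star b * (w * x) - w * x * (b * star b) =
      w * ((2 : ℂ) • (b * c.parity x * star b) - b * star b * x - x * (b * star b)) -
        (g' • b + g • star b) * x + (2 * g) • c.gradedComm (star b) x := by
  have h1 : ∀ y, b * (w * y) = g • y - w * (b * y) := fun y => by
    rw [← mul_assoc, ← mul_assoc, eq_sub_iff_add_eq, ← add_mul, hg, smul_mul_assoc, one_mul]
  have h2 : ∀ y, star b * (w * y) = g' • y - w * (star b * y) := fun y => by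
    rw [← mul_assoc, ← mul_assoc, eq_sub_iff_add_eq, ← add_mul, hg', smul_mul_assoc, one_mul]
  rw [map_mul, hw.parity, gradedComm]
  simp only [mul_assoc, neg_mul, mul_neg, h1, h2, mul_sub, sub_mul, add_mul,
    smul_mul_assoc, mul_smul_comm]
  module

theorem CARAlgebra.gradedComm_sum_left {ι : Type*}
    (s : Finset ι) (m : ι → A) (x : A) :
    c.gradedComm (∑ n ∈ s, m n) x = ∑ n ∈ s, c.gradedComm (m n) x := by
  simp only [CARAlgebra.gradedComm, Finset.sum_mul, Finset.mul_sum, Finset.sum_sub_distrib]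

theorem CARAlgebra.gradedComm_smul_left (z : ℂ)
    (b x : A) : c.gradedComm (z • b) x = z • c.gradedComm b x := by
  simp only [CARAlgebra.gradedComm, mul_smul_comm, smul_mul_assoc, smul_sub]

end Lindblad

/-! ### Davies' dissipator is quasi-free and its one-particle data converge. -/

section DaviesApproximation

variable {d : ℕ} {A : Type*} [CStarAlgebra A] {V : Lattice d → ℝ} {hV : ∃ C, ∀ x, |V x| ≤ C}

theorem dissipator_one (c : CARAlgebra (OneParticle d) A) (β μ lam : ℝ) {N : ℕ}
    (φ : BoxEigenbasis V hV N) : dissipator c β μ lam φ 1 = 0 := by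
  simp [dissipator, two_smul]

/-- Jumps by `a(φ_n)` and by `a*(φ_n)` damp an annihilation operator with weights that add up to 1,
so the damping does not see the Fermi function. The contraction comes from the jumps by `a*(φ_n)`
alone, with their weight `1 - f`. -/
theorem dissipator_ann_mul (c : CARAlgebra (OneParticle d) A) (β μ lam : ℝ) {N : ℕ}
    (φ : BoxEigenbasis V hV N) (f : OneParticle d) (x : A) :
    dissipator c β μ lam φ (c.ann f * x) = c.ann f * dissipator c β μ lam φ x -
      (lam : ℂ) • (c.ann (φ.apply (fun _ => 1) f) * x) + (2 * lam : ℂ) •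
        c.gradedComm (c.ann (φ.apply (fun _ => 1) f - φ.apply (fermiDirac β μ) f)) x := by
  have h1 := fun n => c.lindblad_term_mul (b := c.ann (φ.vec n)) (CARAlgebra.IsField.ann c f)
    (g := 0) (g' := inner ℂ f (φ.vec n)) (by rw [c.ann_mul_ann, zero_smul])
    (c.cre_mul_ann_add (φ.vec n) f) x
  have h2 := fun n => c.lindblad_term_mul (b := c.cre (φ.vec n)) (CARAlgebra.IsField.ann c f)
    (g := inner ℂ f (φ.vec n)) (g' := 0) (c.cre_mul_ann_add (φ.vec n) f)
    (by rw [CARAlgebra.cre, star_star, c.ann_mul_ann, zero_smul]) x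
  simp only [CARAlgebra.cre, star_star] at h1 h2
  have e1 : c.ann (φ.apply (fun _ => 1) f) = ∑ n, (inner ℂ f (φ.vec n) : ℂ) • c.ann (φ.vec n) := by
    simp [BoxEigenbasis.apply, map_sum, LinearMap.map_smulₛₗ]
  have e2 : c.ann (φ.apply (fun _ => 1) f - φ.apply (fermiDirac β μ) f) =
      ∑ n, (((1 - fermiDirac β μ (φ.energy n) : ℝ) : ℂ) * inner ℂ f (φ.vec n)) •
        c.ann (φ.vec n) := by
    rw [← BoxEigenbasis.apply_sub]
    simp [BoxEigenbasis.apply, map_sum, LinearMap.map_smulₛₗ]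
  rw [e1, e2, c.gradedComm_sum_left]
  simp only [c.gradedComm_smul_left, dissipator, CARAlgebra.cre, h1, h2]
  simp only [Finset.smul_sum, mul_add, Finset.mul_sum, Finset.sum_mul, ← Finset.sum_add_distrib,
    ← Finset.sum_sub_distrib]
  refine Finset.sum_congr rfl fun n _ => ?_
  simp only [smul_mul_assoc, mul_smul_comm, zero_smul, zero_add, add_zero, mul_zero]
  push_cast
  module

/-- The roles of the two kinds of jumps are exchanged: a creation operator is contracted only by the
jumps by `a(φ_n)`, whose weight is `f`. -/
theorem dissipator_cre_mul (c : CARAlgebra (OneParticle d) A) (β μ lam : ℝ) {N : ℕ}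
    (φ : BoxEigenbasis V hV N) (f : OneParticle d) (x : A) :
    dissipator c β μ lam φ (c.cre f * x) = c.cre f * dissipator c β μ lam φ x -
      (lam : ℂ) • (c.cre (φ.apply (fun _ => 1) f) * x) + (2 * lam : ℂ) •
        c.gradedComm (c.cre (φ.apply (fermiDirac β μ) f)) x := by
  have h1 := fun n => c.lindblad_term_mul (b := c.ann (φ.vec n)) (CARAlgebra.IsField.cre c f)
    (g := inner ℂ (φ.vec n) f) (g' := 0) (c.ann_mul_cre_add f (φ.vec n))
    ((c.cre_mul_cre_add (φ.vec n) f).trans (zero_smul ℂ _).symm) x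
  have h2 := fun n => c.lindblad_term_mul (b := c.cre (φ.vec n)) (CARAlgebra.IsField.cre c f)
    (g := 0) (g' := inner ℂ (φ.vec n) f) (by rw [c.cre_mul_cre_add, zero_smul])
    (by
      have := c.ann_mul_cre_add f (φ.vec n)
      rwa [CARAlgebra.cre, star_star]) x
  have hs : ∀ g, star (c.cre g) = c.ann g := fun g => star_star _
  have hs' : ∀ g, star (c.ann g) = c.cre g := fun g => rfl
  simp only [hs, hs'] at h1 h2
  have e1 : ∀ F : ℝ → ℝ, c.cre (φ.apply F f) =
      ∑ n, ((F (φ.energy n) : ℂ) * inner ℂ (φ.vec n) f) • c.cre (φ.vec n) := fun F => by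
    simp [BoxEigenbasis.apply, CARAlgebra.cre, map_sum, LinearMap.map_smulₛₗ, star_sum, star_smul]
  rw [e1, e1, c.gradedComm_sum_left]
  simp only [c.gradedComm_smul_left, dissipator, h1, h2]
  simp only [Finset.smul_sum, mul_add, Finset.mul_sum, Finset.sum_mul, ← Finset.sum_add_distrib,
    ← Finset.sum_sub_distrib]
  refine Finset.sum_congr rfl fun n _ => ?_
  simp only [smul_mul_assoc, mul_smul_comm, zero_smul, zero_add, add_zero, mul_zero]
  push_cast
  module

theorem continuous_fermiDirac (β μ : ℝ) : Continuous (fermiDirac β μ) := by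
  unfold fermiDirac
  have : Continuous fun ε : ℝ => 1 + Real.exp (β * (ε - μ)) := by fun_prop
  exact continuous_const.div this fun ε => by positivity

variable [PartialOrder A] [StarOrderedRing A]

/-- The rates of the dissipator of the box. -/
noncomputable def boxRate (β μ lam : ℝ) {N : ℕ} (φ : BoxEigenbasis V hV N) :
    Fin (box d N).card ⊕ Fin (box d N).card → ℝ :=
  Sum.elim (fun n => lam * fermiDirac β μ (φ.energy n))
    (fun n => lam * (1 - fermiDirac β μ (φ.energy n)))

/-- The annihilation and creation operators of the eigenvectors of the box. -/
noncomputable def boxField (c : CARAlgebra (OneParticle d) A) {N : ℕ} (φ : BoxEigenbasis V hV N) :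
    Fin (box d N).card ⊕ Fin (box d N).card → A :=
  Sum.elim (fun n => c.ann (φ.vec n)) (fun n => c.cre (φ.vec n))

/-- The dissipator as a bounded operator. -/
noncomputable def dissipatorCLM (c : CARAlgebra (OneParticle d) A) (β μ lam : ℝ) {N : ℕ}
    (φ : BoxEigenbasis V hV N) : A →L[ℂ] A :=
  lindbladOp (homCLM c.parity) (boxRate β μ lam φ) (boxField c φ)

theorem dissipatorCLM_apply (c : CARAlgebra (OneParticle d) A) (β μ lam : ℝ) {N : ℕ}
    (φ : BoxEigenbasis V hV N) (x : A) :
    dissipatorCLM c β μ lam φ x = dissipator c β μ lam φ x := by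
  rw [dissipatorCLM, lindbladOp_apply, Fintype.sum_sum_type, dissipator, Finset.smul_sum,
    Finset.smul_sum]
  simp only [boxRate, boxField, Sum.elim_inl, Sum.elim_inr, CARAlgebra.cre, smul_smul,
    homCLM_apply, Complex.ofReal_mul, star_star]

/-- The field enters the one-particle data only through the group; damping and density are those of
the box without field, and their limits are the identity and `f(h)`. -/
theorem isDissipativeApproximation [NeZero d] (c : CARAlgebra (OneParticle d) A) (β μ : ℝ)
    {lam : ℝ} (hlam : 0 < lam) (E : ℝ) (φ : ∀ N, BoxEigenbasis V hV N) :
    IsDissipativeApproximation c lam (fermiOp V hV β μ)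
      (fun t => (fieldEvolution V hV E t).toLinearIsometry)
      (fun N => (φ N).apply fun _ => 1) (fun N => (φ N).apply (fermiDirac β μ))
      (fun N => dissipatorCLM c β μ lam (φ N))
      (fun N => daviesSemigroup c β μ hlam E (φ N)) where
  isQuasiFree N :=
    { map_one := by rw [dissipatorCLM_apply, dissipator_one]
      ann_mul := fun f x => by
        simp only [dissipatorCLM_apply]
        exact dissipator_ann_mul c β μ lam (φ N) f x
      cre_mul := fun f x => by
        simp only [dissipatorCLM_apply]
        exact dissipator_cre_mul c β μ lam (φ N) f x
      norm_le := fun f => by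
        refine ⟨?_, ?_⟩
        · simpa using (φ N).norm_apply_le (F := fun _ => 1) zero_le_one (by simp) f
        · have := (φ N).norm_apply_le (F := fermiDirac β μ) zero_le_one (fun x _ => by
            have := fermiDirac_mem β μ x
            rw [abs_of_nonneg this.1]
            linarith) f
          simpa using this }
  tendsto_one f := by
    simp only [BoxEigenbasis.apply_one]
    exact tendsto_boxProj f
  tendsto_density f := tendsto_apply_functionOf φ (continuous_fermiDirac β μ) f
  continuous f := (fieldEvolution_spec V hV E).continuous f
  zero f := (fieldEvolution_spec V hV E).map_zero f
  duhamel N k t x := by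
    have hU := fieldEvolution_spec V hV E
    refine (daviesSemigroup c β μ hlam E (φ N)).duhamel (freeDynamics c V hV E)
      (fun x => c.hom_ext (ψ := StarAlgHom.id ℂ A)
        (fun f => by simp [freeDynamics, hU.map_zero]) x)
      (fun s t x => c.hom_ext (ψ := (freeDynamics c V hV E s).comp (freeDynamics c V hV E t))
        (fun f => by simp [freeDynamics, hU.map_add]) x)
      (fun x => c.continuous_bogoliubov _ (fun f => hU.continuous f) x)
      (dissipatorCLM c β μ lam (φ N)) (fun x y => ?_) k t x
    rw [daviesSemigroup_spec, IsDaviesGeneratorValue]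
    simp only [dissipatorCLM_apply]

end DaviesApproximation

/-! ### The Fermi function as the inverse of an exponential expression. -/

section FermiFunction

variable {H : Type*} [NormedAddCommGroup H] [InnerProductSpace ℂ H] [CompleteSpace H]

/-- The operator `1 + e^{β(T - μ)}`. -/
noncomputable def fermiDenominator (β μ : ℝ) (T : H →L[ℂ] H) : H →L[ℂ] H :=
  1 + NormedSpace.exp ((β : ℂ) • (T - (μ : ℂ) • (1 : H →L[ℂ] H)))

/-- Passing from the functional calculus to the power series of the exponential makes
differentiation along a family of operators, not necessarily commuting, available. -/
theorem cfc_fermiDenominator (β μ : ℝ) {T : H →L[ℂ] H} (hT : IsSelfAdjoint T) :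
    cfc (fun x => 1 + Real.exp (β * (x - μ))) T = fermiDenominator β μ T := by
  have h1 : cfc (fun x => β * (x - μ)) T = (β : ℂ) • (T - (μ : ℂ) • (1 : H →L[ℂ] H)) := by
    rw [cfc_const_mul β (fun x => x - μ) T, cfc_sub (fun x => x) (fun _ => μ) T, cfc_id' ℝ T,
      cfc_const μ T, Algebra.algebraMap_eq_smul_one]
    rfl
  have h2 : IsSelfAdjoint (cfc (fun x : ℝ => β * (x - μ)) T) := cfc_predicate _ _
  rw [cfc_const_add 1 (fun x => Real.exp (β * (x - μ))) T,
    cfc_comp' Real.exp (fun x => β * (x - μ)) T, CFC.real_exp_eq_normedSpace_exp h2, h1, map_one]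
  rfl

theorem functionOf_mul_fermiDenominator (β μ : ℝ) {T : H →L[ℂ] H} (hT : IsSelfAdjoint T) :
    functionOf (fermiDirac β μ) T * fermiDenominator β μ T = 1 ∧
      fermiDenominator β μ T * functionOf (fermiDirac β μ) T = 1 := by
  have hc := (continuous_fermiDirac β μ).continuousOn (s := spectrum ℝ T)
  have hg : ContinuousOn (fun x => 1 + Real.exp (β * (x - μ))) (spectrum ℝ T) := by fun_prop
  have hone : ∀ x, fermiDirac β μ x * (1 + Real.exp (β * (x - μ))) = 1 := fun x => by
    rw [fermiDirac]
    have : 0 < Real.exp (β * (x - μ)) := Real.exp_pos _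
    field_simp
  have h1 : functionOf (fermiDirac β μ) T * fermiDenominator β μ T = 1 := by
    rw [functionOf, ← cfc_fermiDenominator β μ hT, ← cfc_mul _ _ T hc hg]
    simp only [hone]
    exact cfc_const_one ℝ T
  refine ⟨h1, ?_⟩
  rw [← h1, functionOf, ← cfc_fermiDenominator β μ hT]
  exact cfc_commute_cfc _ _ T

theorem functionOf_commute (f : ℝ → ℝ) {T : H →L[ℂ] H} (hT : IsSelfAdjoint T) :
    functionOf f T * T = T * functionOf f T := by
  have h := cfc_commute_cfc f (fun x : ℝ => x) T
  rw [cfc_id' ℝ T] at h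
  exact h

theorem isSelfAdjoint_functionOf (f : ℝ → ℝ) (T : H →L[ℂ] H) :
    IsSelfAdjoint (functionOf f T) := cfc_predicate f T

end FermiFunction

/-! ### Differentiability of exponentials and inverses in a Banach algebra. -/

section BanachAlgebra

variable {B : Type*} [NormedRing B] [NormedAlgebra ℂ B] [CompleteSpace B]

theorem exp_conj_of_inverse {u v : B} (huv : u * v = 1) (hvu : v * u = 1) (x : B) :
    NormedSpace.exp (u * x * v) = u * NormedSpace.exp x * v := by
  let _ : NormedAlgebra ℚ B := NormedAlgebra.restrictScalars ℚ ℂ B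
  exact NormedSpace.exp_units_conj ⟨u, v, huv, hvu⟩ x

theorem differentiable_exp : Differentiable ℂ (NormedSpace.exp : B → B) :=
  fun x => (NormedSpace.exp_analytic (𝕂 := ℂ) x).differentiableAt

theorem continuous_fderiv_exp : Continuous (fderiv ℂ (NormedSpace.exp : B → B)) :=
  continuous_iff_continuousAt.2 fun x => (NormedSpace.exp_analytic (𝕂 := ℂ) x).fderiv.continuousAt

theorem hasDerivAt_exp_comp {f : ℝ → B} {f' : B} {s : ℝ} (hf : HasDerivAt f f' s) :
    HasDerivAt (fun r => NormedSpace.exp (f r)) (fderiv ℂ (NormedSpace.exp : B → B) (f s) f') s :=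
  ((differentiable_exp (f s)).hasFDerivAt.restrictScalars ℝ).comp_hasDerivAt s hf

/-- The inverses of a differentiable family are differentiable. -/
theorem exists_hasDerivAt_inverse {g ρ : ℝ → B} (h1 : ∀ s, g s * ρ s = 1)
    (h2 : ∀ s, ρ s * g s = 1) {g' : B} {s : ℝ} (hg : HasDerivAt g g' s) :
    ∃ ρ', HasDerivAt ρ ρ' s := by
  have e : ρ = fun r => Ring.inverse (g r) := funext fun r =>
    (Ring.inverse_unit ⟨g r, ρ r, h1 r, h2 r⟩).symm
  have h3 := (hasFDerivAt_ringInverse (𝕜 := ℂ) (⟨g s, ρ s, h1 s, h2 s⟩ : Bˣ)).restrictScalars ℝ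
  rw [e]
  exact ⟨_, h3.comp_hasDerivAt s hg⟩

end BanachAlgebra

/-! ### Product rules for an operator family applied to a moving vector. -/

section StrongProduct

variable {H : Type*} [NormedAddCommGroup H] [NormedSpace ℂ H]

/-- Made for groups with unbounded generator: `F` is differentiated only on the one vector `ψ r`,
and the uniform bound absorbs the difference between the slope of `ψ` and its limit. -/
theorem hasDerivAt_strong {F : ℝ → H →L[ℂ] H} {C : ℝ} (hb : ∀ s x, ‖F s x‖ ≤ C * ‖x‖)
    {ψ : ℝ → H} {ψ' χ' : H} {r : ℝ} (hc : Tendsto (fun s => F s ψ') (𝓝 r) (𝓝 (F r ψ')))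
    (hF : HasDerivAt (fun s => F s (ψ r)) χ' r) (hψ : HasDerivAt ψ ψ' r) :
    HasDerivAt (fun s => F s (ψ s)) (χ' + F r ψ') r := by
  rw [hasDerivAt_iff_tendsto_slope] at hF hψ ⊢
  have h1 : Tendsto (fun s => F s (slope ψ r s - ψ')) (𝓝[≠] r) (𝓝 0) := by
    have := (tendsto_iff_norm_sub_tendsto_zero.1 hψ).const_mul C
    rw [mul_zero] at this
    exact squeeze_zero_norm (fun s => hb s _) this
  have h2 := (hF.add h1).add (hc.mono_left nhdsWithin_le_nhds)
  rw [add_zero] at h2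
  refine h2.congr fun s => ?_
  have e : F s (slope ψ r s) = (s - r)⁻¹ • (F s (ψ s) - F s (ψ r)) := by
    rw [slope_def_module, ← map_sub]
    exact ContinuousLinearMap.map_smul_of_tower (F s) _ _
  rw [map_sub, e, slope_def_module, slope_def_module]
  module

theorem hasDerivAt_apply {F : ℝ → H →L[ℂ] H} {F' : H →L[ℂ] H} {ψ : ℝ → H} {ψ' : H} {r : ℝ}
    (hF : HasDerivAt F F' r) (hψ : HasDerivAt ψ ψ' r) :
    HasDerivAt (fun s => F s (ψ s)) (F' (ψ r) + F r ψ') r := by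
  have h := ((isBoundedBilinearMap_apply (𝕜 := ℂ) (E := H) (F := H)).hasFDerivAt
    (F r, ψ r)).restrictScalars ℝ
  refine (h.comp_hasDerivAt r (hF.prodMk hψ)).congr_deriv ?_
  show F r ψ' + F' (ψ r) = _
  abel

end StrongProduct

/-! ### Bounded commutators with the position operator. -/

section PositionCommutator

variable {d : ℕ}

theorem lp_coe_hasDerivAt {F : ℝ → OneParticle d} {F' : OneParticle d} {r : ℝ}
    (hF : HasDerivAt F F' r) (x : Lattice d) : HasDerivAt (fun s => F s x) (F' x) r := by
  have h := ((lp.evalCLM ℂ (fun _ : Lattice d => ℂ) 2 x).restrictScalars ℝ).hasFDerivAt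
    (x := F r)
  exact h.comp_hasDerivAt r hF

variable [NeZero d]

theorem hasDerivAt_fieldPhase_neg (φ : (positionOp d).domain) :
    HasDerivAt (fun s => fieldPhase d 1 (-s) (φ : OneParticle d)) (I • positionOp d φ) 0 := by
  have h := hasDerivAt_fieldPhase_apply 1 φ
  have h' : HasDerivAt (fun t => fieldPhase d 1 t (φ : OneParticle d))
      (-(I * (1 : ℝ)) • positionOp d φ) (-0) := by rwa [neg_zero]
  refine (h'.scomp (0 : ℝ) (hasDerivAt_neg (0 : ℝ))).congr_deriv ?_
  simp

/-- If `s ↦ e^{isQ₁} B e^{-isQ₁}` is differentiable in norm with derivative `iK` at `0`, then `K` is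
the commutator of `Q₁` and `B`. -/
theorem isPositionCommutator_of_hasDerivAt {B K : OneParticle d →L[ℂ] OneParticle d}
    (h : HasDerivAt (fun s => fieldPhase d 1 (-s) * B * fieldPhase d 1 s) (I • K) 0) :
    IsPositionCommutator B K := by
  intro φ
  have h1 := hasDerivAt_apply h (hasDerivAt_fieldPhase_neg φ)
  -- The phases cancel, so the product rule differentiates `e^{isQ₁} B φ` without knowing beforehand
  -- that `B φ` is in the domain.
  have h2 : (fun s => (fieldPhase d 1 (-s) * B * fieldPhase d 1 s)
      (fieldPhase d 1 (-s) (φ : OneParticle d))) = fun s => fieldPhase d 1 (-s) (B φ) := by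
    funext s
    rw [← mul_apply_eq_comp, mul_assoc, fieldPhase_mul_neg, mul_one]
    rfl
  rw [h2] at h1
  simp only [neg_zero, fieldPhase_zero, one_mul, mul_one, one_apply_eq_self] at h1
  -- At each site the derivative can be computed directly. Comparison shows that `x₁ (B φ)(x)` is
  -- the coordinate of a square-summable vector, which is membership in the maximal domain.
  have key : ∀ x : Lattice d, (x 0 : ℂ) * B φ x = (K φ + B (positionOp d φ) : OneParticle d) x := by
    intro x
    have h3 := lp_coe_hasDerivAt h1 x
    simp only [fieldPhase_apply] at h3
    have h4 : HasDerivAt (fun s : ℝ => Complex.exp (-((-s * 1 * x 0 : ℝ) : ℂ) * I) * B φ x)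
        (I * x 0 * B φ x) 0 := by
      have h5 : HasDerivAt (fun s : ℝ => -((-s * 1 * x 0 : ℝ) : ℂ) * I) (I * x 0) 0 := by
        have h6 := ((hasDerivAt_id (0 : ℝ)).ofReal_comp.mul_const (x 0 : ℂ)).mul_const I
        refine (h6.congr_deriv ?_).congr_of_eventuallyEq (Eventually.of_forall fun t => ?_)
        · push_cast
          ring
        · simp
      have := h5.cexp.mul_const (B φ x)
      simpa using this
    have h5 := h4.unique h3
    have h6 : ((I • K) (φ : OneParticle d) + B (I • positionOp d φ) : OneParticle d) x =
        I * (K φ + B (positionOp d φ) : OneParticle d) x := by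
      rw [map_smul]
      show I * K φ x + I * B (positionOp d φ) x = I * (K φ x + B (positionOp d φ) x)
      ring
    rw [h6, mul_assoc] at h5
    exact mul_left_cancel₀ I_ne_zero h5
  have hmem : B φ ∈ (positionOp d).domain := by
    show Memℓp (fun x : Lattice d => (x 0 : ℂ) * B φ x) 2
    simp only [key]
    exact (K φ + B (positionOp d φ) : OneParticle d).2
  refine ⟨hmem, ?_⟩
  rw [eq_sub_iff_add_eq]
  refine lp_ext fun x => ?_
  rw [positionOp_apply]
  exact (key x).symm

/-- The commutator `[Q₁, h]`. -/
noncomputable def hopCommutator (d : ℕ) [NeZero d] : OneParticle d →L[ℂ] OneParticle d :=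
  translation (unitVec 0) - translation (-unitVec 0)

/-- The rotation multiplies each translation by a phase and leaves the potential alone. Hence the
family is smooth in norm although `Q₁` is unbounded, and its derivative does not involve `V`. -/
theorem rotatedHamiltonian_eq (V : Lattice d → ℝ) (hV : ∃ C, ∀ x, |V x| ≤ C) (E t : ℝ) :
    rotatedHamiltonian V hV E t =
      -(∑ j, (Complex.exp (-((t * E * (unitVec j : Lattice d) 0 : ℝ) : ℂ) * I) •
        translation (unitVec j) +
        Complex.exp (-((t * E * (-unitVec j : Lattice d) 0 : ℝ) : ℂ) * I) •
        translation (-unitVec j))) + potentialOp V hV := by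
  simp only [← fieldPhase_conj_translation]
  rw [rotatedHamiltonian, hamiltonian, mul_add, add_mul, fieldPhase_conj_potentialOp]
  congr 1
  simp only [mul_neg, neg_mul, Finset.mul_sum, Finset.sum_mul, mul_add, add_mul]

theorem hasDerivAt_rotatedHamiltonian (V : Lattice d → ℝ) (hV : ∃ C, ∀ x, |V x| ≤ C) :
    HasDerivAt (fun s => fieldPhase d 1 (-s) * hamiltonian V hV * fieldPhase d 1 s)
      (I • hopCommutator d) 0 := by
  have h0 : ∀ n : ℤ, HasDerivAt (fun t : ℝ => Complex.exp (-((t * 1 * n : ℝ) : ℂ) * I))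
      (-(I * n)) 0 := fun n => by
    have h5 : HasDerivAt (fun t : ℝ => -((t * 1 * n : ℝ) : ℂ) * I) (-(I * n)) 0 := by
      have h6 := ((hasDerivAt_id (0 : ℝ)).ofReal_comp.mul_const (n : ℂ)).neg.mul_const I
      refine (h6.congr_deriv ?_).congr_of_eventuallyEq (Eventually.of_forall fun t => ?_)
      · push_cast
        ring
      · simp
    simpa using h5.cexp
  have h1 : HasDerivAt (rotatedHamiltonian V hV 1)
      (-(∑ j, ((-(I * ((unitVec j : Lattice d) 0 : ℤ))) • translation (unitVec j) +
        (-(I * ((-unitVec j : Lattice d) 0 : ℤ))) • translation (-unitVec j)))) 0 := by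
    rw [funext (rotatedHamiltonian_eq V hV 1)]
    refine HasDerivAt.add_const _ (HasDerivAt.neg (HasDerivAt.fun_sum fun j _ => ?_))
    exact ((h0 ((unitVec j : Lattice d) 0)).smul_const (translation (unitVec j))).add
      ((h0 ((-unitVec j : Lattice d) 0)).smul_const (translation (-unitVec j)))
  refine h1.congr_deriv ?_
  -- Only hops along the first axis change the first coordinate.
  rw [Finset.sum_eq_single (0 : Fin d)]
  · simp only [unitVec, Pi.single_eq_same, Pi.neg_apply, hopCommutator]
    push_cast
    module
  · intro j _ hj
    simp [unitVec, Pi.single_eq_of_ne hj.symm]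
  · simp

theorem isPositionCommutator_hamiltonian (V : Lattice d → ℝ) (hV : ∃ C, ∀ x, |V x| ≤ C) :
    IsPositionCommutator (hamiltonian V hV) (hopCommutator d) :=
  isPositionCommutator_of_hasDerivAt (hasDerivAt_rotatedHamiltonian V hV)

/-- The velocity operator `v₁`. -/
noncomputable def velocityOp (d : ℕ) [NeZero d] : OneParticle d →L[ℂ] OneParticle d :=
  -(I • hopCommutator d)

theorem isVelocity_velocityOp (V : Lattice d → ℝ) (hV : ∃ C, ∀ x, |V x| ≤ C) :
    IsVelocity V hV (velocityOp d) := fun φ => by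
  obtain ⟨h, he⟩ := isPositionCommutator_hamiltonian V hV φ
  refine ⟨h, ?_⟩
  show -(I • hopCommutator d (φ : OneParticle d)) = _
  rw [he, ← smul_neg, neg_sub]

variable (V : Lattice d → ℝ) (hV : ∃ C, ∀ x, |V x| ≤ C)

theorem fieldPhase_conj_exp (T : OneParticle d →L[ℂ] OneParticle d) (s : ℝ) :
    fieldPhase d 1 (-s) * NormedSpace.exp T * fieldPhase d 1 s =
      NormedSpace.exp (fieldPhase d 1 (-s) * T * fieldPhase d 1 s) :=
  (exp_conj_of_inverse (fieldPhase_neg_mul 1 s) (fieldPhase_mul_neg 1 s) T).symm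

/-- Rotation by `e^{isQ₁}` passes through the exponential and through inverses, so norm
differentiability of the rotated `h` is inherited by `1 + e^{β(h - μ)}` and by its inverse `f(h)`.
-/
theorem exists_isPositionCommutator_fermiOp (β μ : ℝ) :
    ∃ K, IsPositionCommutator (fermiOp V hV β μ) K := by
  set h := hamiltonian V hV
  have hr := hasDerivAt_rotatedHamiltonian V hV
  have hconj : ∀ s, fieldPhase d 1 (-s) * fermiDenominator β μ h * fieldPhase d 1 s =
      fermiDenominator β μ (fieldPhase d 1 (-s) * h * fieldPhase d 1 s) := fun s => by
    rw [fermiDenominator, mul_add, add_mul, fieldPhase_conj_exp, mul_one, fieldPhase_neg_mul,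
      fermiDenominator]
    congr 2
    simp only [mul_smul_comm, smul_mul_assoc, mul_sub, sub_mul, mul_one, fieldPhase_neg_mul]
  have hg := (hasDerivAt_exp_comp ((hr.sub_const ((μ : ℂ) • 1)).const_smul (β : ℂ))).const_add
    (1 : OneParticle d →L[ℂ] OneParticle d)
  obtain ⟨h1, h2⟩ := functionOf_mul_fermiDenominator β μ (isSelfAdjoint_hamiltonian (V := V)
    (hV := hV))
  have hcancel : ∀ {X Y : OneParticle d →L[ℂ] OneParticle d}, X * Y = 1 → ∀ s,
      fieldPhase d 1 (-s) * X * fieldPhase d 1 s * (fieldPhase d 1 (-s) * Y * fieldPhase d 1 s)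
        = 1 := fun {X Y} hXY s => by
    calc _ = fieldPhase d 1 (-s) * X * (fieldPhase d 1 s * fieldPhase d 1 (-s)) * Y *
          fieldPhase d 1 s := by simp only [mul_assoc]
      _ = fieldPhase d 1 (-s) * (X * Y) * fieldPhase d 1 s := by
          rw [fieldPhase_mul_neg, mul_one]
          simp only [mul_assoc]
      _ = 1 := by rw [hXY, mul_one, fieldPhase_neg_mul]
  obtain ⟨ρ', hρ⟩ := exists_hasDerivAt_inverse
    (g := fun s => fieldPhase d 1 (-s) * fermiDenominator β μ h * fieldPhase d 1 s)
    (ρ := fun s => fieldPhase d 1 (-s) * fermiOp V hV β μ * fieldPhase d 1 s) (s := 0)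
    (hcancel h2) (hcancel h1) (by
      simp only [hconj]
      exact hg)
  refine ⟨-(I • ρ'), isPositionCommutator_of_hasDerivAt (hρ.congr_deriv ?_)⟩
  rw [smul_neg, smul_smul, I_mul_I, neg_one_smul, neg_neg]

/-- The same argument for `e^{irh}`. Continuity in `r` makes `Q₁ e^{irh} φ` bounded on compact time
intervals, as the comparison of the evolutions requires. -/
theorem exists_isPositionCommutator_evolution :
    ∃ K : ℝ → (OneParticle d →L[ℂ] OneParticle d), Continuous K ∧
      ∀ r, IsPositionCommutator (evolution V hV r) (K r) := by
  have hr := hasDerivAt_rotatedHamiltonian V hV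
  have h0 : fieldPhase d 1 (-0) * hamiltonian V hV * fieldPhase d 1 0 = hamiltonian V hV := by
    simp [fieldPhase_zero]
  refine ⟨fun r => -(I • fderiv ℂ NormedSpace.exp ((I * (r : ℂ)) • hamiltonian V hV)
    ((I * (r : ℂ)) • I • hopCommutator d)), ?_, fun r => ?_⟩
  · have h1 : Continuous fun r : ℝ => fderiv ℂ (NormedSpace.exp :
        (OneParticle d →L[ℂ] OneParticle d) → _) ((I * (r : ℂ)) • hamiltonian V hV) :=
      continuous_fderiv_exp.comp (by fun_prop)
    exact ((h1.clm_apply (by fun_prop)).const_smul I).neg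
  · refine isPositionCommutator_of_hasDerivAt ?_
    have := hasDerivAt_exp_comp (hr.const_smul (I * (r : ℂ)))
    rw [Pi.smul_apply, h0] at this
    rw [smul_neg, smul_smul, I_mul_I, neg_one_smul, neg_neg]
    refine this.congr_of_eventuallyEq (Eventually.of_forall fun s => ?_)
    simp only [evolution]
    rw [fieldPhase_conj_exp]
    simp only [mul_smul_comm, smul_mul_assoc]
    rfl

end PositionCommutator

/-! ### The group in the field: invariance of `D(Q₁)` and the limit of zero field. -/

section FieldEvolution

variable {d : ℕ} [NeZero d] (V : Lattice d → ℝ) (hV : ∃ C, ∀ x, |V x| ≤ C)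

theorem fieldHamiltonian_apply (E : ℝ) (φ : (positionOp d).domain) :
    fieldHamiltonian V hV E φ = hamiltonian V hV φ - (E : ℂ) • positionOp d φ := rfl

theorem inner_positionOp (φ ψ : (positionOp d).domain) :
    inner ℂ (positionOp d φ) (ψ : OneParticle d) = inner ℂ (φ : OneParticle d) (positionOp d ψ) := by
  rw [inner_eq, inner_eq]
  refine tsum_congr fun x => ?_
  rw [positionOp_apply, positionOp_apply, map_mul, map_intCast]
  ring

theorem inner_basisVec {d : ℕ} (x : Lattice d) (φ : OneParticle d) :
    inner ℂ (basisVec x) φ = φ x := by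
  rw [basisVec, lp.inner_single_left]
  simp

theorem basisVec_mem_domain (x : Lattice d) : basisVec x ∈ (positionOp d).domain := by
  rw [mem_positionOp_domain]
  refine summable_of_ne_finset_zero (s := {x}) fun y hy => ?_
  rw [basisVec_apply, if_neg (by simpa using hy)]
  simp

theorem positionOp_basisVec (x : Lattice d) :
    positionOp d ⟨basisVec x, basisVec_mem_domain x⟩ = (x 0 : ℂ) • basisVec x := by
  refine lp_ext fun y => ?_
  rw [positionOp_apply]
  show (y 0 : ℂ) * basisVec x y = x 0 * basisVec x y
  rw [basisVec_apply]
  split_ifs with h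
  · rw [h]
  · simp

theorem inner_hamiltonian {d : ℕ} (V : Lattice d → ℝ) (hV : ∃ C, ∀ x, |V x| ≤ C)
    (φ ψ : OneParticle d) :
    inner ℂ (hamiltonian V hV φ) ψ = inner ℂ φ (hamiltonian V hV ψ) :=
  (ContinuousLinearMap.isSelfAdjoint_iff_isSymmetric.1
    (isSelfAdjoint_hamiltonian (V := V) (hV := hV))) φ ψ

theorem fieldEvolution_neg_apply (E t : ℝ) (φ : OneParticle d) :
    fieldEvolution V hV E (-t) (fieldEvolution V hV E t φ) = φ := by
  have hU := fieldEvolution_spec V hV E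
  rw [← hU.map_add, neg_add_cancel, hU.map_zero]

theorem inner_fieldEvolution (E t : ℝ) (φ ψ : OneParticle d) :
    inner ℂ φ (fieldEvolution V hV E t ψ) = inner ℂ (fieldEvolution V hV E (-t) φ) ψ := by
  rw [← (fieldEvolution V hV E (-t)).inner_map_map, fieldEvolution_neg_apply]

theorem hasDerivAt_fieldEvolution (E : ℝ) (φ : (positionOp d).domain) (r : ℝ) :
    HasDerivAt (fun s => fieldEvolution V hV E s (φ : OneParticle d))
      (fieldEvolution V hV E r (I • fieldHamiltonian V hV E φ)) r := by
  have hU := fieldEvolution_spec V hV E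
  have h1 : HasDerivAt (fun s => fieldEvolution V hV E s (φ : OneParticle d))
      (I • fieldHamiltonian V hV E φ) (r - r) := by
    rw [sub_self]
    exact hU.hasDerivAt φ
  have h2 := h1.comp_sub_const r r
  have h3 := (((fieldEvolution V hV E r).toContinuousLinearEquiv :
    OneParticle d →L[ℂ] OneParticle d).restrictScalars ℝ).hasFDerivAt.comp_hasDerivAt r h2
  refine h3.congr_of_eventuallyEq (Eventually.of_forall fun s => ?_)
  show fieldEvolution V hV E s φ = fieldEvolution V hV E r (fieldEvolution V hV E (s - r) φ)
  rw [← hU.map_add, add_sub_cancel]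

theorem hasDerivAt_fieldEvolution_neg (E : ℝ) (φ : (positionOp d).domain) (r : ℝ) :
    HasDerivAt (fun s => fieldEvolution V hV E (-s) (φ : OneParticle d))
      (-fieldEvolution V hV E (-r) (I • fieldHamiltonian V hV E φ)) r := by
  refine ((hasDerivAt_fieldEvolution V hV E φ (-r)).scomp r (hasDerivAt_neg r)).congr_deriv ?_
  rw [neg_one_smul]

/-- The generator of `e^{ith_E}` acts as the formal operator `i(h - E Q₁)`. -/
theorem apply_of_hasDerivAt_fieldEvolution {E : ℝ} {φ y : OneParticle d}
    (h : HasDerivAt (fun t => fieldEvolution V hV E t φ) y 0) (x : Lattice d) :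
    y x = I * (hamiltonian V hV φ x - E * ((x 0 : ℂ) * φ x)) := by
  have h1 := lp_coe_hasDerivAt h x
  -- Testing against basis vectors, which lie in `D(Q₁)`, moves the generator to the side where it
  -- is known, so `φ` itself need not lie in `D(Q₁)`.
  have h2 := (hasDerivAt_fieldEvolution_neg V hV E ⟨basisVec x, basisVec_mem_domain x⟩ 0).inner ℂ
    (hasDerivAt_const (0 : ℝ) φ)
  have h3 : (fun t => fieldEvolution V hV E t φ x) =
      fun t => inner ℂ (fieldEvolution V hV E (-t) (basisVec x)) φ := funext fun t => by
    rw [← inner_fieldEvolution, inner_basisVec]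
  rw [h3] at h1
  rw [h1.unique h2, inner_zero_right, zero_add, neg_zero, (fieldEvolution_spec V hV E).map_zero,
    fieldHamiltonian_apply, positionOp_basisVec, inner_neg_left, inner_smul_left, inner_sub_left,
    inner_hamiltonian, inner_smul_left, inner_smul_left, inner_basisVec, inner_basisVec]
  simp

theorem hasDerivAt_fieldEvolution_apply (E : ℝ) (φ : (positionOp d).domain) (r : ℝ) :
    HasDerivAt (fun t => fieldEvolution V hV E t (fieldEvolution V hV E r (φ : OneParticle d)))
      (fieldEvolution V hV E r (I • fieldHamiltonian V hV E φ)) 0 := by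
  have hU := fieldEvolution_spec V hV E
  have h1 : HasDerivAt (fun s => fieldEvolution V hV E s (φ : OneParticle d))
      (fieldEvolution V hV E r (I • fieldHamiltonian V hV E φ)) (0 + r) := by
    rw [zero_add]
    exact hasDerivAt_fieldEvolution V hV E φ r
  simpa only [hU.map_add] using h1.comp_add_const 0 r

theorem evolution_zero {d : ℕ} (V : Lattice d → ℝ) (hV : ∃ C, ∀ x, |V x| ≤ C) :
    evolution V hV 0 = 1 := by
  simp [evolution]

theorem hasDerivAt_evolution {d : ℕ} (V : Lattice d → ℝ) (hV : ∃ C, ∀ x, |V x| ≤ C)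
    (φ : OneParticle d) (r : ℝ) :
    HasDerivAt (fun s => evolution V hV s φ) (I • hamiltonian V hV (evolution V hV r φ)) r := by
  have h1 := hasDerivAt_exp_smul_const' (𝕂 := ℝ) (I • hamiltonian V hV) r
  have e : ∀ s : ℝ, NormedSpace.exp (s • I • hamiltonian V hV) = evolution V hV s := fun s => by
    rw [evolution, mul_comm, mul_smul]
    rfl
  have h2 : HasDerivAt (evolution V hV) (I • hamiltonian V hV * evolution V hV r) r := by
    rw [← e r, funext fun s => (e s).symm]
    exact h1
  exact ((ContinuousLinearMap.apply ℂ (OneParticle d) φ).restrictScalars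
    ℝ).hasFDerivAt.comp_hasDerivAt r h2

theorem continuous_evolution {d : ℕ} (V : Lattice d → ℝ) (hV : ∃ C, ∀ x, |V x| ≤ C)
    (φ : OneParticle d) : Continuous fun s => evolution V hV s φ :=
  continuous_iff_continuousAt.2 fun r => (hasDerivAt_evolution V hV φ r).continuousAt

theorem star_evolution {d : ℕ} (V : Lattice d → ℝ) (hV : ∃ C, ∀ x, |V x| ≤ C) (s : ℝ) :
    star (evolution V hV s) = evolution V hV (-s) := by
  rw [evolution, NormedSpace.star_exp, star_smul, star_hamiltonian, evolution]
  simp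

/-- The evolutions with and without field differ by a term of first order in the field. -/
theorem exists_norm_evolution_sub_fieldEvolution_le (φ : (positionOp d).domain) (r : ℝ) :
    ∃ C, ∀ E, ‖evolution V hV r φ - fieldEvolution V hV E r (φ : OneParticle d)‖ ≤ |E| * C := by
  obtain ⟨K, hK, hKc⟩ := exists_isPositionCommutator_evolution V hV
  have hcont : Continuous fun s => K s φ + evolution V hV s (positionOp d φ) :=
    (hK.clm_apply continuous_const).add (continuous_evolution V hV _)
  obtain ⟨M, hM⟩ := (isCompact_uIcc (a := (0 : ℝ)) (b := r)).exists_bound_of_continuousOn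
    hcont.continuousOn
  refine ⟨M * ‖r - 0‖, fun E => ?_⟩
  have hU := fieldEvolution_spec V hV E
  -- Along this interpolation between the two evolutions the contributions of `h` cancel. The
  -- remainder is `iE Q₁ e^{ish} φ`, which the commutator `K` expresses by vectors bounded
  -- independently of `E`.
  have hder : ∀ s, HasDerivAt (fun s => fieldEvolution V hV E (-s) (evolution V hV s φ))
      (fieldEvolution V hV E (-s)
        ((I * E : ℂ) • (K s φ + evolution V hV s (positionOp d φ)))) s := fun s => by
    obtain ⟨hmem, hval⟩ := hKc s φ
    have h1 := hasDerivAt_fieldEvolution_neg V hV E ⟨_, hmem⟩ s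
    have h2 := hasDerivAt_strong (C := 1)
      (F := fun s => ((fieldEvolution V hV E (-s)).toContinuousLinearEquiv :
        OneParticle d →L[ℂ] OneParticle d)) (r := s)
      (fun s x => by
        rw [one_mul]
        exact ((fieldEvolution V hV E (-s)).norm_map x).le)
      (((hU.continuous _).comp continuous_neg).tendsto s) h1 (hasDerivAt_evolution V hV φ s)
    refine h2.congr_deriv ?_
    show -fieldEvolution V hV E (-s) (I • fieldHamiltonian V hV E ⟨_, hmem⟩) +
      fieldEvolution V hV E (-s) _ = _
    rw [← map_neg, ← map_add, hval, sub_add_cancel]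
    refine congrArg _ ?_
    show -(I • (hamiltonian V hV (evolution V hV s φ) - (E : ℂ) • positionOp d ⟨_, hmem⟩)) + _ = _
    module
  have h3 := (convex_uIcc (0 : ℝ) r).norm_image_sub_le_of_norm_hasDerivWithin_le
    (C := |E| * M) (fun s _ => (hder s).hasDerivWithinAt) (fun s hs => by
      rw [LinearIsometryEquiv.norm_map, norm_smul]
      simpa using mul_le_mul_of_nonneg_left (hM s hs) (abs_nonneg E))
    Set.left_mem_uIcc Set.right_mem_uIcc
  rw [neg_zero, hU.map_zero, evolution_zero, ← (fieldEvolution V hV E r).norm_map, map_sub,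
    ← hU.map_add, add_neg_cancel, hU.map_zero, mul_assoc] at h3
  exact h3

theorem tendsto_fieldEvolution (φ : (positionOp d).domain) (r : ℝ) :
    Tendsto (fun E => fieldEvolution V hV E r (φ : OneParticle d)) (𝓝 0)
      (𝓝 (evolution V hV r φ)) := by
  obtain ⟨C, hC⟩ := exists_norm_evolution_sub_fieldEvolution_le V hV φ r
  rw [tendsto_iff_norm_sub_tendsto_zero]
  have h : Tendsto (fun E : ℝ => |E| * C) (𝓝 0) (𝓝 0) := by
    have := (continuous_abs.mul continuous_const).tendsto' (0 : ℝ) (|0| * C) rfl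
    rwa [abs_zero, zero_mul] at this
  refine squeeze_zero (fun _ => norm_nonneg _) (fun E => ?_) h
  rw [norm_sub_rev]
  exact hC E

/-- The group is specified only by its generator on `D(Q₁)`; the estimate at `E = 0` identifies it
with the exponential there. -/
theorem fieldEvolution_field_zero (φ : (positionOp d).domain) (r : ℝ) :
    fieldEvolution V hV 0 r (φ : OneParticle d) = evolution V hV r φ := by
  obtain ⟨C, hC⟩ := exists_norm_evolution_sub_fieldEvolution_le V hV φ r
  have := hC 0
  rw [abs_zero, zero_mul, norm_le_zero_iff, sub_eq_zero] at this
  exact this.symm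

/-- The group `e^{ith_E}` leaves `D(Q₁)` invariant. -/
theorem fieldEvolution_mem_domain (E : ℝ) (φ : (positionOp d).domain) (r : ℝ) :
    fieldEvolution V hV E r (φ : OneParticle d) ∈ (positionOp d).domain := by
  rcases eq_or_ne E 0 with rfl | hE
  · rw [fieldEvolution_field_zero]
    obtain ⟨K, -, hKc⟩ := exists_isPositionCommutator_evolution V hV
    exact (hKc r φ).1
  -- The vector `U_r φ` has a differentiable orbit, so `h - E Q₁` acts on it, site by site, as a
  -- square-summable vector. Since `h` is bounded and `E ≠ 0`, `Q₁` does so as well.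
  · have h := apply_of_hasDerivAt_fieldEvolution V hV (hasDerivAt_fieldEvolution_apply V hV E φ r)
    have hE' : (E : ℂ) ≠ 0 := by exact_mod_cast hE
    show Memℓp (fun x : Lattice d => (x 0 : ℂ) * fieldEvolution V hV E r (φ : OneParticle d) x) 2
    have e : (fun x : Lattice d => (x 0 : ℂ) * fieldEvolution V hV E r (φ : OneParticle d) x) =
        fun x => ((E : ℂ)⁻¹ • (hamiltonian V hV (fieldEvolution V hV E r (φ : OneParticle d)) +
          I • fieldEvolution V hV E r (I • fieldHamiltonian V hV E φ)) : OneParticle d) x := by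
      funext x
      show _ = (E : ℂ)⁻¹ * (hamiltonian V hV (fieldEvolution V hV E r (φ : OneParticle d)) x +
          I * fieldEvolution V hV E r (I • fieldHamiltonian V hV E φ) x)
      rw [h x, ← mul_assoc, I_mul_I]
      field_simp
      ring
    rw [e]
    exact lp.memℓp _

/-- Both sides are the derivative at `t = 0` of `U_t U_r φ`. -/
theorem fieldEvolution_fieldHamiltonian (E : ℝ) (φ : (positionOp d).domain) (r : ℝ) :
    fieldEvolution V hV E r (I • fieldHamiltonian V hV E φ) =
      I • fieldHamiltonian V hV E ⟨_, fieldEvolution_mem_domain V hV E φ r⟩ :=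
  (hasDerivAt_fieldEvolution_apply V hV E φ r).unique
    ((fieldEvolution_spec V hV E).hasDerivAt ⟨_, fieldEvolution_mem_domain V hV E φ r⟩)

/-- The rate of change of `e^{-ish_E} ρ e^{ish_E}` is `iE` times the rotated commutator of `Q₁` and
`ρ`, if `ρ` commutes with `h`. -/
theorem hasDerivAt_inner_fieldEvolution {ρ K : OneParticle d →L[ℂ] OneParticle d}
    (hρ : ρ * hamiltonian V hV = hamiltonian V hV * ρ) (hK : IsPositionCommutator ρ K) (E : ℝ)
    (φ ψ : (positionOp d).domain) (s : ℝ) :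
    HasDerivAt (fun s => inner ℂ (fieldEvolution V hV E s (φ : OneParticle d))
        (ρ (fieldEvolution V hV E s (ψ : OneParticle d))))
      (E * inner ℂ (fieldEvolution V hV E s (φ : OneParticle d))
        (I • K (fieldEvolution V hV E s (ψ : OneParticle d)))) s := by
  have h1 := hasDerivAt_fieldEvolution V hV E φ s
  have h2 := (ρ.restrictScalars ℝ).hasFDerivAt.comp_hasDerivAt s
    (hasDerivAt_fieldEvolution V hV E ψ s)
  refine (h1.inner ℂ h2).congr_deriv ?_
  show inner ℂ (fieldEvolution V hV E s (φ : OneParticle d))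
      (ρ (fieldEvolution V hV E s (I • fieldHamiltonian V hV E ψ))) +
    inner ℂ (fieldEvolution V hV E s (I • fieldHamiltonian V hV E φ))
      (ρ (fieldEvolution V hV E s (ψ : OneParticle d))) = _
  rw [fieldEvolution_fieldHamiltonian, fieldEvolution_fieldHamiltonian]
  set χ : (positionOp d).domain := ⟨_, fieldEvolution_mem_domain V hV E φ s⟩ with hχ
  set ξ : (positionOp d).domain := ⟨_, fieldEvolution_mem_domain V hV E ψ s⟩ with hξ
  obtain ⟨hmem, hval⟩ := hK ξ
  -- This is where `ρ` commuting with `h` is used: the two contributions of `h` cancel, and those of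
  -- `E Q₁` combine to the commutator.
  have h3 : inner ℂ (χ : OneParticle d) (ρ (hamiltonian V hV ξ)) =
      inner ℂ (hamiltonian V hV χ) (ρ ξ) := by
    rw [inner_hamiltonian]
    congr 1
    exact DFunLike.congr_fun hρ (ξ : OneParticle d)
  have h4 := inner_positionOp χ ⟨_, hmem⟩
  show inner ℂ (χ : OneParticle d) (ρ (I • fieldHamiltonian V hV E ξ)) +
    inner ℂ (I • fieldHamiltonian V hV E χ) (ρ ξ) =
      E * inner ℂ (χ : OneParticle d) (I • K ξ)
  rw [hval, fieldHamiltonian_apply, fieldHamiltonian_apply]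
  simp only [map_smul, map_sub, inner_smul_left, inner_smul_right, inner_sub_left, inner_sub_right,
    conj_I, conj_ofReal, h3, ← h4]
  ring

end FieldEvolution

/-! ### Laplace transforms and an elementary criterion for differentiability. -/

section LaplaceTransform

theorem integrableOn_exp_mul {b C : ℝ} (hb : 0 < b) {f : ℝ → ℂ} (hf : Continuous f)
    (hC : ∀ s, ‖f s‖ ≤ C) :
    MeasureTheory.IntegrableOn (fun s => (Real.exp (-b * s) : ℂ) * f s) (Set.Ioi 0) := by
  have h1 : MeasureTheory.IntegrableOn (fun s => (Real.exp (-b * s) : ℂ)) (Set.Ioi 0) :=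
    (exp_neg_integrableOn_Ioi 0 hb).ofReal
  exact h1.mul_bdd hf.aestronglyMeasurable (Eventually.of_forall hC)

/-- Integration by parts for the Laplace transform of a bounded function. -/
theorem integral_exp_mul_eq {b C C' : ℝ} (hb : 0 < b) {f f' : ℝ → ℂ}
    (hf : ∀ s, HasDerivAt f (f' s) s) (hf' : Continuous f') (hC : ∀ s, ‖f s‖ ≤ C)
    (hC' : ∀ s, ‖f' s‖ ≤ C') :
    ∫ s in Set.Ioi (0 : ℝ), (Real.exp (-b * s) : ℂ) * (b * f s) =
      f 0 + ∫ s in Set.Ioi (0 : ℝ), (Real.exp (-b * s) : ℂ) * f' s := by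
  have hfc : Continuous f := continuous_iff_continuousAt.2 fun s => (hf s).continuousAt
  have i1 := integrableOn_exp_mul hb (f := fun s => b * f s) (C := |b| * C)
    (continuous_const.mul hfc) (fun s => by
      rw [norm_mul, norm_real, Real.norm_eq_abs]
      exact mul_le_mul_of_nonneg_left (hC s) (abs_nonneg _))
  have i2 := integrableOn_exp_mul hb hf' hC'
  have hexp : ∀ s, HasDerivAt (fun s : ℝ => (Real.exp (-b * s) : ℂ))
      ((Real.exp (-b * s) * (-b) : ℝ) : ℂ) s := fun s => by
    have h1 : HasDerivAt (fun s : ℝ => -b * s) (-b) s := by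
      simpa using (hasDerivAt_id s).const_mul (-b)
    exact h1.exp.ofReal_comp
  have hder : ∀ s ∈ Set.Ici (0 : ℝ), HasDerivAt (fun s => -((Real.exp (-b * s) : ℂ) * f s))
      ((Real.exp (-b * s) : ℂ) * (b * f s) - (Real.exp (-b * s) : ℂ) * f' s) s := fun s _ => by
    refine ((hexp s).mul (hf s)).neg.congr_deriv ?_
    push_cast
    ring
  have hlim : Tendsto (fun s => -((Real.exp (-b * s) : ℂ) * f s)) atTop (𝓝 0) := by
    have h1 : Tendsto (fun s : ℝ => Real.exp (-b * s) * C) atTop (𝓝 0) := by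
      have h2 : Tendsto (fun s : ℝ => Real.exp (-b * s)) atTop (𝓝 0) :=
        Real.tendsto_exp_atBot.comp (tendsto_id.const_mul_atTop_of_neg (neg_neg_of_pos hb))
      simpa using h2.mul_const C
    refine squeeze_zero_norm (fun s => ?_) h1
    rw [norm_neg, norm_mul, norm_real, Real.norm_eq_abs, Real.abs_exp]
    exact mul_le_mul_of_nonneg_left (hC s) (Real.exp_pos _).le
  have h := MeasureTheory.integral_Ioi_of_hasDerivAt_of_tendsto' hder (i1.sub i2) hlim
  rw [MeasureTheory.integral_sub i1 i2, mul_zero, Real.exp_zero] at h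
  push_cast at h ⊢
  linear_combination h

/-- The difference quotient at `0` is `Φ` itself, so continuity of `Φ` at `0` suffices and the
evolution need not be differentiated in `E`. -/
theorem hasDerivAt_of_eq_add_mul {F Φ : ℝ → ℂ} {a : ℂ} (h : ∀ E : ℝ, F E = a + E * Φ E)
    (hΦ : Tendsto Φ (𝓝 0) (𝓝 (Φ 0))) : HasDerivAt F (Φ 0) 0 := by
  rw [hasDerivAt_iff_tendsto_slope_zero]
  refine (hΦ.mono_left nhdsWithin_le_nhds).congr' ?_
  filter_upwards [self_mem_nhdsWithin] with t ht
  have ht' : (t : ℂ) ≠ 0 := by exact_mod_cast ht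
  rw [zero_add, h, h, real_smul]
  push_cast
  field_simp
  ring

end LaplaceTransform

/-! ### The current in the steady state and its linear response. -/

section LinearResponse

variable {d : ℕ} [NeZero d] (V : Lattice d → ℝ) (hV : ∃ C, ∀ x, |V x| ≤ C)

/-- The function `⟨e^{ish_E} φ, B e^{ish_E} ψ⟩` of `s`. -/
noncomputable def fieldCorrelation (B : OneParticle d →L[ℂ] OneParticle d) (φ ψ : OneParticle d)
    (E s : ℝ) : ℂ :=
  inner ℂ (fieldEvolution V hV E s φ) (B (fieldEvolution V hV E s ψ))

theorem continuous_fieldCorrelation (B : OneParticle d →L[ℂ] OneParticle d) (φ ψ : OneParticle d)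
    (E : ℝ) : Continuous (fieldCorrelation V hV B φ ψ E) :=
  ((fieldEvolution_spec V hV E).continuous φ).inner
    (B.continuous.comp ((fieldEvolution_spec V hV E).continuous ψ))

theorem norm_fieldCorrelation_le (B : OneParticle d →L[ℂ] OneParticle d) (φ ψ : OneParticle d)
    (E s : ℝ) : ‖fieldCorrelation V hV B φ ψ E s‖ ≤ ‖φ‖ * (‖B‖ * ‖ψ‖) := by
  refine (norm_inner_le_norm _ _).trans ?_
  rw [LinearIsometryEquiv.norm_map]
  refine mul_le_mul_of_nonneg_left ((B.le_opNorm _).trans ?_) (norm_nonneg _)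
  rw [LinearIsometryEquiv.norm_map]

theorem fieldCorrelation_zero (B : OneParticle d →L[ℂ] OneParticle d) (φ ψ : OneParticle d)
    (E : ℝ) : fieldCorrelation V hV B φ ψ E 0 = inner ℂ φ (B ψ) := by
  rw [fieldCorrelation, (fieldEvolution_spec V hV E).map_zero,
    (fieldEvolution_spec V hV E).map_zero]

/-- Integration by parts, exact for every `E`: the explicit factor `E` comes from the derivative of
the correlation and no expansion in the field is made. -/
theorem integral_fieldCorrelation {ρ K : OneParticle d →L[ℂ] OneParticle d}
    (hρ : ρ * hamiltonian V hV = hamiltonian V hV * ρ) (hK : IsPositionCommutator ρ K)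
    {b : ℝ} (hb : 0 < b) (φ ψ : (positionOp d).domain) (E : ℝ) :
    ∫ s in Set.Ioi (0 : ℝ), (Real.exp (-b * s) : ℂ) * (b * fieldCorrelation V hV ρ φ ψ E s) =
      inner ℂ (φ : OneParticle d) (ρ ψ) + E * ∫ s in Set.Ioi (0 : ℝ),
        (Real.exp (-b * s) : ℂ) * fieldCorrelation V hV (I • K) φ ψ E s := by
  rw [integral_exp_mul_eq hb (f := fieldCorrelation V hV ρ φ ψ E) (C' := |E| * (‖(φ : OneParticle d)‖ * (‖I • K‖ * ‖(ψ : OneParticle d)‖)))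
    (fun s => hasDerivAt_inner_fieldEvolution V hV hρ hK E φ ψ s)
    (continuous_const.mul (continuous_fieldCorrelation V hV (I • K) φ ψ E))
    (norm_fieldCorrelation_le V hV ρ φ ψ E) (fun s => by
      rw [norm_mul, norm_real, Real.norm_eq_abs]
      exact mul_le_mul_of_nonneg_left (norm_fieldCorrelation_le V hV (I • K) φ ψ E s)
        (abs_nonneg _)), fieldCorrelation_zero, ← MeasureTheory.integral_const_mul]
  congr 2
  funext s
  exact mul_left_comm _ _ _

/-- For each `s` the groups converge on `D(Q₁)`; since they are isometric, a multiple of `e^{-bs}`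
dominates uniformly in `E`. -/
theorem tendsto_integral_fieldCorrelation (B : OneParticle d →L[ℂ] OneParticle d)
    {b : ℝ} (hb : 0 < b) (φ ψ : (positionOp d).domain) :
    Tendsto (fun E => ∫ s in Set.Ioi (0 : ℝ),
        (Real.exp (-b * s) : ℂ) * fieldCorrelation V hV B φ ψ E s) (𝓝 0)
      (𝓝 (∫ s in Set.Ioi (0 : ℝ),
        (Real.exp (-b * s) : ℂ) * fieldCorrelation V hV B φ ψ 0 s)) := by
  refine MeasureTheory.tendsto_integral_filter_of_dominated_convergence
    (fun s => Real.exp (-b * s) * (‖(φ : OneParticle d)‖ * (‖B‖ * ‖(ψ : OneParticle d)‖)))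
    (Eventually.of_forall fun E => ?_) (Eventually.of_forall fun E =>
      Eventually.of_forall fun s => ?_) ?_ (Eventually.of_forall fun s => ?_)
  · exact (integrableOn_exp_mul hb (continuous_fieldCorrelation V hV B φ ψ E)
      (norm_fieldCorrelation_le V hV B φ ψ E)).aestronglyMeasurable
  · rw [norm_mul, norm_real, Real.norm_eq_abs, Real.abs_exp]
    exact mul_le_mul_of_nonneg_left (norm_fieldCorrelation_le V hV B φ ψ E s) (Real.exp_pos _).le
  · exact (exp_neg_integrableOn_Ioi 0 hb).mul_const _
  · refine Tendsto.const_mul _ ?_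
    simp only [fieldCorrelation]
    rw [fieldEvolution_field_zero, fieldEvolution_field_zero]
    exact (tendsto_fieldEvolution V hV φ s).inner
      ((B.continuous.tendsto _).comp (tendsto_fieldEvolution V hV ψ s))

theorem velocityOp_basisVec (x : Lattice d) :
    velocityOp d (basisVec x) = -(I • (basisVec (x - unitVec 0) - basisVec (x + unitVec 0))) := by
  have h : ∀ v : Lattice d, translation v (basisVec x) = basisVec (x - v) := fun v => by
    refine lp_ext fun y => ?_
    rw [translation_apply, basisVec_apply, basisVec_apply]
    simp only [eq_sub_iff_add_eq]
  show -(I • (translation (unitVec 0) (basisVec x) - translation (-unitVec 0) (basisVec x))) = _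
  rw [h, h, sub_neg_eq_add]

theorem velocityOp_basisVec_mem_domain (x : Lattice d) :
    velocityOp d (basisVec x) ∈ (positionOp d).domain := by
  rw [velocityOp_basisVec]
  exact neg_mem (Submodule.smul_mem _ _
    (sub_mem (basisVec_mem_domain _) (basisVec_mem_domain _)))

/-- The operator `e^{-ish}` is moved to the left factor as an adjoint. Both vectors have finite
support, hence lie in `D(Q₁)`, where the group at zero field is `e^{ish}`. -/
theorem kuboIntegrand_eq (lam : ℝ) (K : OneParticle d →L[ℂ] OneParticle d) (x : Lattice d) :
    kuboIntegrand V hV lam K (velocityOp d) x = fun s => (Real.exp (-(2 * lam) * s) : ℂ) *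
      fieldCorrelation V hV (I • K) (basisVec x) (velocityOp d (basisVec x)) 0 s := by
  funext s
  rw [kuboIntegrand, fieldCorrelation,
    fieldEvolution_field_zero V hV ⟨basisVec x, basisVec_mem_domain x⟩,
    fieldEvolution_field_zero V hV ⟨_, velocityOp_basisVec_mem_domain x⟩, neg_mul, ← star_evolution,
    ContinuousLinearMap.star_eq_adjoint, ContinuousLinearMap.adjoint_inner_right, ← neg_mul]
  rfl

variable {A : Type*} [CStarAlgebra A]

/-- Averaging the two flows yields the symmetrized density of the velocity at `x`, which brings the
two-point function of `η_x` and `v₁ η_x` into play. -/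
theorem currentObservable_eq (c : CARAlgebra (OneParticle d) A) (x : Lattice d) :
    currentObservable c x = (1 / 2 : ℂ) • (c.cre (basisVec x) * c.ann (velocityOp d (basisVec x)) +
      c.cre (velocityOp d (basisVec x)) * c.ann (basisVec x)) := by
  rw [velocityOp_basisVec, CARAlgebra.cre, CARAlgebra.cre, currentObservable, flow, flow]
  simp only [CARAlgebra.cre, map_neg, map_sub, LinearMap.map_smulₛₗ, star_neg, star_smul, star_sub,
    mul_neg, neg_mul, mul_sub, sub_mul, mul_smul_comm, smul_mul_assoc, conj_I, RCLike.star_def]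
  module

variable [PartialOrder A] [StarOrderedRing A]

/-- The two terms of the symmetrized current have complex conjugate values, because `f(h)` is
self-adjoint; half their sum is the real part that appears in the conductivity. -/
theorem tendsto_currentObservable (c : CARAlgebra (OneParticle d) A) (β μ : ℝ) {lam : ℝ}
    (hlam : 0 < lam) (E : ℝ) (φ : ∀ N, BoxEigenbasis V hV N) {S : QuantumDynamicalSemigroup A}
    (hS : ∀ t x, Tendsto (fun N => (daviesSemigroup c β μ hlam E (φ N)).map t x) atTop
      (𝓝 (S.map t x))) (x : Lattice d) :
    Tendsto (fun t => S.map t (currentObservable c x)) atTop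
      (𝓝 (((∫ s in Set.Ioi (0 : ℝ), (Real.exp (-(2 * lam) * s) : ℂ) * ((2 * lam : ℝ) *
        fieldCorrelation V hV (fermiOp V hV β μ) (basisVec x) (velocityOp d (basisVec x)) E s)).re :
          ℂ) • (1 : A))) := by
  have happ := isDissipativeApproximation c β μ hlam E φ
  set ρ := fermiOp V hV β μ
  set v := velocityOp d (basisVec x)
  have h1 := happ.tendsto_atTop_cre_mul_ann hlam hS ρ.continuous (basisVec x) v
  have h2 := happ.tendsto_atTop_cre_mul_ann hlam hS ρ.continuous v (basisVec x)
  have hsymm : ∀ f g, inner ℂ f (ρ g) = starRingEnd ℂ (inner ℂ g (ρ f)) := fun f g => by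
    rw [inner_conj_symm]
    exact ((ContinuousLinearMap.isSelfAdjoint_iff_isSymmetric.1
      (isSelfAdjoint_functionOf (fermiDirac β μ) (hamiltonian V hV))) f g).symm
  have h3 := (h1.add h2).const_smul (1 / 2 : ℂ)
  rw [currentObservable_eq]
  simp only [map_smul, map_add]
  convert h3 using 2
  rw [← add_smul, smul_smul]
  congr 1
  rw [re_eq_add_conj, ← integral_conj]
  simp only [fieldCorrelation, real_smul, map_mul, conj_ofReal, LinearIsometryEquiv.coe_toLinearIsometry]
  simp_rw [hsymm (fieldEvolution V hV E _ v)]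
  push_cast
  ring

/-- The linear response of the current. -/
theorem hasDerivAt_current {β μ lam : ℝ} (hlam : 0 < lam) {K : OneParticle d →L[ℂ] OneParticle d}
    (hK : IsPositionCommutator (fermiOp V hV β μ) K) (x : Lattice d) :
    HasDerivAt (fun E : ℝ => (((∫ s in Set.Ioi (0 : ℝ), (Real.exp (-(2 * lam) * s) : ℂ) *
        ((2 * lam : ℝ) * fieldCorrelation V hV (fermiOp V hV β μ) (basisVec x)
          (velocityOp d (basisVec x)) E s)).re : ℝ) : ℂ))
      (((∫ s in Set.Ioi (0 : ℝ), kuboIntegrand V hV lam K (velocityOp d) x s).re : ℝ) : ℂ) 0 := by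
  have hb : 0 < 2 * lam := by positivity
  have h := hasDerivAt_of_eq_add_mul
    (integral_fieldCorrelation V hV (functionOf_commute _ (isSelfAdjoint_hamiltonian (V := V)
      (hV := hV))) hK hb ⟨_, basisVec_mem_domain x⟩ ⟨_, velocityOp_basisVec_mem_domain x⟩)
    (tendsto_integral_fieldCorrelation V hV (I • K) hb ⟨_, basisVec_mem_domain x⟩
      ⟨_, velocityOp_basisVec_mem_domain x⟩)
  rw [kuboIntegrand_eq]
  exact (ofRealCLM.comp reCLM).hasFDerivAt.comp_hasDerivAt 0 h

end LinearResponse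

end Davies

/-! ### The theorem. -/

theorem theorem2p1 {d : ℕ} [NeZero d] (V : Davies.Lattice d → ℝ) (hV : ∃ C, ∀ x, |V x| ≤ C)
    (β μ lam : ℝ) (hlam : 0 < lam)
    {A : Type*} [CStarAlgebra A] [PartialOrder A] [StarOrderedRing A] [Nontrivial A]
    (c : Davies.CARAlgebra (Davies.OneParticle d) A)
    (φ : ∀ N, Davies.BoxEigenbasis V hV N) :
    ∃ (T : ℝ → Davies.QuantumDynamicalSemigroup A) (ω : ℝ → Davies.State A),
      -- the infinite-volume dissipative dynamics in the field `E`
      (∀ (E : ℝ) (t : ℝ≥0) (a : A),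
        Tendsto (fun N => (Davies.daviesSemigroup c β μ hlam E (φ N)).map t a) atTop
          (𝓝 ((T E).map t a))) ∧
      -- `ω E` is the steady state that is reached in the field `E`
      (∀ (E : ℝ) (ψ : Davies.State A) (a : A),
        Tendsto (fun t : ℝ≥0 => ψ ((T E).map t a)) atTop (𝓝 (ω E a))) ∧
      -- `K = [Q₁, f(h)]`, and `v = i[h, Q₁]`, which does not depend on the potential
      ∃ K v : Davies.OneParticle d →L[ℂ] Davies.OneParticle d,
        Davies.IsPositionCommutator (Davies.fermiOp V hV β μ) K ∧
        (∀ (W : Davies.Lattice d → ℝ) (hW : ∃ C, ∀ x, |W x| ≤ C), Davies.IsVelocity W hW v) ∧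
        -- the current is differentiable at `E = 0`, with the conductivity as derivative
        ∀ x : Davies.Lattice d,
          MeasureTheory.IntegrableOn (Davies.kuboIntegrand V hV lam K v x) (Set.Ioi 0) ∧
          HasDerivAt (fun E : ℝ => ω E (Davies.currentObservable c x))
            (((∫ s in Set.Ioi (0 : ℝ), Davies.kuboIntegrand V hV lam K v x s).re : ℝ) : ℂ) 0 := by
  have happ := fun E => Davies.isDissipativeApproximation c β μ hlam E φ
  choose T hT using fun E => (happ E).exists_limit hlam.le
  choose ω hω using fun E =>
    Davies.exists_state_of_tendsto ((happ E).exists_tendsto_atTop hlam (hT E))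
  obtain ⟨K, hK⟩ := Davies.exists_isPositionCommutator_fermiOp V hV β μ
  refine ⟨T, ω, hT, fun E ψ a => ψ.tendsto_of_tendsto_smul_one (hω E a), K, Davies.velocityOp d, hK,
    fun W hW => Davies.isVelocity_velocityOp W hW, fun x => ⟨?_, ?_⟩⟩
  · rw [Davies.kuboIntegrand_eq]
    exact Davies.integrableOn_exp_mul (by positivity)
      (Davies.continuous_fieldCorrelation V hV _ _ _ 0)
      (Davies.norm_fieldCorrelation_le V hV _ _ _ 0)
  -- The steady-state current is read off from the coefficient of the identity, which is unique
  -- because the algebra is nontrivial.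
  · have h : (fun E : ℝ => ω E (Davies.currentObservable c x)) = _ := funext fun E =>
      smul_left_injective ℂ (one_ne_zero (α := A)) (tendsto_nhds_unique (hω E _)
        (Davies.tendsto_currentObservable V hV c β μ hlam E φ (hT E) x))
    rw [h]
    exact Davies.hasDerivAt_current V hV hlam hK x
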